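/- Let $d\ge 1$ and let $\Omega$ be the set of locally finite subsets of $\mathbb{R}^d$ (point configurations), with the $\sigma$-algebra generated by the events $\{X : N_X(B)=m\}$, $B\subset\mathbb{R}^d$ Borel, $m\in\mathbb{N}$, where $N_X(B)=\operatorname{card}(X\cap B)$. A (simple) point process $X$ is a random element of $\Omega$; write $N(B)=N_X(B)$. $X$ is *negatively associated* if for all finite families of pairwise disjoint bounded Borel sets $(A_i)_{1\le i\le k}$ and $(B_j)_{1\le j\le l}$ with $(\bigcup_i A_i)\cap(\bigcup_j B_j)=\emptyset$ and all coordinatewise increasing $F:\mathbb{N}^k\to\mathbb{R}$, $G:\mathbb{N}^l\to\mathbb{R}$, $$\mathbb{E}\big[F(N(A_1),\dots,N(A_k))\,G(N(B_1),\dots,N(B_l))\big]\le \mathbb{E}\big[F(N(A_1),\dots,N(A_k))\big]\,\mathbb{E}\big[G(N(B_1),\dots,N(B_l))\big]$$ whenever these expectations exist. It is *positively associated* if the reverse inequality holds for all finite families of pairwise disjoint bounded Borel sets $(A_i)$ and $(B_j)$, not necessarily with $(\bigcup_i A_i)\cap(\bigcup_j B_j)=\emptyset$. It is *associated* if it is negatively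 or positively associated. A measurable function $\rho_n:(\mathbb{R}^d)^n\to[0,\infty)$ is an *$n$-th order intensity function* of $X$ if, for every measurable $f:(\mathbb{R}^d)^n\to[0,\infty]$, $$\mathbb{E}\Big[\sum_{x_1,\dots,x_n\in X\text{ pairwise distinct}} f(x_1,\dots,x_n)\Big]=\int_{(\mathbb{R}^d)^n} f(x_1,\dots,x_n)\,\rho_n(x_1,\dots,x_n)\,dx_1\cdots dx_n .$$ Fix $s\ge R>0$ and, for $i\in\mathbb{Z}^d$, let $C_i$ be the closed axis-parallel cube with centre $R\,i$ and side length $s$. Let $(f_i)_{i\in\mathbb{Z}^d}$ be measurable functions $\Omega\to\mathbb{R}$ and put $$Y_i=f_i(X\cap C_i)-\mathbb{E}[f_i(X\cap C_i)],\qquad i\in\mathbb{Z}^d .$$ Let $(I_n)_{n\in\mathbb{N}}$ be a strictly increasing sequence of finite subsets of $\mathbb{Z}^d$, $S_n=\sum_{i\in I_n}Y_i$ and $\sigma_n^2=\operatorname{Var}(S_n)$. **Theorem 3.1.** Assume that for some $\epsilon,\delta>0$: 1. $X$ is an associated point process on $\mathbb{R}^d$ which has first and second order intensity functions $\rho_1$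 and $\rho_2$; 2. $\sup_{i\in\mathbb{Z}^d}\|Y_i\|_{2+\delta}<\infty$, where $\|Y\|_p=\mathbb{E}[|Y|^p]^{1/p}$; 3. with $D(x,y)=\rho_2(x,y)-\rho_1(x)\rho_1(y)$ and $|x-y|$ the Euclidean norm, $\displaystyle\sup_{|x-y|\ge r}|D(x,y)|=o\big(r^{-(d+\epsilon)\frac{2+\delta}{\delta}}\big)$ as $r\to\infty$; 4. $\displaystyle\liminf_{n\to\infty}|I_n|^{-1}\sigma_n^2>0$, where $|I_n|$ is the cardinality of $I_n$. Then, as $n\to\infty$, $$\frac{1}{\sigma_n}S_n\overset{\mathcal{L}}{\longrightarrow}\mathcal{N}(0,1).$$ -/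

import Mathlib

open MeasureTheory ProbabilityTheory Filter Topology
open scoped ENNReal

namespace AssocPP

/-- A locally finite configuration of (distinct) points of `ℝ^d`. -/
@[ext]
structure Config (d : ℕ) where
  carrier : Set (EuclideanSpace ℝ (Fin d))
  finite_inter : ∀ B : Set (EuclideanSpace ℝ (Fin d)),
    Bornology.IsBounded B → (carrier ∩ B).Finite

namespace Config

variable {d : ℕ}

/-- The number `N(B)` of points of the configuration in `B`; it is finite for bounded `B`. -/
noncomputable def count (B : Set (EuclideanSpace ℝ (Fin d))) (X : Config d) : ℕ∞ :=
  (X.carrier ∩ B).encard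

/-- The configuration `X ∩ A`. -/
def restrict (A : Set (EuclideanSpace ℝ (Fin d))) (X : Config d) : Config d where
  carrier := X.carrier ∩ A
  finite_inter := fun B hB =>
    (X.finite_inter B hB).subset fun _ hx => ⟨hx.1.1, hx.2⟩

/-- The σ-algebra on configurations generated by the events `{N(B) = m}`, `B` Borel, `m ∈ ℕ`. -/
instance : MeasurableSpace (Config d) :=
  MeasurableSpace.generateFrom
    {S | ∃ (B : Set (EuclideanSpace ℝ (Fin d))) (m : ℕ),
      MeasurableSet B ∧ S = {X | count B X = (m : ℕ∞)}}

end Config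

section PointProcess

/- A point process on `ℝ^d` is a measurable map `X : 𝓢 → Config d` on a probability space. -/
variable {d : ℕ} {𝓢 : Type*} [MeasurableSpace 𝓢]

/-- The random vector `(N(A₁), …, N(A_k))`; used for bounded `A_i`, whose counts are finite. -/
noncomputable def countVec {k : ℕ} (X : 𝓢 → Config d)
    (A : Fin k → Set (EuclideanSpace ℝ (Fin d))) (ω : 𝓢) : Fin k → ℕ :=
  fun i => (Config.count (A i) (X ω)).toNat

/-- A finite family of pairwise disjoint bounded Borel sets. -/
def IsDisjointFamily {k : ℕ} (A : Fin k → Set (EuclideanSpace ℝ (Fin d))) : Prop :=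
  (∀ i, MeasurableSet (A i)) ∧ (∀ i, Bornology.IsBounded (A i)) ∧
    Pairwise (fun i j => Disjoint (A i) (A j))

/-- Negative association. `Monotone` on `Fin k → ℕ` is coordinate-wise monotonicity; the
inequality is required whenever its three expectations exist. -/
def IsNegAssociated (X : 𝓢 → Config d) (P : Measure 𝓢) : Prop :=
  ∀ (k l : ℕ) (A : Fin k → Set (EuclideanSpace ℝ (Fin d)))
    (B : Fin l → Set (EuclideanSpace ℝ (Fin d))) (F : (Fin k → ℕ) → ℝ) (G : (Fin l → ℕ) → ℝ),
    IsDisjointFamily A → IsDisjointFamily B → Disjoint (⋃ i, A i) (⋃ j, B j) →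
    Monotone F → Monotone G →
    Integrable (fun ω => F (countVec X A ω)) P →
    Integrable (fun ω => G (countVec X B ω)) P →
    Integrable (fun ω => F (countVec X A ω) * G (countVec X B ω)) P →
    ∫ ω, F (countVec X A ω) * G (countVec X B ω) ∂P
      ≤ (∫ ω, F (countVec X A ω) ∂P) * ∫ ω, G (countVec X B ω) ∂P

/-- Positive association: the reverse inequality, where sets of the first family may meet sets of
the second one. -/
def IsPosAssociated (X : 𝓢 → Config d) (P : Measure 𝓢) : Prop :=
  ∀ (k l : ℕ) (A : Fin k → Set (EuclideanSpace ℝ (Fin d)))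
    (B : Fin l → Set (EuclideanSpace ℝ (Fin d))) (F : (Fin k → ℕ) → ℝ) (G : (Fin l → ℕ) → ℝ),
    IsDisjointFamily A → IsDisjointFamily B →
    Monotone F → Monotone G →
    Integrable (fun ω => F (countVec X A ω)) P →
    Integrable (fun ω => G (countVec X B ω)) P →
    Integrable (fun ω => F (countVec X A ω) * G (countVec X B ω)) P →
    (∫ ω, F (countVec X A ω) ∂P) * ∫ ω, G (countVec X B ω) ∂P
      ≤ ∫ ω, F (countVec X A ω) * G (countVec X B ω) ∂P

/-- Associated: negatively or positively associated. -/
def IsAssociated (X : 𝓢 → Config d) (P : Measure 𝓢) : Prop :=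
  IsNegAssociated X P ∨ IsPosAssociated X P

/-- `ρ` is (a version of) the `n`-th order intensity function of `X`: the expected sum of `f` over
`n`-tuples of pairwise distinct points of `X` is the Lebesgue integral of `f * ρ`, for all
measurable `f` with values in `[0, ∞]`. -/
def IsIntensity (X : 𝓢 → Config d) (P : Measure 𝓢) (n : ℕ)
    (ρ : (Fin n → EuclideanSpace ℝ (Fin d)) → ℝ) : Prop :=
  Measurable ρ ∧ (∀ x, 0 ≤ ρ x) ∧
    ∀ f : (Fin n → EuclideanSpace ℝ (Fin d)) → ℝ≥0∞, Measurable f →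
      ∫⁻ ω, ∑' x : {x : Fin n → EuclideanSpace ℝ (Fin d) //
          Function.Injective x ∧ ∀ i, x i ∈ (X ω).carrier}, f x.1 ∂P
        = ∫⁻ x, f x * ENNReal.ofReal (ρ x)

end PointProcess

section Field

variable {d : ℕ}

/-- `D(x, y) = ρ₂(x, y) - ρ₁(x) ρ₁(y)`. -/
def pairCov (ρ₁ : (Fin 1 → EuclideanSpace ℝ (Fin d)) → ℝ)
    (ρ₂ : (Fin 2 → EuclideanSpace ℝ (Fin d)) → ℝ) (x y : EuclideanSpace ℝ (Fin d)) : ℝ :=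
  ρ₂ ![x, y] - ρ₁ ![x] * ρ₁ ![y]

/-- `sup_{|x - y| ≥ r} |D(x, y)|`, with value in `[0, ∞]`. -/
noncomputable def supBeyond
    (D : EuclideanSpace ℝ (Fin d) → EuclideanSpace ℝ (Fin d) → ℝ) (r : ℝ) : ℝ≥0∞ :=
  ⨆ (x : EuclideanSpace ℝ (Fin d)) (y : EuclideanSpace ℝ (Fin d)) (_ : r ≤ ‖x - y‖),
    ENNReal.ofReal |D x y|

/-- The closed axis-parallel cube `C_i` with centre `R • i` and side length `s`. -/
def cube (R s : ℝ) (i : Fin d → ℤ) : Set (EuclideanSpace ℝ (Fin d)) :=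
  {x | ∀ k, |x k - R * (i k : ℝ)| ≤ s / 2}

variable {𝓢 : Type*} [MeasurableSpace 𝓢]

/-- The centred field `Y_i = f_i(X ∩ C_i) - E[f_i(X ∩ C_i)]`. -/
noncomputable def field (X : 𝓢 → Config d) (P : Measure 𝓢) (R s : ℝ)
    (f : (Fin d → ℤ) → Config d → ℝ) (i : Fin d → ℤ) (ω : 𝓢) : ℝ :=
  f i ((X ω).restrict (cube R s i)) - ∫ ω', f i ((X ω').restrict (cube R s i)) ∂P

/-- The partial sum `∑_{i ∈ I} Y_i`. -/
noncomputable def fieldSum (X : 𝓢 → Config d) (P : Measure 𝓢) (R s : ℝ)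
    (f : (Fin d → ℤ) → Config d → ℝ) (I : Finset (Fin d → ℤ)) (ω : 𝓢) : ℝ :=
  ∑ i ∈ I, field X P R s f i ω

end Field

end AssocPP

namespace AssocPP

/-! ### Counts and intensity functions -/

section Counts

variable {d : ℕ}

namespace Config

/-! The point process enters only through a covariance inequality. If a function `Φ` of counts is
Lipschitz with weights `a i`, then both `∑ a i * n i + Φ` and `∑ a i * n i - Φ` are increasing.
Association, applied to two such functions with all four choices of sign and added in pairs, cancels
the mixed terms. It bounds the covariance of `Φ` and `Ψ` by that of their linear parts, which for
disjoint sets is a weighted sum of integrals of `D` (`abs_crossCov_countVec_le`).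

A function of finitely many counts bounded by `M` is automatically Lipschitz, since distinct
integers differ by at least one. Cutting the sets into disjoint atoms gives a covariance bound
containing only `M`, the volumes of the cubes and the size of `D`, whatever the number of atoms. It
therefore survives `L¹` limits and holds for all bounded measurable functionals of the `X ∩ C_i`
(`abs_crossCov_restrict_le`).

From there on only the property `WeaklyDependent` of the field `X ∩ C_i` matters. Truncation at a
level adapted to the rate `t` turns it into Davydov's inequality with rate `t ^ (δ / (2 + δ))`, and
the decay exponent of `D` is what makes this power summable over `ℤ^d`. So truncating the `Y_i`
changes `S_n` by a term whose variance is a small multiple of `|I_n|`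
(`exists_variance_truncation_le`). By the lower bound on the variance this is negligible compared
with `σ_n²`.

Bounded fields are treated by Stein's method for characteristic functions, in Bolthausen's form. For
each site the sum is split into a near and a far part. Far sites are almost uncorrelated with the
given one, and the quadratic form of near products concentrates at its mean, which is almost the
variance (`norm_stein_le`). An approximate Stein equation is an approximate differential equation
`φ' = -s φ` for the characteristic function (`norm_charFun_sub_le_of_stein`). Lévy's continuity
theorem finishes the proof. -/

lemma count_restrict (A B : Set (EuclideanSpace ℝ (Fin d))) (X : Config d) :
    count B (X.restrict A) = count (A ∩ B) X := by
  simp [count, restrict, Set.inter_assoc]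

lemma measurable_count {B : Set (EuclideanSpace ℝ (Fin d))} (hB : MeasurableSet B) :
    Measurable (count B : Config d → ℕ∞) := by
  have hfin : ∀ m : ℕ, MeasurableSet {X : Config d | count B X = (m : ℕ∞)} := fun m =>
    MeasurableSpace.measurableSet_generateFrom ⟨B, m, hB, rfl⟩
  refine measurable_to_countable' fun x => ?_
  induction x using ENat.recTopCoe with
  | coe m => exact hfin m
  | top =>
    have : (count B : Config d → ℕ∞) ⁻¹' {⊤} = (⋃ m : ℕ, {X | count B X = (m : ℕ∞)})ᶜ := by
      ext X
      simp only [Set.mem_preimage, Set.mem_singleton_iff, Set.mem_compl_iff, Set.mem_iUnion,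
        Set.mem_ofPred_eq, not_exists]
      constructor
      · intro h m
        simp [h]
      · intro h
        by_contra hne
        exact h _ (ENat.natCast_toNat hne).symm
    rw [this]
    exact (MeasurableSet.iUnion hfin).compl

lemma measurable_restrict {A : Set (EuclideanSpace ℝ (Fin d))} (hA : MeasurableSet A) :
    Measurable (restrict A : Config d → Config d) := by
  refine measurable_generateFrom ?_
  rintro _ ⟨B, m, hB, rfl⟩
  have := measurable_count (hA.inter hB) (measurableSet_singleton (m : ℕ∞))
  simpa [Set.preimage, count_restrict] using this

lemma count_ne_top {B : Set (EuclideanSpace ℝ (Fin d))} (hB : Bornology.IsBounded B)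
    (X : Config d) : count B X ≠ ⊤ := by
  simpa [count] using X.finite_inter B hB

end Config

variable {𝓢 : Type*} [MeasurableSpace 𝓢] {X : 𝓢 → Config d} {P : Measure 𝓢}

lemma tsum_subtype_indicator {α : Type*} (p : α → Prop) (f : α → ℝ≥0∞) :
    ∑' x : {x // p x}, f x = ∑' x, Set.indicator {x | p x} f x :=
  tsum_subtype {x | p x} f

/-- Campbell's formula for the indicator of `A`, after identifying `Fin 1 → ℝ^d` with `ℝ^d`. -/
lemma lintegral_count {ρ₁ : (Fin 1 → EuclideanSpace ℝ (Fin d)) → ℝ} (hρ : IsIntensity X P 1 ρ₁)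
    {A : Set (EuclideanSpace ℝ (Fin d))} (hA : MeasurableSet A) :
    ∫⁻ ω, (Config.count A (X ω) : ℝ≥0∞) ∂P = ∫⁻ x in A, ENNReal.ofReal (ρ₁ ![x]) := by
  obtain ⟨hm, -, h⟩ := hρ
  have key := h (fun x => A.indicator 1 (x 0))
    ((measurable_one.indicator hA).comp (measurable_pi_apply 0))
  have h1 : ∀ ω, (Config.count A (X ω) : ℝ≥0∞) =
      ∑' x : {x : Fin 1 → EuclideanSpace ℝ (Fin d) //
          Function.Injective x ∧ ∀ i, x i ∈ (X ω).carrier}, A.indicator (1 : EuclideanSpace ℝ (Fin d) → ℝ≥0∞) (x.1 0) := by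
    intro ω
    rw [Config.count, ← ENNReal.tsum_set_one, tsum_subtype _ (fun _ => (1 : ℝ≥0∞)),
      tsum_subtype_indicator (fun x : Fin 1 → EuclideanSpace ℝ (Fin d) =>
        Function.Injective x ∧ ∀ i, x i ∈ (X ω).carrier) (fun x => A.indicator (1 : EuclideanSpace ℝ (Fin d) → ℝ≥0∞) (x 0)),
      ← (Equiv.funUnique (Fin 1) (EuclideanSpace ℝ (Fin d))).symm.tsum_eq]
    refine tsum_congr fun p => ?_
    by_cases h1 : p ∈ (X ω).carrier <;> by_cases h2 : p ∈ A <;>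
      simp [Set.indicator, h1, h2, Function.injective_of_subsingleton]
  simp_rw [h1, key]
  have hmp : MeasurePreserving (MeasurableEquiv.funUnique (Fin 1) (EuclideanSpace ℝ (Fin d)))
      volume volume := by
    convert volume_preserving_funUnique (Fin 1) (EuclideanSpace ℝ (Fin d))
  rw [← hmp.symm.lintegral_comp_emb (MeasurableEquiv.measurableEmbedding _),
    ← lintegral_indicator hA]
  refine lintegral_congr fun p => ?_
  have : (MeasurableEquiv.funUnique (Fin 1) (EuclideanSpace ℝ (Fin d))).symm p = ![p] := by
    ext i; fin_cases i; rfl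
  rw [this]
  by_cases h2 : p ∈ A <;> simp [Set.indicator, h2]

/-- Disjointness makes every pair in `A × B` a pair of distinct points, so the product of the counts
is a sum over distinct pairs and no diagonal term appears. -/
lemma lintegral_count_mul_count {ρ₂ : (Fin 2 → EuclideanSpace ℝ (Fin d)) → ℝ}
    (hρ : IsIntensity X P 2 ρ₂) {A B : Set (EuclideanSpace ℝ (Fin d))} (hA : MeasurableSet A)
    (hB : MeasurableSet B) (hAB : Disjoint A B) :
    ∫⁻ ω, (Config.count A (X ω) : ℝ≥0∞) * (Config.count B (X ω) : ℝ≥0∞) ∂P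
      = ∫⁻ x in A, ∫⁻ y in B, ENNReal.ofReal (ρ₂ ![x, y]) := by
  obtain ⟨hm, -, h⟩ := hρ
  have key := h (fun x => A.indicator 1 (x 0) * B.indicator 1 (x 1))
    (((measurable_one.indicator hA).comp (measurable_pi_apply 0)).mul
      ((measurable_one.indicator hB).comp (measurable_pi_apply 1)))
  have h1 : ∀ ω, (Config.count A (X ω) : ℝ≥0∞) * (Config.count B (X ω) : ℝ≥0∞) =
      ∑' x : {x : Fin 2 → EuclideanSpace ℝ (Fin d) //
          Function.Injective x ∧ ∀ i, x i ∈ (X ω).carrier},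
        A.indicator (1 : EuclideanSpace ℝ (Fin d) → ℝ≥0∞) (x.1 0) * B.indicator (1 : EuclideanSpace ℝ (Fin d) → ℝ≥0∞) (x.1 1) := by
    intro ω
    rw [Config.count, Config.count, ← ENNReal.tsum_set_one, ← ENNReal.tsum_set_one,
      tsum_subtype _ (fun _ => (1 : ℝ≥0∞)), tsum_subtype _ (fun _ => (1 : ℝ≥0∞)),
      tsum_subtype_indicator (fun x : Fin 2 → EuclideanSpace ℝ (Fin d) =>
        Function.Injective x ∧ ∀ i, x i ∈ (X ω).carrier) (fun x => A.indicator (1 : EuclideanSpace ℝ (Fin d) → ℝ≥0∞) (x 0) * B.indicator (1 : EuclideanSpace ℝ (Fin d) → ℝ≥0∞) (x 1)),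
      ← (finTwoArrowEquiv (EuclideanSpace ℝ (Fin d))).symm.tsum_eq, ENNReal.tsum_prod',
      ← ENNReal.tsum_mul_right]
    refine tsum_congr fun p => ?_
    rw [← ENNReal.tsum_mul_left]
    refine tsum_congr fun q => ?_
    by_cases hpA : p ∈ A <;> by_cases hqB : q ∈ B <;>
      simp only [Set.indicator, Set.mem_inter_iff, hpA, hqB, and_false, and_true, if_false,
        zero_mul, mul_zero, finTwoArrowEquiv_symm_apply, Matrix.cons_val_zero, Matrix.cons_val_one,
        ite_self]
    have hpq : p ≠ q := fun e => (Set.disjoint_left.1 hAB hpA) (e ▸ hqB)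
    have hinj : Function.Injective ![p, q] := by
      intro i j hij
      fin_cases i <;> fin_cases j
      exacts [rfl, absurd hij hpq, absurd hij.symm hpq, rfl]
    by_cases h1 : p ∈ (X ω).carrier <;> by_cases h2 : q ∈ (X ω).carrier <;>
      simp [h1, h2, hpA, hqB, hinj, Fin.forall_fin_two]
  simp_rw [h1, key]
  rw [← (volume_preserving_finTwoArrow (EuclideanSpace ℝ (Fin d))).symm.lintegral_comp_emb
    (MeasurableEquiv.measurableEmbedding _)]
  have e2 : ∀ p : EuclideanSpace ℝ (Fin d) × EuclideanSpace ℝ (Fin d),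
      (MeasurableEquiv.finTwoArrow (α := EuclideanSpace ℝ (Fin d))).symm p = ![p.1, p.2] :=
    fun p => rfl
  simp only [e2]
  rw [Measure.volume_eq_prod, lintegral_prod]
  · rw [← lintegral_indicator hA]
    refine lintegral_congr fun p => ?_
    by_cases hp : p ∈ A
    · simp only [Set.indicator_of_mem hp]
      rw [← lintegral_indicator hB]
      refine lintegral_congr fun q => ?_
      by_cases hq : q ∈ B <;> simp [Set.indicator, hq, hp]
    · simp [Set.indicator, hp]
  · have hv : Measurable (fun p : EuclideanSpace ℝ (Fin d) × EuclideanSpace ℝ (Fin d) =>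
        ![p.1, p.2]) := (MeasurableEquiv.finTwoArrow (α := EuclideanSpace ℝ (Fin d))).symm.measurable
    refine Measurable.aemeasurable ?_
    refine Measurable.mul ?_ (hm.comp hv).ennreal_ofReal
    exact ((measurable_one.indicator hA).comp measurable_fst).mul
      ((measurable_one.indicator hB).comp measurable_snd)

/-- The pair intensity and the product of the intensities have comparable integrals over
`A × B` when their difference is bounded there. -/
lemma lintegral_count_mul_le {ρ₁ : (Fin 1 → EuclideanSpace ℝ (Fin d)) → ℝ}
    {ρ₂ : (Fin 2 → EuclideanSpace ℝ (Fin d)) → ℝ} (hρ₁ : IsIntensity X P 1 ρ₁)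
    (hρ₂ : IsIntensity X P 2 ρ₂) {A B : Set (EuclideanSpace ℝ (Fin d))} (hA : MeasurableSet A)
    (hB : MeasurableSet B) (hAB : Disjoint A B) {g : ℝ≥0∞}
    (hg : ∀ x ∈ A, ∀ y ∈ B, ENNReal.ofReal |pairCov ρ₁ ρ₂ x y| ≤ g) :
    (∫⁻ ω, (Config.count A (X ω) : ℝ≥0∞) * (Config.count B (X ω) : ℝ≥0∞) ∂P
      ≤ (∫⁻ ω, (Config.count A (X ω) : ℝ≥0∞) ∂P) * (∫⁻ ω, (Config.count B (X ω) : ℝ≥0∞) ∂P)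
        + g * volume A * volume B) ∧
    (∫⁻ ω, (Config.count A (X ω) : ℝ≥0∞) ∂P) * (∫⁻ ω, (Config.count B (X ω) : ℝ≥0∞) ∂P)
      ≤ ∫⁻ ω, (Config.count A (X ω) : ℝ≥0∞) * (Config.count B (X ω) : ℝ≥0∞) ∂P
        + g * volume A * volume B := by
  have hm1 : Measurable fun x : EuclideanSpace ℝ (Fin d) => ENNReal.ofReal (ρ₁ ![x]) := by
    refine (hρ₁.1.comp (measurable_pi_lambda _ fun i => ?_)).ennreal_ofReal
    fin_cases i
    exact measurable_id
  have hprod : (∫⁻ ω, (Config.count A (X ω) : ℝ≥0∞) ∂P) *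
      (∫⁻ ω, (Config.count B (X ω) : ℝ≥0∞) ∂P)
      = ∫⁻ x in A, ∫⁻ y in B, ENNReal.ofReal (ρ₁ ![x]) * ENNReal.ofReal (ρ₁ ![y]) := by
    rw [lintegral_count hρ₁ hA, lintegral_count hρ₁ hB, ← lintegral_mul_const _ hm1]
    refine lintegral_congr fun x => ?_
    rw [lintegral_const_mul _ hm1]
  have hconst : g * volume A * volume B
      = ∫⁻ _ in A, ∫⁻ _ in B, g := by
    simp [mul_comm, mul_left_comm]
  rw [lintegral_count_mul_count hρ₂ hA hB hAB, hprod, hconst]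
  -- Both inequalities are proved in `[0, ∞]` without subtraction: each of the two densities is at
  -- most the other plus `g`.
  have comparison : ∀ u v : EuclideanSpace ℝ (Fin d) → EuclideanSpace ℝ (Fin d) → ℝ≥0∞,
      (∀ x ∈ A, ∀ y ∈ B, u x y ≤ v x y + g) →
      ∫⁻ x in A, ∫⁻ y in B, u x y
        ≤ (∫⁻ x in A, ∫⁻ y in B, v x y) + ∫⁻ _ in A, ∫⁻ _ in B, g := by
    intro u v huv
    calc ∫⁻ x in A, ∫⁻ y in B, u x y
        ≤ ∫⁻ x in A, ((∫⁻ y in B, v x y) + ∫⁻ _ in B, g) := by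
          refine setLIntegral_mono' hA fun x hx => ?_
          rw [← lintegral_add_right _ measurable_const]
          exact setLIntegral_mono' hB fun y hy => huv x hx y hy
      _ = _ := lintegral_add_right _ measurable_const
  have h1 := fun x => hρ₁.2.1 x
  have h2 := fun x => hρ₂.2.1 x
  constructor
  · refine comparison _ _ fun x hx y hy => ?_
    refine le_trans ?_ (add_le_add_right (hg x hx y hy) _)
    rw [← ENNReal.ofReal_mul (h1 _), ← ENNReal.ofReal_add (mul_nonneg (h1 _) (h1 _)) (abs_nonneg _)]
    refine ENNReal.ofReal_le_ofReal ?_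
    have := le_abs_self (pairCov ρ₁ ρ₂ x y)
    simp only [pairCov] at this ⊢
    linarith
  · refine comparison _ _ fun x hx y hy => ?_
    refine le_trans ?_ (add_le_add_right (hg x hx y hy) _)
    rw [← ENNReal.ofReal_mul (h1 _), ← ENNReal.ofReal_add (h2 _) (abs_nonneg _)]
    refine ENNReal.ofReal_le_ofReal ?_
    have := neg_abs_le (pairCov ρ₁ ρ₂ x y)
    simp only [pairCov] at this ⊢
    linarith

end Counts

end AssocPP

namespace AssocPP

/-! ### Covariances of Lipschitz functions of counts -/

section CrossCov

variable {𝓢 : Type*} [MeasurableSpace 𝓢] {P : Measure 𝓢}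

/-- `E[F G] - E[F] E[G]`, which is meaningful as soon as these three integrals are. -/
noncomputable def crossCov (F G : 𝓢 → ℝ) (P : Measure 𝓢) : ℝ :=
  ∫ ω, F ω * G ω ∂P - (∫ ω, F ω ∂P) * ∫ ω, G ω ∂P

/-- Bilinearity, with integrability required of each product separately: the linear parts `L`, `L'`
are sums of counts, which need not be square integrable. -/
lemma crossCov_smul_add {φ ψ L L' : 𝓢 → ℝ} (hφ : Integrable φ P) (hψ : Integrable ψ P)
    (hL : Integrable L P) (hL' : Integrable L' P) (h1 : Integrable (fun ω => φ ω * ψ ω) P)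
    (h2 : Integrable (fun ω => φ ω * L' ω) P) (h3 : Integrable (fun ω => L ω * ψ ω) P)
    (h4 : Integrable (fun ω => L ω * L' ω) P) (a b : ℝ) :
    Integrable (fun ω => (a * φ ω + L ω) * (b * ψ ω + L' ω)) P ∧
    crossCov (fun ω => a * φ ω + L ω) (fun ω => b * ψ ω + L' ω) P =
      a * b * crossCov φ ψ P + a * crossCov φ L' P + b * crossCov L ψ P + crossCov L L' P := by
  have e : (fun ω => (a * φ ω + L ω) * (b * ψ ω + L' ω)) = fun ω =>
      ((a * b) * (φ ω * ψ ω) + a * (φ ω * L' ω)) + (b * (L ω * ψ ω) + L ω * L' ω) := by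
    funext ω; ring
  have i1 : Integrable (fun ω => (a * b) * (φ ω * ψ ω) + a * (φ ω * L' ω)) P :=
    (h1.const_mul (a * b)).add (h2.const_mul a)
  have i2 : Integrable (fun ω => b * (L ω * ψ ω) + L ω * L' ω) P := (h3.const_mul b).add h4
  refine ⟨by rw [e]; exact i1.add i2, ?_⟩
  unfold crossCov
  rw [e, integral_add i1 i2, integral_add (h1.const_mul (a * b)) (h2.const_mul a),
    integral_add (h3.const_mul b) h4, integral_add (hφ.const_mul a) hL,
    integral_add (hψ.const_mul b) hL']
  simp only [integral_const_mul]
  ring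

lemma crossCov_sum_sum {k l : ℕ} {u : Fin k → 𝓢 → ℝ} {v : Fin l → 𝓢 → ℝ} (a : Fin k → ℝ)
    (b : Fin l → ℝ) (hu : ∀ i, Integrable (u i) P) (hv : ∀ j, Integrable (v j) P)
    (huv : ∀ i j, Integrable (fun ω => u i ω * v j ω) P) :
    Integrable (fun ω => (∑ i, a i * u i ω) * ∑ j, b j * v j ω) P ∧
    crossCov (fun ω => ∑ i, a i * u i ω) (fun ω => ∑ j, b j * v j ω) P =
      ∑ i, ∑ j, a i * b j * crossCov (u i) (v j) P := by
  have e : (fun ω => (∑ i, a i * u i ω) * ∑ j, b j * v j ω) = fun ω =>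
      ∑ i, ∑ j, a i * b j * (u i ω * v j ω) := by
    funext ω
    rw [Finset.sum_mul_sum]
    exact Finset.sum_congr rfl fun i _ => Finset.sum_congr rfl fun j _ => by ring
  have hi : ∀ i j, Integrable (fun ω => a i * b j * (u i ω * v j ω)) P :=
    fun i j => (huv i j).const_mul _
  refine ⟨e ▸ integrable_finsetSum _ fun i _ => integrable_finsetSum _ fun j _ => hi i j, ?_⟩
  unfold crossCov
  rw [e, integral_finsetSum _ fun i _ => integrable_finsetSum _ fun j _ => hi i j,
    integral_finsetSum _ fun i _ => (hu i).const_mul _,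
    integral_finsetSum _ fun j _ => (hv j).const_mul _, Finset.sum_mul_sum,
    ← Finset.sum_sub_distrib]
  refine Finset.sum_congr rfl fun i _ => ?_
  rw [integral_finsetSum _ fun j _ => hi i j, ← Finset.sum_sub_distrib]
  refine Finset.sum_congr rfl fun j _ => ?_
  simp only [integral_const_mul]
  ring

end CrossCov

section RealCount

variable {d : ℕ} {𝓢 : Type*} {X : 𝓢 → Config d}

/-- The number of points in a bounded set, as a real random variable. -/
noncomputable def realCount (X : 𝓢 → Config d) (B : Set (EuclideanSpace ℝ (Fin d))) (ω : 𝓢) : ℝ :=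
  ((Config.count B (X ω)).toNat : ℝ)

lemma ofReal_realCount {B : Set (EuclideanSpace ℝ (Fin d))} (hB : Bornology.IsBounded B) (ω : 𝓢) :
    ENNReal.ofReal (realCount X B ω) = (Config.count B (X ω) : ℝ≥0∞) := by
  rw [realCount, ENNReal.ofReal_natCast]
  conv_rhs => rw [← ENat.natCast_toNat (Config.count_ne_top hB (X ω))]
  simp

end RealCount

section Counts

variable {d : ℕ} {𝓢 : Type*} [MeasurableSpace 𝓢] {X : 𝓢 → Config d} {P : Measure 𝓢}

/-- Bounded Borel sets on which `ρ` is bounded. -/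
structure IsBoundedFor (ρ : (Fin 1 → EuclideanSpace ℝ (Fin d)) → ℝ)
    (B : Set (EuclideanSpace ℝ (Fin d))) : Prop where
  measurableSet : MeasurableSet B
  isBounded : Bornology.IsBounded B
  exists_le : ∃ K : ℝ, ∀ x ∈ B, ρ ![x] ≤ K

lemma IsBoundedFor.mono {ρ : (Fin 1 → EuclideanSpace ℝ (Fin d)) → ℝ}
    {A B : Set (EuclideanSpace ℝ (Fin d))} (hB : IsBoundedFor ρ B) (hA : MeasurableSet A)
    (hAB : A ⊆ B) : IsBoundedFor ρ A :=
  ⟨hA, hB.isBounded.subset hAB, hB.exists_le.imp fun _ h x hx => h x (hAB hx)⟩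

lemma measurable_toNat_count (hX : Measurable X) {B : Set (EuclideanSpace ℝ (Fin d))}
    (hB : MeasurableSet B) : Measurable fun ω => (Config.count B (X ω)).toNat :=
  (measurable_from_top (f := ENat.toNat)).comp ((Config.measurable_count hB).comp hX)

lemma measurable_realCount (hX : Measurable X) {B : Set (EuclideanSpace ℝ (Fin d))}
    (hB : MeasurableSet B) : Measurable (realCount X B) :=
  (measurable_from_top (f := fun n : ℕ => (n : ℝ))).comp (measurable_toNat_count hX hB)

lemma lintegral_count_ne_top {ρ₁ : (Fin 1 → EuclideanSpace ℝ (Fin d)) → ℝ}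
    (hρ₁ : IsIntensity X P 1 ρ₁) {B : Set (EuclideanSpace ℝ (Fin d))} (hB : IsBoundedFor ρ₁ B) :
    ∫⁻ ω, (Config.count B (X ω) : ℝ≥0∞) ∂P ≠ ∞ := by
  obtain ⟨K, hK⟩ := hB.exists_le
  rw [lintegral_count hρ₁ hB.measurableSet]
  refine ((setLIntegral_mono' (g := fun _ => ENNReal.ofReal K) hB.measurableSet
    fun x hx => ENNReal.ofReal_le_ofReal (hK x hx)).trans_lt ?_).ne
  rw [setLIntegral_const]
  exact ENNReal.mul_lt_top ENNReal.ofReal_lt_top hB.isBounded.measure_lt_top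

lemma integrable_realCount (hX : Measurable X) {ρ₁ : (Fin 1 → EuclideanSpace ℝ (Fin d)) → ℝ}
    (hρ₁ : IsIntensity X P 1 ρ₁) {B : Set (EuclideanSpace ℝ (Fin d))} (hB : IsBoundedFor ρ₁ B) :
    Integrable (realCount X B) P := by
  refine ⟨(measurable_realCount hX hB.measurableSet).aestronglyMeasurable, ?_⟩
  have nn : ∀ ω, 0 ≤ realCount X B ω := fun ω => Nat.cast_nonneg _
  rw [hasFiniteIntegral_iff_ofReal (ae_of_all _ nn)]
  simp_rw [ofReal_realCount hB.isBounded]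
  exact (lintegral_count_ne_top hρ₁ hB).lt_top

/-- The difference of the two sides of Campbell's formula is an integral of `D` over `A × B`.
Finiteness of the product moment comes from the same comparison. -/
lemma integrable_realCount_mul_and_abs_crossCov_le (hX : Measurable X)
    {ρ₁ : (Fin 1 → EuclideanSpace ℝ (Fin d)) → ℝ} {ρ₂ : (Fin 2 → EuclideanSpace ℝ (Fin d)) → ℝ}
    (hρ₁ : IsIntensity X P 1 ρ₁) (hρ₂ : IsIntensity X P 2 ρ₂)
    {A B : Set (EuclideanSpace ℝ (Fin d))} (hA : IsBoundedFor ρ₁ A) (hB : IsBoundedFor ρ₁ B)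
    (hAB : Disjoint A B) {g : ℝ} (hg0 : 0 ≤ g)
    (hg : ∀ x ∈ A, ∀ y ∈ B, |pairCov ρ₁ ρ₂ x y| ≤ g) :
    Integrable (fun ω => realCount X A ω * realCount X B ω) P ∧
    |crossCov (realCount X A) (realCount X B) P|
      ≤ g * (volume A).toReal * (volume B).toReal := by
  obtain ⟨h1, h2⟩ := lintegral_count_mul_le hρ₁ hρ₂ hA.measurableSet hB.measurableSet hAB
    (g := ENNReal.ofReal g) fun x hx y hy => ENNReal.ofReal_le_ofReal (hg x hx y hy)
  set EA := ∫⁻ ω, (Config.count A (X ω) : ℝ≥0∞) ∂P with hEA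
  set EB := ∫⁻ ω, (Config.count B (X ω) : ℝ≥0∞) ∂P with hEB
  set EAB := ∫⁻ ω, (Config.count A (X ω) : ℝ≥0∞) * (Config.count B (X ω) : ℝ≥0∞) ∂P with hEAB
  have fA : EA ≠ ∞ := lintegral_count_ne_top hρ₁ hA
  have fB : EB ≠ ∞ := lintegral_count_ne_top hρ₁ hB
  have vA : volume A ≠ ∞ := hA.isBounded.measure_lt_top.ne
  have vB : volume B ≠ ∞ := hB.isBounded.measure_lt_top.ne
  have fr : ENNReal.ofReal g * volume A * volume B ≠ ∞ :=
    ENNReal.mul_ne_top (ENNReal.mul_ne_top ENNReal.ofReal_ne_top vA) vB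
  have fAB : EAB ≠ ∞ :=
    ne_top_of_le_ne_top (ENNReal.add_ne_top.2 ⟨ENNReal.mul_ne_top fA fB, fr⟩) h1
  have nn : ∀ B ω, 0 ≤ realCount X B ω := fun B ω => Nat.cast_nonneg _
  have mA := measurable_realCount hX hA.measurableSet
  have mB := measurable_realCount hX hB.measurableSet
  have eA : ∫ ω, realCount X A ω ∂P = EA.toReal := by
    rw [integral_eq_lintegral_of_nonneg_ae (ae_of_all _ (nn A)) mA.aestronglyMeasurable]
    simp_rw [ofReal_realCount hA.isBounded, ← hEA]
  have eB : ∫ ω, realCount X B ω ∂P = EB.toReal := by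
    rw [integral_eq_lintegral_of_nonneg_ae (ae_of_all _ (nn B)) mB.aestronglyMeasurable]
    simp_rw [ofReal_realCount hB.isBounded, ← hEB]
  have lAB : ∫⁻ ω, ENNReal.ofReal (realCount X A ω * realCount X B ω) ∂P = EAB := by
    simp_rw [ENNReal.ofReal_mul (nn A _), ofReal_realCount hA.isBounded,
      ofReal_realCount hB.isBounded, ← hEAB]
  have eAB : ∫ ω, realCount X A ω * realCount X B ω ∂P = EAB.toReal := by
    rw [integral_eq_lintegral_of_nonneg_ae (ae_of_all _ fun ω => mul_nonneg (nn A ω) (nn B ω))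
      (mA.mul mB).aestronglyMeasurable, lAB]
  constructor
  · refine ⟨(mA.mul mB).aestronglyMeasurable, ?_⟩
    rw [hasFiniteIntegral_iff_ofReal (ae_of_all _ fun ω => mul_nonneg (nn A ω) (nn B ω)), lAB]
    exact fAB.lt_top
  · rw [crossCov, eA, eB, eAB]
    have hr : (ENNReal.ofReal g * volume A * volume B).toReal
        = g * (volume A).toReal * (volume B).toReal := by
      simp [ENNReal.toReal_ofReal hg0]
    have h1' := ENNReal.toReal_mono (ENNReal.add_ne_top.2 ⟨ENNReal.mul_ne_top fA fB, fr⟩) h1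
    have h2' := ENNReal.toReal_mono (ENNReal.add_ne_top.2 ⟨fAB, fr⟩) h2
    rw [ENNReal.toReal_add (ENNReal.mul_ne_top fA fB) fr, ENNReal.toReal_mul, hr] at h1'
    rw [ENNReal.toReal_add fAB fr, ENNReal.toReal_mul, hr] at h2'
    rw [abs_le]
    constructor <;> linarith

lemma measurable_countVec (hX : Measurable X) {k : ℕ}
    {A : Fin k → Set (EuclideanSpace ℝ (Fin d))} (hA : ∀ i, MeasurableSet (A i)) :
    Measurable (countVec X A) :=
  measurable_pi_lambda _ fun i => measurable_toNat_count hX (hA i)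

/-- Raising the counts changes `e * Φ` by no more than the growth of the linear part. This produces
the increasing functions to which association applies. -/
lemma monotone_smul_add_sum {k : ℕ} {Φ : (Fin k → ℕ) → ℝ} {a : Fin k → ℝ}
    (hΦ : ∀ x y, |Φ x - Φ y| ≤ ∑ i, a i * |(x i : ℝ) - y i|) {e : ℝ} (he : |e| = 1) :
    Monotone fun x => e * Φ x + ∑ i, a i * (x i : ℝ) := by
  intro x y hxy
  have h := hΦ x y
  have e1 : ∑ i, a i * |(x i : ℝ) - y i| = ∑ i, a i * (y i : ℝ) - ∑ i, a i * (x i : ℝ) := by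
    rw [← Finset.sum_sub_distrib]
    refine Finset.sum_congr rfl fun i _ => ?_
    rw [abs_sub_comm, abs_of_nonneg (sub_nonneg.2 (Nat.cast_le.2 (hxy i)))]
    ring
  have h2 : e * Φ x - e * Φ y ≤ |Φ x - Φ y| := by
    rw [← mul_sub]
    refine (le_abs_self _).trans ?_
    rw [abs_mul, he, one_mul]
  show e * Φ x + _ ≤ e * Φ y + _
  linarith

/-- Association bounds the covariance of bounded Lipschitz functions of counts by the
covariances of the counts themselves. -/
theorem abs_crossCov_countVec_le [IsFiniteMeasure P] (hX : Measurable X)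
    (hassoc : IsAssociated X P)
    {ρ₁ : (Fin 1 → EuclideanSpace ℝ (Fin d)) → ℝ} {ρ₂ : (Fin 2 → EuclideanSpace ℝ (Fin d)) → ℝ}
    (hρ₁ : IsIntensity X P 1 ρ₁) (hρ₂ : IsIntensity X P 2 ρ₂) {k l : ℕ}
    {A : Fin k → Set (EuclideanSpace ℝ (Fin d))} {B : Fin l → Set (EuclideanSpace ℝ (Fin d))}
    (hA : ∀ i, IsBoundedFor ρ₁ (A i)) (hB : ∀ j, IsBoundedFor ρ₁ (B j))
    (hAd : Pairwise fun i j => Disjoint (A i) (A j))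
    (hBd : Pairwise fun i j => Disjoint (B i) (B j)) (hAB : ∀ i j, Disjoint (A i) (B j))
    {g : Fin k → Fin l → ℝ} (hg0 : ∀ i j, 0 ≤ g i j)
    (hg : ∀ i j, ∀ x ∈ A i, ∀ y ∈ B j, |pairCov ρ₁ ρ₂ x y| ≤ g i j)
    {Φ : (Fin k → ℕ) → ℝ} {Ψ : (Fin l → ℕ) → ℝ} {a : Fin k → ℝ} {b : Fin l → ℝ}
    (ha : ∀ i, 0 ≤ a i) (hb : ∀ j, 0 ≤ b j)
    (hΦ : ∀ x y, |Φ x - Φ y| ≤ ∑ i, a i * |(x i : ℝ) - y i|)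
    (hΨ : ∀ x y, |Ψ x - Ψ y| ≤ ∑ j, b j * |(x j : ℝ) - y j|)
    {C : ℝ} (hΦC : ∀ x, |Φ x| ≤ C) (hΨC : ∀ x, |Ψ x| ≤ C) :
    |crossCov (fun ω => Φ (countVec X A ω)) (fun ω => Ψ (countVec X B ω)) P|
      ≤ ∑ i, ∑ j, a i * b j * (g i j * (volume (A i)).toReal * (volume (B j)).toReal) := by
  set φ : 𝓢 → ℝ := fun ω => Φ (countVec X A ω) with hφ
  set ψ : 𝓢 → ℝ := fun ω => Ψ (countVec X B ω) with hψ
  set L : 𝓢 → ℝ := fun ω => ∑ i, a i * realCount X (A i) ω with hL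
  set L' : 𝓢 → ℝ := fun ω => ∑ j, b j * realCount X (B j) ω with hL'
  have mφ : Measurable φ := (Measurable.of_discrete (f := Φ)).comp
    (measurable_countVec hX fun i => (hA i).measurableSet)
  have mψ : Measurable ψ := (Measurable.of_discrete (f := Ψ)).comp
    (measurable_countVec hX fun i => (hB i).measurableSet)
  have iφ : Integrable φ P := Integrable.of_bound mφ.aestronglyMeasurable C
    (ae_of_all _ fun ω => hΦC _)
  have iψ : Integrable ψ P := Integrable.of_bound mψ.aestronglyMeasurable C
    (ae_of_all _ fun ω => hΨC _)
  have iL : Integrable L P := integrable_finsetSum _ fun i _ =>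
    (integrable_realCount hX hρ₁ (hA i)).const_mul _
  have iL' : Integrable L' P := integrable_finsetSum _ fun i _ =>
    (integrable_realCount hX hρ₁ (hB i)).const_mul _
  have iφψ : Integrable (fun ω => φ ω * ψ ω) P :=
    iψ.bdd_mul mφ.aestronglyMeasurable (c := C) (ae_of_all _ fun ω => hΦC _)
  have iφL : Integrable (fun ω => φ ω * L' ω) P :=
    iL'.bdd_mul mφ.aestronglyMeasurable (c := C) (ae_of_all _ fun ω => hΦC _)
  have iLψ : Integrable (fun ω => L ω * ψ ω) P :=
    iL.mul_bdd mψ.aestronglyMeasurable (c := C) (ae_of_all _ fun ω => hΨC _)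
  have hpair := fun i j => integrable_realCount_mul_and_abs_crossCov_le hX hρ₁ hρ₂ (hA i) (hB j)
    (hAB i j) (hg0 i j) (hg i j)
  obtain ⟨iLL, cLL⟩ := crossCov_sum_sum (P := P) (u := fun i => realCount X (A i))
    (v := fun j => realCount X (B j)) a b (fun i => integrable_realCount hX hρ₁ (hA i))
    (fun j => integrable_realCount hX hρ₁ (hB j)) fun i j => (hpair i j).1
  have bound : |crossCov L L' P| ≤
      ∑ i, ∑ j, a i * b j * (g i j * (volume (A i)).toReal * (volume (B j)).toReal) := by
    rw [cLL]
    refine (Finset.abs_sum_le_sum_abs _ _).trans (Finset.sum_le_sum fun i _ => ?_)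
    refine (Finset.abs_sum_le_sum_abs _ _).trans (Finset.sum_le_sum fun j _ => ?_)
    rw [abs_mul, abs_of_nonneg (mul_nonneg (ha i) (hb j))]
    exact mul_le_mul_of_nonneg_left (hpair i j).2 (mul_nonneg (ha i) (hb j))
  refine le_trans ?_ bound
  have hAf : IsDisjointFamily A := ⟨fun i => (hA i).measurableSet, fun i => (hA i).isBounded, hAd⟩
  have hBf : IsDisjointFamily B := ⟨fun i => (hB i).measurableSet, fun i => (hB i).isBounded, hBd⟩
  have hU : Disjoint (⋃ i, A i) (⋃ j, B j) := by
    simp only [Set.disjoint_iUnion_left, Set.disjoint_iUnion_right]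
    exact fun i j => hAB j i
  -- Adding the inequalities for the signs (1,1) and (-1,-1), and those for (1,-1) and (-1,1),
  -- removes the covariances of `φ` with `L'` and of `L` with `ψ`. What remains bounds both
  -- `crossCov φ ψ` and its negative by `-crossCov L L'` in the negative case and by `crossCov L L'`
  -- in the positive one.
  have expand := crossCov_smul_add iφ iψ iL iL' iφψ iφL iLψ iLL
  have lin : ∀ e : ℝ, Integrable (fun ω => e * φ ω + L ω) P := fun e => (iφ.const_mul e).add iL
  have lin' : ∀ e : ℝ, Integrable (fun ω => e * ψ ω + L' ω) P := fun e => (iψ.const_mul e).add iL'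
  have h11 := expand 1 1
  have h12 := expand 1 (-1)
  have h21 := expand (-1) 1
  have h22 := expand (-1) (-1)
  have o1 : |(1 : ℝ)| = 1 := by simp
  have o2 : |(-1 : ℝ)| = 1 := by simp
  rcases hassoc with hN | hPos
  · have key : ∀ e e' : ℝ, |e| = 1 → |e'| = 1 →
        crossCov (fun ω => e * φ ω + L ω) (fun ω => e' * ψ ω + L' ω) P ≤ 0 := fun e e' he he' =>
      sub_nonpos.2 (hN k l A B _ _ hAf hBf hU (monotone_smul_add_sum hΦ he)
        (monotone_smul_add_sum hΨ he') (lin e) (lin' e') (expand e e').1)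
    have k11 := key 1 1 o1 o1
    have k12 := key 1 (-1) o1 o2
    have k21 := key (-1) 1 o2 o1
    have k22 := key (-1) (-1) o2 o2
    rw [h11.2] at k11; rw [h12.2] at k12; rw [h21.2] at k21; rw [h22.2] at k22
    have := neg_abs_le (crossCov L L' P)
    rw [abs_le]
    constructor <;> linarith
  · have key : ∀ e e' : ℝ, |e| = 1 → |e'| = 1 →
        0 ≤ crossCov (fun ω => e * φ ω + L ω) (fun ω => e' * ψ ω + L' ω) P := fun e e' he he' =>
      sub_nonneg.2 (hPos k l A B _ _ hAf hBf (monotone_smul_add_sum hΦ he)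
        (monotone_smul_add_sum hΨ he') (lin e) (lin' e') (expand e e').1)
    have k11 := key 1 1 o1 o1
    have k12 := key 1 (-1) o1 o2
    have k21 := key (-1) 1 o2 o1
    have k22 := key (-1) (-1) o2 o2
    rw [h11.2] at k11; rw [h12.2] at k12; rw [h21.2] at k21; rw [h22.2] at k22
    have := le_abs_self (crossCov L L' P)
    rw [abs_le]
    constructor <;> linarith

end Counts

end AssocPP

namespace AssocPP

/-! ### Approximation by functions of finitely many counts -/

section CountField

variable {d : ℕ}

/-- All counts of a configuration. -/
noncomputable def countField (ξ : Config d) (B : Set (EuclideanSpace ℝ (Fin d))) : ℕ :=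
  (Config.count B ξ).toNat

lemma countField_restrict (ξ : Config d) {B C : Set (EuclideanSpace ℝ (Fin d))} (h : B ⊆ C) :
    countField (ξ.restrict C) B = countField ξ B := by
  rw [countField, Config.count_restrict, Set.inter_eq_self_of_subset_right h, countField]

lemma measurable_countField {B : Set (EuclideanSpace ℝ (Fin d))} (hB : MeasurableSet B) :
    Measurable fun ξ : Config d => countField ξ B :=
  measurable_toNat_count measurable_id hB

lemma measurable_comp_countField {𝓑 : Finset (Set (EuclideanSpace ℝ (Fin d)))}
    (h𝓑 : ∀ B ∈ 𝓑, MeasurableSet B) {α : Type*} [MeasurableSpace α]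
    {H : (Set (EuclideanSpace ℝ (Fin d)) → ℕ) → α} (hH : DependsOn H 𝓑) :
    Measurable fun ξ : Config d => H (countField ξ) := by
  classical
  have e : (fun ξ : Config d => H (countField ξ)) =
      -- The value 0 off `𝓑` is irrelevant because `H` depends only on `𝓑`. A function on the
      -- countable discrete space `𝓑 → ℕ` is measurable.
      (fun z : 𝓑 → ℕ => H fun B => if h : B ∈ 𝓑 then z ⟨B, h⟩ else 0) ∘
        fun ξ B => countField ξ B.1 := by
    funext ξ
    refine hH fun B hB => ?_
    simp only [Finset.mem_coe] at hB
    simp [hB]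
  rw [e]
  exact Measurable.of_discrete.comp
    (measurable_pi_lambda _ fun B => measurable_countField (h𝓑 B.1 B.2))

/-- Every event about a configuration contained in the bounded set `C` is, up to an event of small
probability, determined by finitely many counts of subsets of `C` on which `ρ` is bounded. -/
lemma exists_dependsOn_approx_event (μ : Measure (Config d)) [IsFiniteMeasure μ]
    {ρ : (Fin 1 → EuclideanSpace ℝ (Fin d)) → ℝ} (hρ : Measurable ρ)
    {C : Set (EuclideanSpace ℝ (Fin d))} (hC : MeasurableSet C) (hCb : Bornology.IsBounded C)
    (hμ : ∀ᵐ ξ ∂μ, ξ.carrier ⊆ C) {S : Set (Config d)} (hS : MeasurableSet S) {η : ℝ≥0∞}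
    (hη : η ≠ 0) :
    ∃ (𝓑 : Finset (Set (EuclideanSpace ℝ (Fin d)))) (T : (Set (EuclideanSpace ℝ (Fin d)) → ℕ) → Prop),
      (∀ B ∈ 𝓑, IsBoundedFor ρ B ∧ B ⊆ C) ∧ DependsOn T 𝓑 ∧
        μ {ξ | ¬(ξ ∈ S ↔ T (countField ξ))} ≤ η := by
  classical
  -- Approximable events include the generators and are stable under complements and countable
  -- unions, hence exhaust the σ-algebra.
  induction S, hS using MeasurableSpace.generateFrom_induction generalizing η with
  | hC S hS _ =>
    obtain ⟨B, m, hB, rfl⟩ := hS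
    -- Since `ρ` may be unbounded on `C`, the set is cut down to `{ρ ≤ K}`. A configuration has
    -- finitely many points in `C`, so a large `K` loses none of them, and `E K`, the event of
    -- losing a point, decreases to the empty set.
    set A : ℕ → Set (EuclideanSpace ℝ (Fin d)) := fun K => (B ∩ C) ∩ {x | ρ ![x] ≤ K} with hAdef
    have hρ' : Measurable fun x : EuclideanSpace ℝ (Fin d) => ρ ![x] :=
      hρ.comp (measurable_pi_lambda _ fun i => by fin_cases i; exact measurable_id)
    have hA : ∀ K, MeasurableSet (A K) := fun K =>
      (hB.inter hC).inter (measurableSet_le hρ' measurable_const)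
    set E : ℕ → Set (Config d) := fun K =>
      {ξ | Config.count (A K) ξ = Config.count (B ∩ C) ξ}ᶜ with hE
    have hEm : ∀ K, MeasurableSet (E K) := fun K =>
      (measurableSet_eq_fun (Config.measurable_count (hA K))
        (Config.measurable_count (hB.inter hC))).compl
    have fin : ∀ ξ : Config d, (ξ.carrier ∩ (B ∩ C)).Finite := fun ξ =>
      ξ.finite_inter _ (hCb.subset Set.inter_subset_right)
    have hEiff : ∀ K ξ, ξ ∈ E K ↔ ¬ ξ.carrier ∩ (B ∩ C) ⊆ A K := by
      intro K ξ
      rw [hE, Set.mem_compl_iff, not_iff_not]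
      have hsub : ξ.carrier ∩ A K ⊆ ξ.carrier ∩ (B ∩ C) :=
        Set.inter_subset_inter_right _ Set.inter_subset_left
      constructor
      · intro h
        have h' : (ξ.carrier ∩ A K).encard = (ξ.carrier ∩ (B ∩ C)).encard := h
        have := ((fin ξ).subset hsub).eq_of_subset_of_encard_le hsub h'.ge
        rw [← this]
        exact Set.inter_subset_right
      · intro h
        have : ξ.carrier ∩ A K = ξ.carrier ∩ (B ∩ C) :=
          hsub.antisymm fun x hx => ⟨hx.1, h hx⟩
        show Config.count (A K) ξ = Config.count (B ∩ C) ξ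
        rw [Config.count, Config.count, this]
    have hanti : Antitone E := by
      intro K K' hK ξ hξ
      rw [hEiff] at hξ ⊢
      intro h
      refine hξ (h.trans fun x hx => ⟨hx.1, ?_⟩)
      have h2 : ρ ![x] ≤ K := hx.2
      exact h2.trans (Nat.cast_le.2 hK)
    have hempty : ⋂ K, E K = ∅ := by
      refine Set.eq_empty_of_forall_notMem fun ξ hξ => ?_
      rw [Set.mem_iInter] at hξ
      obtain ⟨c, hc⟩ := ((fin ξ).image fun x => ρ ![x]).bddAbove
      obtain ⟨K, hK⟩ := exists_nat_ge c
      refine (hEiff K ξ).1 (hξ K) fun x hx => ⟨hx.2, ?_⟩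
      exact (hc (Set.mem_image_of_mem _ hx)).trans hK
    have hlim : Tendsto (fun K => μ (E K)) atTop (𝓝 0) := by
      have := tendsto_measure_iInter_atTop (μ := μ) (fun K => (hEm K).nullMeasurableSet) hanti
        ⟨0, measure_ne_top _ _⟩
      rwa [hempty, measure_empty] at this
    obtain ⟨K, hK⟩ := (hlim.eventually_lt_const (pos_iff_ne_zero.2 hη)).exists
    refine ⟨{A K}, fun n => n (A K) = m, ?_, ?_, ?_⟩
    · intro B' hB'
      rw [Finset.mem_singleton] at hB'
      subst hB'
      exact ⟨⟨hA K, hCb.subset fun x hx => hx.1.2, K, fun x hx => hx.2⟩, fun x hx => hx.1.2⟩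
    · intro n n' h
      simp only [h (A K) (by simp)]
    · refine le_trans (measure_mono_ae ?_) hK.le
      filter_upwards [hμ] with ξ hξ hbad
      by_contra hgood
      have hg : Config.count (A K) ξ = Config.count (B ∩ C) ξ := not_not.1 hgood
      refine hbad ?_
      have h1 : Config.count B ξ = Config.count (A K) ξ := by
        rw [hg, Config.count, Config.count]
        congr 1
        ext x
        exact ⟨fun hx => ⟨hx.1, hx.2, hξ hx.1⟩, fun hx => ⟨hx.1, hx.2.1⟩⟩
      have hfin : Config.count (A K) ξ ≠ ⊤ :=
        Config.count_ne_top (hCb.subset fun x hx => hx.1.2) ξ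
      show Config.count B ξ = m ↔ countField ξ (A K) = m
      rw [h1, countField]
      constructor
      · intro h; rw [h]; simp
      · intro h; rw [← h, ENat.natCast_toNat hfin]
  | empty =>
    exact ⟨∅, fun _ => False, by simp, fun _ _ _ => rfl, by simp⟩
  | compl S _ ih =>
    obtain ⟨𝓑, T, h1, h2, h3⟩ := ih hη
    refine ⟨𝓑, fun n => ¬ T n, h1, fun n n' h => by simp only [h2 h], ?_⟩
    convert h3 using 3
    ext ξ
    simp only [Set.mem_compl_iff, not_iff_not]
  | iUnion f hf ih =>
    have hη2 : η / 2 ≠ 0 := (ENNReal.half_pos hη).ne'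
    -- Half of `η` pays for replacing the union by a finite one, the other half is distributed over
    -- the approximations of the pieces.
    obtain ⟨w, hw0, hw⟩ := ENNReal.exists_pos_sum_of_countable' hη2 ℕ
    choose 𝓑 T h1 h2 h3 using fun n => ih n (hw0 n).ne'
    have hfm : ∀ n, MeasurableSet (f n) := hf
    set R : ℕ → Set (Config d) := fun n => (⋃ i, f i) \ ⋃ i ∈ Finset.range n, f i with hR
    have hlim : Tendsto (fun n => μ (R n)) atTop (𝓝 0) := by
      have hanti : Antitone R := fun n n' hn =>
        Set.sdiff_subset_sdiff_right (Set.biUnion_subset_biUnion_left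
          (Finset.coe_subset.2 (Finset.range_mono hn)))
      have hempty : ⋂ n, R n = ∅ := by
        refine Set.eq_empty_of_forall_notMem fun ξ hξ => ?_
        rw [Set.mem_iInter] at hξ
        obtain ⟨i, hi⟩ := Set.mem_iUnion.1 (hξ 0).1
        exact (hξ (i + 1)).2 (Set.mem_biUnion (Finset.mem_coe.2 (Finset.self_mem_range_succ i)) hi)
      have := tendsto_measure_iInter_atTop (μ := μ) (fun n => ((MeasurableSet.iUnion hfm).diff
        (Finset.measurableSet_biUnion _ fun i _ => hfm i)).nullMeasurableSet) hanti
        ⟨0, measure_ne_top _ _⟩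
      rwa [hempty, measure_empty] at this
    obtain ⟨n, hn⟩ := (hlim.eventually_lt_const (pos_iff_ne_zero.2 hη2)).exists
    refine ⟨(Finset.range n).biUnion 𝓑, fun x => ∃ i ∈ Finset.range n, T i x, ?_, ?_, ?_⟩
    · intro B hB
      obtain ⟨i, -, hi⟩ := Finset.mem_biUnion.1 hB
      exact h1 i B hi
    · intro x y hxy
      have : ∀ i ∈ Finset.range n, T i x = T i y := fun i hi => h2 i fun B hB =>
        hxy B (Finset.mem_coe.2 (Finset.mem_biUnion.2 ⟨i, hi, Finset.mem_coe.1 hB⟩))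
      refine propext (exists_congr fun i => and_congr_right fun hi => by rw [this i hi])
    · have hsub : {ξ | ¬(ξ ∈ ⋃ i, f i ↔ ∃ i ∈ Finset.range n, T i (countField ξ))} ⊆
          R n ∪ ⋃ i, {ξ | ¬(ξ ∈ f i ↔ T i (countField ξ))} := by
        intro ξ hξ
        by_contra hcon
        rw [Set.mem_union, not_or] at hcon
        obtain ⟨c1, c2⟩ := hcon
        have c3 : ∀ i, ξ ∈ f i ↔ T i (countField ξ) := by
          intro i
          by_contra hi
          exact c2 (Set.mem_iUnion.2 ⟨i, hi⟩)
        refine hξ ⟨fun h => ?_, ?_⟩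
        · have : ξ ∈ ⋃ i ∈ Finset.range n, f i := by
            by_contra hh
            exact c1 ⟨h, hh⟩
          obtain ⟨i, hi, hi'⟩ := Set.mem_iUnion₂.1 this
          exact ⟨i, hi, (c3 i).1 hi'⟩
        · rintro ⟨i, -, hi⟩
          exact Set.mem_iUnion.2 ⟨i, (c3 i).2 hi⟩
      calc μ _ ≤ μ (R n) + μ (⋃ i, {ξ | ¬(ξ ∈ f i ↔ T i (countField ξ))}) :=
            (measure_mono hsub).trans (measure_union_le _ _)
        _ ≤ η / 2 + ∑' i, w i :=
            add_le_add hn.le ((measure_iUnion_le _).trans (ENNReal.tsum_le_tsum h3))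
        _ ≤ η / 2 + η / 2 := by gcongr
        _ = η := ENNReal.add_halves η

/-- The metric projection of `ℝ` onto `[-M, M]`. -/
noncomputable def clamp (M x : ℝ) : ℝ := max (-M) (min M x)

lemma abs_clamp_le {M : ℝ} (hM : 0 ≤ M) (x : ℝ) : |clamp M x| ≤ M := by
  rw [abs_le]
  exact ⟨le_max_left _ _, max_le (by linarith) (min_le_left _ _)⟩

lemma clamp_of_abs_le {M x : ℝ} (h : |x| ≤ M) : clamp M x = x := by
  rw [abs_le] at h
  rw [clamp, min_eq_right h.2, max_eq_right h.1]

lemma abs_clamp_sub_clamp_le (M x y : ℝ) : |clamp M x - clamp M y| ≤ |x - y| := by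
  refine (abs_max_sub_max_le_max _ _ _ _).trans ?_
  rw [sub_self, abs_zero, max_eq_right (abs_nonneg _)]
  refine (abs_min_sub_min_le_max _ _ _ _).trans ?_
  rw [sub_self, abs_zero, max_eq_right (abs_nonneg _)]

lemma measurable_clamp (M : ℝ) : Measurable (clamp M) :=
  measurable_const.max (measurable_const.min measurable_id)

/-- Approximable events give approximable simple functions, which are dense in `L¹` of the law of `X
∩ C`. Clamping restores the bound `M` without increasing the error, as it is 1-Lipschitz and fixes
the values of `u`. The counts may be taken from `X` itself because the sets lie in `C`. -/
lemma exists_dependsOn_approx {𝓢 : Type*} [MeasurableSpace 𝓢] {X : 𝓢 → Config d}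
    {P : Measure 𝓢} [IsFiniteMeasure P] (hX : Measurable X)
    {ρ : (Fin 1 → EuclideanSpace ℝ (Fin d)) → ℝ} (hρ : Measurable ρ)
    {C : Set (EuclideanSpace ℝ (Fin d))} (hC : MeasurableSet C) (hCb : Bornology.IsBounded C)
    {u : Config d → ℝ} (hu : Measurable u) {M : ℝ} (huM : ∀ ξ, |u ξ| ≤ M) {η : ℝ} (hη : 0 < η) :
    ∃ (𝓑 : Finset (Set (EuclideanSpace ℝ (Fin d))))
      (H : (Set (EuclideanSpace ℝ (Fin d)) → ℕ) → ℝ),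
      (∀ B ∈ 𝓑, IsBoundedFor ρ B ∧ B ⊆ C) ∧ DependsOn H 𝓑 ∧ (∀ x, |H x| ≤ M) ∧
        ∫ ω, |u ((X ω).restrict C) - H (countField (X ω))| ∂P ≤ η := by
  classical
  have hM : 0 ≤ M := (abs_nonneg _).trans (huM ⟨∅, fun _ _ => by simp⟩)
  set Z : 𝓢 → Config d := fun ω => (X ω).restrict C with hZ
  have hZm : Measurable Z := (Config.measurable_restrict hC).comp hX
  set μ : Measure (Config d) := P.map Z with hμdef
  have hμ : ∀ᵐ ξ ∂μ, ξ.carrier ⊆ C := by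
    have e : {ξ : Config d | ξ.carrier ⊆ C} = {ξ | Config.count Cᶜ ξ = 0} := by
      ext ξ
      simp only [Set.mem_ofPred_eq, Config.count, Set.encard_eq_zero]
      rw [← Set.sdiff_eq, Set.sdiff_eq_empty]
    rw [hμdef, ae_map_iff hZm.aemeasurable]
    · exact ae_of_all _ fun ω => Set.inter_subset_right
    · rw [e]
      exact Config.measurable_count hC.compl (measurableSet_singleton _)
  have dense := MemLp.induction_dense (α := Config d) (E := ℝ) (p := 1) (μ := μ) ENNReal.one_ne_top
    (fun g => ∃ (𝓑 : Finset (Set (EuclideanSpace ℝ (Fin d))))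
      (H : (Set (EuclideanSpace ℝ (Fin d)) → ℕ) → ℝ),
      (∀ B ∈ 𝓑, IsBoundedFor ρ B ∧ B ⊆ C) ∧ DependsOn H 𝓑 ∧ g = fun ξ => H (countField ξ))
    ?_ ?_ ?_ (f := u) ?_ (ε := ENNReal.ofReal η) (by simpa using hη)
  · obtain ⟨g, hg, 𝓑, H, h1, h2, rfl⟩ := dense
    have h2' : DependsOn (fun x => clamp M (H x)) 𝓑 := fun x y h => by simp only [h2 h]
    refine ⟨𝓑, fun x => clamp M (H x), h1, h2', fun x => abs_clamp_le hM _, ?_⟩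
    have hHm := measurable_comp_countField (fun B hB => (h1 B hB).1.measurableSet) h2
    have e1 : ∀ ω, H (countField (X ω)) = H (countField (Z ω)) := fun ω =>
      h2 fun B hB => (countField_restrict (X ω) (h1 B (Finset.mem_coe.1 hB)).2).symm
    rw [eLpNorm_one_eq_lintegral_enorm, hμdef] at hg
    simp only [Pi.sub_apply] at hg
    rw [lintegral_map (f := fun ξ => ‖u ξ - H (countField ξ)‖ₑ) (hu.sub hHm).enorm hZm] at hg
    rw [integral_eq_lintegral_of_nonneg_ae (ae_of_all _ fun ω => abs_nonneg _)]
    · refine ENNReal.toReal_le_of_le_ofReal hη.le (le_trans (lintegral_mono fun ω => ?_) hg)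
      rw [← Real.enorm_eq_ofReal_abs, Real.enorm_eq_ofReal_abs, Real.enorm_eq_ofReal_abs]
      refine ENNReal.ofReal_le_ofReal ?_
      show |u (Z ω) - clamp M (H (countField (X ω)))| ≤ |u (Z ω) - H (countField (Z ω))|
      rw [e1 ω]
      have := abs_clamp_sub_clamp_le M (u (Z ω)) (H (countField (Z ω)))
      rwa [clamp_of_abs_le (huM _)] at this
    · refine Measurable.aestronglyMeasurable ?_
      have m1 : Measurable fun ω => u ((X ω).restrict C) := hu.comp hZm
      have m2 : Measurable fun ω => clamp M (H (countField (X ω))) :=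
        (measurable_clamp M).comp (hHm.comp hX)
      exact continuous_abs.measurable.comp (m1.sub m2)
  · intro c S hS _ ε hε
    obtain ⟨𝓑, T, h1, h2, h3⟩ := exists_dependsOn_approx_event μ hρ hC hCb hμ hS
      -- The added 1 keeps the denominator nonzero when `c = 0`.
      (η := ε / (‖c‖ₑ + 1)) (ENNReal.div_ne_zero.2 ⟨hε, by simp⟩)
    refine ⟨fun ξ => if T (countField ξ) then c else 0, ?_, 𝓑,
      fun x => if T x then c else 0, h1, fun x y h => by simp only [h2 h], rfl⟩
    have hTm : MeasurableSet {ξ : Config d | T (countField ξ)} :=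
      (measurable_comp_countField (fun B hB => (h1 B hB).1.measurableSet) h2).setOf
    have hbad : MeasurableSet {ξ : Config d | ¬(ξ ∈ S ↔ T (countField ξ))} := by
      have : {ξ : Config d | ¬(ξ ∈ S ↔ T (countField ξ))} =
          symmDiff S {ξ | T (countField ξ)} := by
        ext ξ
        simp only [Set.mem_ofPred_eq, Set.mem_symmDiff]
        tauto
      rw [this]
      exact hS.symmDiff hTm
    rw [eLpNorm_one_eq_lintegral_enorm]
    calc ∫⁻ ξ, ‖((fun ξ => if T (countField ξ) then c else 0) - S.indicator fun _ => c) ξ‖ₑ ∂μ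
        ≤ ∫⁻ ξ, {ξ : Config d | ¬(ξ ∈ S ↔ T (countField ξ))}.indicator (fun _ => ‖c‖ₑ) ξ ∂μ := by
          refine lintegral_mono fun ξ => ?_
          by_cases hs : ξ ∈ S <;> by_cases ht : T (countField ξ) <;>
            simp [Set.indicator, hs, ht]
      _ = ‖c‖ₑ * μ {ξ : Config d | ¬(ξ ∈ S ↔ T (countField ξ))} := by
          rw [lintegral_indicator hbad, setLIntegral_const]
      _ ≤ (‖c‖ₑ + 1) * (ε / (‖c‖ₑ + 1)) := mul_le_mul' le_self_add h3
      _ ≤ ε := ENNReal.mul_div_le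
  · rintro _ _ ⟨𝓑, H, h1, h2, rfl⟩ ⟨𝓑', H', h1', h2', rfl⟩
    refine ⟨𝓑 ∪ 𝓑', fun x => H x + H' x, fun B hB => ?_, fun x y hxy => ?_, rfl⟩
    · rcases Finset.mem_union.1 hB with h | h
      exacts [h1 B h, h1' B h]
    · have e := h2 fun B hB => hxy B (by simp [Finset.mem_coe.1 hB])
      have e' := h2' fun B hB => hxy B (by simp [Finset.mem_coe.1 hB])
      simp only [e, e']
  · rintro _ ⟨𝓑, H, h1, h2, rfl⟩
    exact (measurable_comp_countField (fun B hB => (h1 B hB).1.measurableSet)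
      h2).aestronglyMeasurable
  · exact memLp_one_iff_integrable.2
      (Integrable.of_bound hu.aestronglyMeasurable M (ae_of_all _ huM))

end CountField

end AssocPP

namespace AssocPP

/-! ### Covariance inequality for functions of restricted configurations -/

section Atoms

variable {d : ℕ}

open Classical in
/-- The members of a finite family of sets that contain a given point. -/
noncomputable def membersAt (𝓑 : Finset (Set (EuclideanSpace ℝ (Fin d))))
    (x : EuclideanSpace ℝ (Fin d)) : Finset (Set (EuclideanSpace ℝ (Fin d))) :=
  𝓑.filter fun B => x ∈ B

/-- The cell of points contained in exactly those members of `𝓑` that belong to `T`. -/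
def atom (𝓑 T : Finset (Set (EuclideanSpace ℝ (Fin d)))) : Set (EuclideanSpace ℝ (Fin d)) :=
  {x | membersAt 𝓑 x = T}

open Classical in
/-- The index set of the atoms that are contained in some member of `𝓑`. -/
noncomputable def atomIndex (𝓑 : Finset (Set (EuclideanSpace ℝ (Fin d)))) :
    Finset (Finset (Set (EuclideanSpace ℝ (Fin d)))) :=
  𝓑.powerset.erase ∅

/-- The label of the `i`-th atom. -/
noncomputable def atomLabel (𝓑 : Finset (Set (EuclideanSpace ℝ (Fin d))))
    (i : Fin (atomIndex 𝓑).card) : Finset (Set (EuclideanSpace ℝ (Fin d))) :=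
  ((atomIndex 𝓑).equivFin.symm i).1

lemma atomLabel_injective (𝓑 : Finset (Set (EuclideanSpace ℝ (Fin d)))) :
    Function.Injective (atomLabel 𝓑) :=
  Subtype.val_injective.comp (atomIndex 𝓑).equivFin.symm.injective

/-- A nonempty label places the atom inside a member of `𝓑`, which makes it bounded when that member
is. The cell outside all members is discarded. -/
lemma atomLabel_mem (𝓑 : Finset (Set (EuclideanSpace ℝ (Fin d))))
    (i : Fin (atomIndex 𝓑).card) : atomLabel 𝓑 i ≠ ∅ ∧ atomLabel 𝓑 i ⊆ 𝓑 := by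
  classical
  have h : atomLabel 𝓑 i ∈ atomIndex 𝓑 := ((atomIndex 𝓑).equivFin.symm i).2
  unfold atomIndex at h
  rwa [Finset.mem_erase, Finset.mem_powerset] at h

lemma atom_subset {𝓑 T : Finset (Set (EuclideanSpace ℝ (Fin d)))}
    {B : Set (EuclideanSpace ℝ (Fin d))} (hB : B ∈ T) : atom 𝓑 T ⊆ B := by
  classical
  intro x hx
  have h : membersAt 𝓑 x = T := hx
  rw [← h, membersAt, Finset.mem_filter] at hB
  exact hB.2

lemma disjoint_atom {𝓑 T T' : Finset (Set (EuclideanSpace ℝ (Fin d)))} (h : T ≠ T') :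
    Disjoint (atom 𝓑 T) (atom 𝓑 T') :=
  Set.disjoint_left.2 fun _ hx hx' => h (Eq.trans (Eq.symm hx) hx')

lemma measurableSet_atom {𝓑 : Finset (Set (EuclideanSpace ℝ (Fin d)))}
    (h𝓑 : ∀ B ∈ 𝓑, MeasurableSet B) (T : Finset (Set (EuclideanSpace ℝ (Fin d)))) :
    MeasurableSet (atom 𝓑 T) := by
  classical
  by_cases hT : T ⊆ 𝓑
  · have e : atom 𝓑 T = ⋂ B ∈ 𝓑, {x | x ∈ B ↔ B ∈ T} := by
      ext x
      simp only [atom, membersAt, Set.mem_ofPred_eq, Set.mem_iInter, Finset.ext_iff,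
        Finset.mem_filter]
      constructor
      · intro h B hB
        rw [← h B]
        exact ⟨fun hx => ⟨hB, hx⟩, fun hx => hx.2⟩
      · intro h B
        exact ⟨fun hB => (h B hB.1).1 hB.2, fun hB => ⟨hT hB, (h B (hT hB)).2 hB⟩⟩
    rw [e]
    refine Finset.measurableSet_biInter _ fun B hB => ?_
    by_cases hBT : B ∈ T
    · simpa [hBT] using h𝓑 B hB
    · simp only [hBT, iff_false]
      exact (h𝓑 B hB).compl
  · have e : atom 𝓑 T = ∅ := by
      refine Set.eq_empty_of_forall_notMem fun x hx => hT ?_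
      have h : membersAt 𝓑 x = T := hx
      rw [← h, membersAt]
      exact Finset.filter_subset _ _
    rw [e]
    exact MeasurableSet.empty

open Classical in
/-- The counts of the members of `𝓑`, computed from the counts of the atoms. -/
noncomputable def countOfAtoms (𝓑 : Finset (Set (EuclideanSpace ℝ (Fin d))))
    (n : Fin (atomIndex 𝓑).card → ℕ) (B : Set (EuclideanSpace ℝ (Fin d))) : ℕ :=
  ∑ i, if B ∈ atomLabel 𝓑 i then n i else 0

/-- Every point of `B` has exactly one label, and that label contains `B`, so the points of `B` are
counted by label. -/
lemma countOfAtoms_eq {𝓢 : Type*} (X : 𝓢 → Config d)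
    {𝓑 : Finset (Set (EuclideanSpace ℝ (Fin d)))} {B : Set (EuclideanSpace ℝ (Fin d))}
    (hB : B ∈ 𝓑) (hBb : Bornology.IsBounded B) (ω : 𝓢) :
    countOfAtoms 𝓑 (countVec X (fun i => atom 𝓑 (atomLabel 𝓑 i)) ω) B = countField (X ω) B := by
  classical
  have hfin := (X ω).finite_inter B hBb
  have key := Finset.card_eq_sum_card_fiberwise (s := hfin.toFinset) (t := atomIndex 𝓑)
    (f := membersAt 𝓑) (by
      intro x hx
      have hx' : x ∈ (X ω).carrier ∩ B := by simpa using hx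
      have hmem : B ∈ membersAt 𝓑 x := Finset.mem_filter.2 ⟨hB, hx'.2⟩
      refine Finset.mem_coe.2 (Finset.mem_erase.2 ⟨Finset.ne_empty_of_mem hmem, ?_⟩)
      exact Finset.mem_powerset.2 (Finset.filter_subset _ _))
  have e1 : countField (X ω) B = hfin.toFinset.card := by
    rw [countField, Config.count, hfin.encard_eq_coe_toFinset_card, ENat.toNat_natCast]
  rw [e1, key, countOfAtoms, ← Finset.sum_coe_sort (atomIndex 𝓑),
    ← (atomIndex 𝓑).equivFin.symm.sum_comp]
  refine Finset.sum_congr rfl fun i _ => ?_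
  show (if B ∈ atomLabel 𝓑 i then _ else 0) =
    (hfin.toFinset.filter fun x => membersAt 𝓑 x = atomLabel 𝓑 i).card
  split_ifs with h
  · have e2 : (X ω).carrier ∩ atom 𝓑 (atomLabel 𝓑 i) =
        ((hfin.toFinset.filter fun x => membersAt 𝓑 x = atomLabel 𝓑 i : Finset _) : Set _) := by
      ext x
      simp only [Set.mem_inter_iff, Finset.coe_filter, Set.Finite.mem_toFinset, Set.mem_ofPred_eq]
      exact ⟨fun hx => ⟨⟨hx.1, atom_subset h hx.2⟩, hx.2⟩, fun hx => ⟨hx.1.1, hx.2⟩⟩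
    rw [countVec, Config.count, e2, Set.encard_coe_eq_coe_finsetCard, ENat.toNat_natCast]
  · symm
    rw [Finset.card_eq_zero, Finset.filter_eq_empty_iff]
    intro x hx hx'
    have hx2 : x ∈ (X ω).carrier ∩ B := by simpa using hx
    exact h (hx' ▸ Finset.mem_filter.2 ⟨hB, hx2.2⟩)

/-- The atoms that meet a given subfamily of sets. -/
def Meets (𝓑 𝓑' : Finset (Set (EuclideanSpace ℝ (Fin d)))) (i : Fin (atomIndex 𝓑).card) : Prop :=
  ∃ B ∈ 𝓑', B ∈ atomLabel 𝓑 i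

open Classical in
-- The atoms in question are disjoint and lie in `C`. This is what frees the final bound from the
-- number of atoms.
lemma sum_volume_atom_le {𝓑 𝓑' : Finset (Set (EuclideanSpace ℝ (Fin d)))}
    (h𝓑 : ∀ B ∈ 𝓑, MeasurableSet B) {C : Set (EuclideanSpace ℝ (Fin d))}
    (hC : Bornology.IsBounded C) (h : ∀ B ∈ 𝓑', B ⊆ C) :
    ∑ i with Meets 𝓑 𝓑' i, (volume (atom 𝓑 (atomLabel 𝓑 i))).toReal ≤ (volume C).toReal := by
  have hsub : ∀ i, Meets 𝓑 𝓑' i → atom 𝓑 (atomLabel 𝓑 i) ⊆ C := by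
    rintro i ⟨B, hB, hBi⟩
    exact (atom_subset hBi).trans (h B hB)
  rw [← ENNReal.toReal_sum]
  · refine ENNReal.toReal_mono hC.measure_lt_top.ne ?_
    rw [← measure_biUnion_finset]
    · exact measure_mono (Set.iUnion₂_subset fun i hi => hsub i (Finset.mem_filter.1 hi).2)
    · intro i _ j _ hij
      exact disjoint_atom ((atomLabel_injective 𝓑).ne hij)
    · exact fun i _ => measurableSet_atom h𝓑 _
  · intro i hi
    exact (hC.subset (hsub i (Finset.mem_filter.1 hi).2)).measure_lt_top.ne

open Classical in
/-- A Lipschitz function of finitely many functions of counts is Lipschitz in the counts of the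
atoms. -/
lemma abs_sub_le_sum_atoms {ι : Type*} {J : Finset ι} {𝓑 : Finset (Set (EuclideanSpace ℝ (Fin d)))}
    {𝓑' : ι → Finset (Set (EuclideanSpace ℝ (Fin d)))}
    {H : ι → (Set (EuclideanSpace ℝ (Fin d)) → ℕ) → ℝ} (hH : ∀ i, DependsOn (H i) (𝓑' i))
    {M : ℝ} (hM : ∀ i x, |H i x| ≤ M) {F : (ι → ℝ) → ℝ} {a : ι → ℝ} (ha : ∀ i, 0 ≤ a i)
    (hF : ∀ v w : ι → ℝ, (∀ i, |v i| ≤ M) → (∀ i, |w i| ≤ M) →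
      |F v - F w| ≤ ∑ i ∈ J, a i * |v i - w i|) (n n' : Fin (atomIndex 𝓑).card → ℕ) :
    |F (fun i => H i (countOfAtoms 𝓑 n)) - F (fun i => H i (countOfAtoms 𝓑 n'))| ≤
      ∑ t, (2 * M * ∑ i ∈ J, if Meets 𝓑 (𝓑' i) t then a i else 0) * |(n t : ℝ) - n' t| := by
  refine (hF _ _ (fun i => hM i _) (fun i => hM i _)).trans ?_
  have e : ∑ t, (2 * M * ∑ i ∈ J, if Meets 𝓑 (𝓑' i) t then a i else 0) * |(n t : ℝ) - n' t| =
      ∑ i ∈ J, a i * (2 * M * ∑ t with Meets 𝓑 (𝓑' i) t, |(n t : ℝ) - n' t|) := by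
    simp_rw [Finset.sum_filter, Finset.mul_sum, Finset.sum_mul]
    rw [Finset.sum_comm]
    refine Finset.sum_congr rfl fun i _ => Finset.sum_congr rfl fun t _ => ?_
    split_ifs <;> ring
  rw [e]
  refine Finset.sum_le_sum fun i _ => mul_le_mul_of_nonneg_left ?_ (ha i)
  have hM0 : 0 ≤ M := (abs_nonneg _).trans (hM i 0)
  have hS : 0 ≤ ∑ t with Meets 𝓑 (𝓑' i) t, |(n t : ℝ) - n' t| :=
    Finset.sum_nonneg fun _ _ => abs_nonneg _
  -- If a relevant count changes, it does so by at least 1, and the trivial bound `2 * M` on the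
  -- change of `H i` suffices. Otherwise `H i` does not change at all.
  by_cases hc : ∃ t, Meets 𝓑 (𝓑' i) t ∧ n t ≠ n' t
  · obtain ⟨t, ht, hne⟩ := hc
    have h1 : (1 : ℝ) ≤ |(n t : ℝ) - n' t| := by
      have : (1 : ℤ) ≤ |(n t : ℤ) - n' t| := Int.one_le_abs (by omega)
      exact_mod_cast this
    have h2 : 1 ≤ ∑ t with Meets 𝓑 (𝓑' i) t, |(n t : ℝ) - n' t| :=
      h1.trans (Finset.single_le_sum (f := fun t => |(n t : ℝ) - n' t|)
        (fun _ _ => abs_nonneg _) (Finset.mem_filter.2 ⟨Finset.mem_univ _, ht⟩))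
    have h3 := abs_sub (H i (countOfAtoms 𝓑 n)) (H i (countOfAtoms 𝓑 n'))
    have h4 := hM i (countOfAtoms 𝓑 n)
    have h5 := hM i (countOfAtoms 𝓑 n')
    nlinarith
  · have : H i (countOfAtoms 𝓑 n) = H i (countOfAtoms 𝓑 n') := by
      refine hH i fun B hB => Finset.sum_congr rfl fun t _ => ?_
      split_ifs with hBt
      · by_contra hne
        exact hc ⟨t, ⟨B, Finset.mem_coe.1 hB, hBt⟩, hne⟩
      · rfl
    rw [this, sub_self, abs_zero]
    positivity

end Atoms

section Restricted

variable {d : ℕ} {𝓢 : Type*} [MeasurableSpace 𝓢] {X : 𝓢 → Config d} {P : Measure 𝓢}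

/-- The covariance inequality for Lipschitz functions of finitely many functions of counts. -/
lemma abs_crossCov_countField_le [IsFiniteMeasure P] (hX : Measurable X)
    (hassoc : IsAssociated X P)
    {ρ₁ : (Fin 1 → EuclideanSpace ℝ (Fin d)) → ℝ} {ρ₂ : (Fin 2 → EuclideanSpace ℝ (Fin d)) → ℝ}
    (hρ₁ : IsIntensity X P 1 ρ₁) (hρ₂ : IsIntensity X P 2 ρ₂) {ι : Type*}
    {C : ι → Set (EuclideanSpace ℝ (Fin d))} (hCb : ∀ i, Bornology.IsBounded (C i))
    {𝓑 : ι → Finset (Set (EuclideanSpace ℝ (Fin d)))}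
    (h𝓑 : ∀ i, ∀ B ∈ 𝓑 i, IsBoundedFor ρ₁ B ∧ B ⊆ C i)
    {H : ι → (Set (EuclideanSpace ℝ (Fin d)) → ℕ) → ℝ} (hH : ∀ i, DependsOn (H i) (𝓑 i))
    {M : ℝ} (hM0 : 0 ≤ M) (hM : ∀ i x, |H i x| ≤ M) {J J' : Finset ι}
    (hdisj : ∀ i ∈ J, ∀ j ∈ J', Disjoint (C i) (C j)) {g : ι → ι → ℝ} (hg0 : ∀ i j, 0 ≤ g i j)
    (hg : ∀ i ∈ J, ∀ j ∈ J', ∀ x ∈ C i, ∀ y ∈ C j, |pairCov ρ₁ ρ₂ x y| ≤ g i j)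
    {F G : (ι → ℝ) → ℝ} {a b : ι → ℝ} (ha : ∀ i, 0 ≤ a i) (hb : ∀ i, 0 ≤ b i)
    (hF : ∀ v w : ι → ℝ, (∀ i, |v i| ≤ M) → (∀ i, |w i| ≤ M) →
      |F v - F w| ≤ ∑ i ∈ J, a i * |v i - w i|)
    (hG : ∀ v w : ι → ℝ, (∀ i, |v i| ≤ M) → (∀ i, |w i| ≤ M) →
      |G v - G w| ≤ ∑ i ∈ J', b i * |v i - w i|)
    {K : ℝ} (hFK : ∀ v : ι → ℝ, (∀ i, |v i| ≤ M) → |F v| ≤ K)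
    (hGK : ∀ v : ι → ℝ, (∀ i, |v i| ≤ M) → |G v| ≤ K) :
    |crossCov (fun ω => F fun i => H i (countField (X ω)))
        (fun ω => G fun i => H i (countField (X ω))) P|
      ≤ (2 * M) ^ 2 * ∑ i ∈ J, ∑ j ∈ J',
          a i * b j * (g i j * (volume (C i)).toReal * (volume (C j)).toReal) := by
  classical
  have family : ∀ (Q : Finset ι) (E : (ι → ℝ) → ℝ) (e : ι → ℝ),
      (∀ v w : ι → ℝ, (∀ i, |v i| ≤ M) → (∀ i, |w i| ≤ M) →
        |E v - E w| ≤ ∑ i ∈ Q, e i * |v i - w i|) →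
      ∀ ω, E (fun i => H i (countField (X ω))) = E (fun i => H i (countOfAtoms (Q.biUnion 𝓑)
        (countVec X (fun t => atom (Q.biUnion 𝓑) (atomLabel (Q.biUnion 𝓑) t)) ω))) := by
    intro Q E e hE ω
    have h := hE (fun i => H i (countField (X ω))) (fun i => H i (countOfAtoms (Q.biUnion 𝓑)
        (countVec X (fun t => atom (Q.biUnion 𝓑) (atomLabel (Q.biUnion 𝓑) t)) ω)))
        (fun i => hM i _) (fun i => hM i _)
    -- The Lipschitz bound shows that `E` depends only on the coordinates in `Q`, where passing to
    -- atoms changes nothing.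
    rw [Finset.sum_eq_zero, abs_nonpos_iff, sub_eq_zero] at h
    · exact h
    · intro i hi
      have : H i (countField (X ω)) = H i (countOfAtoms (Q.biUnion 𝓑)
          (countVec X (fun t => atom (Q.biUnion 𝓑) (atomLabel (Q.biUnion 𝓑) t)) ω)) := by
        refine hH i fun B hB => ?_
        exact (countOfAtoms_eq X (Finset.mem_biUnion.2 ⟨i, hi, Finset.mem_coe.1 hB⟩)
          (h𝓑 i B (Finset.mem_coe.1 hB)).1.isBounded ω).symm
      rw [this, sub_self, abs_zero, mul_zero]
  have hmeas : ∀ Q : Finset ι, ∀ B ∈ Q.biUnion 𝓑, IsBoundedFor ρ₁ B := by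
    intro Q B hB
    obtain ⟨i, -, hi⟩ := Finset.mem_biUnion.1 hB
    exact (h𝓑 i B hi).1
  have hatom : ∀ (Q : Finset ι) t, ∃ i ∈ Q, ∃ B ∈ 𝓑 i, B ∈ atomLabel (Q.biUnion 𝓑) t := by
    intro Q t
    obtain ⟨h1, h2⟩ := atomLabel_mem (Q.biUnion 𝓑) t
    obtain ⟨B, hB⟩ := Finset.nonempty_iff_ne_empty.2 h1
    obtain ⟨i, hi, hi'⟩ := Finset.mem_biUnion.1 (h2 hB)
    exact ⟨i, hi, B, hi', hB⟩
  have hgood : ∀ (Q : Finset ι) t, IsBoundedFor ρ₁ (atom (Q.biUnion 𝓑) (atomLabel (Q.biUnion 𝓑) t)) := by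
    intro Q t
    obtain ⟨i, hi, B, hB, hBt⟩ := hatom Q t
    exact (h𝓑 i B hB).1.mono (measurableSet_atom (fun B hB => (hmeas Q B hB).measurableSet) _)
      (atom_subset hBt)
  set A := fun t => atom (J.biUnion 𝓑) (atomLabel (J.biUnion 𝓑) t) with hAdef
  set B := fun t => atom (J'.biUnion 𝓑) (atomLabel (J'.biUnion 𝓑) t) with hBdef
  have hAC : ∀ i t, Meets (J.biUnion 𝓑) (𝓑 i) t → A t ⊆ C i := by
    rintro i t ⟨S, hS, hSt⟩
    exact (atom_subset hSt).trans (h𝓑 i S hS).2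
  have hBC : ∀ j t, Meets (J'.biUnion 𝓑) (𝓑 j) t → B t ⊆ C j := by
    rintro i t ⟨S, hS, hSt⟩
    exact (atom_subset hSt).trans (h𝓑 i S hS).2
  -- An atom may lie in several `C i`. The supremum of `|D|` over the two atoms themselves is at
  -- most `g i j` for every admissible pair `(i, j)`, so no choice of pair is needed. For an empty
  -- atom it is 0.
  set γ : Fin (atomIndex (J.biUnion 𝓑)).card → Fin (atomIndex (J'.biUnion 𝓑)).card → ℝ :=
    fun s t => sSup {r | ∃ x ∈ A s, ∃ y ∈ B t, r = |pairCov ρ₁ ρ₂ x y|} with hγ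
  have hγle : ∀ i ∈ J, ∀ j ∈ J', ∀ s t, Meets (J.biUnion 𝓑) (𝓑 i) s →
      Meets (J'.biUnion 𝓑) (𝓑 j) t → γ s t ≤ g i j := by
    intro i hi j hj s t hs ht
    refine Real.sSup_le ?_ (hg0 i j)
    rintro _ ⟨x, hx, y, hy, rfl⟩
    exact hg i hi j hj x (hAC i s hs hx) y (hBC j t ht hy)
  have hγ0 : ∀ s t, 0 ≤ γ s t := by
    intro s t
    refine Real.sSup_nonneg ?_
    rintro _ ⟨x, _, y, _, rfl⟩
    exact abs_nonneg _
  have main := abs_crossCov_countVec_le hX hassoc hρ₁ hρ₂ (A := A) (B := B) (hgood J) (hgood J')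
    (fun s t hst => disjoint_atom ((atomLabel_injective _).ne hst))
    (fun s t hst => disjoint_atom ((atomLabel_injective _).ne hst))
    (fun s t => by
      obtain ⟨i, hi, S, hS, hSs⟩ := hatom J s
      obtain ⟨j, hj, S', hS', hSt⟩ := hatom J' t
      exact (hdisj i hi j hj).mono (hAC i s ⟨S, hS, hSs⟩) (hBC j t ⟨S', hS', hSt⟩))
    (g := γ) hγ0
    (fun s t x hx y hy => by
      obtain ⟨i, hi, S, hS, hSs⟩ := hatom J s
      obtain ⟨j, hj, S', hS', hSt⟩ := hatom J' t
      refine le_csSup ⟨g i j, ?_⟩ ⟨x, hx, y, hy, rfl⟩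
      rintro _ ⟨x, hx, y, hy, rfl⟩
      exact hg i hi j hj x (hAC i s ⟨S, hS, hSs⟩ hx) y (hBC j t ⟨S', hS', hSt⟩ hy))
    (Φ := fun n => F fun i => H i (countOfAtoms (J.biUnion 𝓑) n))
    (Ψ := fun n => G fun i => H i (countOfAtoms (J'.biUnion 𝓑) n))
    (a := fun t => 2 * M * ∑ i ∈ J, if Meets (J.biUnion 𝓑) (𝓑 i) t then a i else 0)
    (b := fun t => 2 * M * ∑ i ∈ J', if Meets (J'.biUnion 𝓑) (𝓑 i) t then b i else 0)
    (fun t => mul_nonneg (by positivity) (Finset.sum_nonneg fun i _ => by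
      split_ifs; exacts [ha i, le_rfl]))
    (fun t => mul_nonneg (by positivity) (Finset.sum_nonneg fun i _ => by
      split_ifs; exacts [hb i, le_rfl]))
    (abs_sub_le_sum_atoms hH hM ha hF) (abs_sub_le_sum_atoms hH hM hb hG)
    (C := K) (fun n => hFK _ fun i => hM i _) (fun n => hGK _ fun i => hM i _)
  have eF : (fun ω => F fun i => H i (countField (X ω))) = fun ω =>
      F fun i => H i (countOfAtoms (J.biUnion 𝓑) (countVec X A ω)) := funext (family J F a hF)
  have eG : (fun ω => G fun i => H i (countField (X ω))) = fun ω =>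
      G fun i => H i (countOfAtoms (J'.biUnion 𝓑) (countVec X B ω)) := funext (family J' G b hG)
  rw [eF, eG]
  refine main.trans ?_
  set vA := fun s => (volume (A s)).toReal with hvA
  set vB := fun t => (volume (B t)).toReal with hvB
  have hvA0 : ∀ s, 0 ≤ vA s := fun s => ENNReal.toReal_nonneg
  have hvB0 : ∀ t, 0 ≤ vB t := fun t => ENNReal.toReal_nonneg
  -- Exchanging the sums groups the atoms by the sites whose sets generate them; an atom occurs once
  -- for each such site.
  calc ∑ s, ∑ t, (2 * M * ∑ i ∈ J, if Meets (J.biUnion 𝓑) (𝓑 i) s then a i else 0) *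
        (2 * M * ∑ j ∈ J', if Meets (J'.biUnion 𝓑) (𝓑 j) t then b j else 0) *
        (γ s t * vA s * vB t)
      = (2 * M) ^ 2 * ∑ i ∈ J, ∑ j ∈ J', a i * b j *
          ∑ s with Meets (J.biUnion 𝓑) (𝓑 i) s, ∑ t with Meets (J'.biUnion 𝓑) (𝓑 j) t,
            γ s t * vA s * vB t := by
        have e1 : ∀ s t, (2 * M * ∑ i ∈ J, if Meets (J.biUnion 𝓑) (𝓑 i) s then a i else 0) *
            (2 * M * ∑ j ∈ J', if Meets (J'.biUnion 𝓑) (𝓑 j) t then b j else 0) *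
            (γ s t * vA s * vB t) = ∑ i ∈ J, ∑ j ∈ J', (2 * M) ^ 2 * (a i * b j *
              (if Meets (J.biUnion 𝓑) (𝓑 i) s then
                (if Meets (J'.biUnion 𝓑) (𝓑 j) t then γ s t * vA s * vB t else 0) else 0)) := by
          intro s t
          rw [mul_mul_mul_comm (2 * M) _ (2 * M), Finset.sum_mul_sum, Finset.mul_sum, Finset.sum_mul]
          refine Finset.sum_congr rfl fun i _ => ?_
          rw [Finset.mul_sum, Finset.sum_mul]
          refine Finset.sum_congr rfl fun j _ => ?_
          split_ifs <;> ring
        simp_rw [e1]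
        have e2 : ∀ s, ∑ t, ∑ i ∈ J, ∑ j ∈ J', (2 * M) ^ 2 * (a i * b j *
              (if Meets (J.biUnion 𝓑) (𝓑 i) s then
                (if Meets (J'.biUnion 𝓑) (𝓑 j) t then γ s t * vA s * vB t else 0) else 0)) =
            ∑ i ∈ J, ∑ j ∈ J', (2 * M) ^ 2 * (a i * b j * (if Meets (J.biUnion 𝓑) (𝓑 i) s then
                ∑ t, (if Meets (J'.biUnion 𝓑) (𝓑 j) t then γ s t * vA s * vB t else 0)
                  else 0)) := by
          intro s
          rw [Finset.sum_comm]
          refine Finset.sum_congr rfl fun i _ => ?_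
          rw [Finset.sum_comm]
          refine Finset.sum_congr rfl fun j _ => ?_
          rw [← Finset.mul_sum, ← Finset.mul_sum]
          split_ifs <;> simp
        simp_rw [e2]
        rw [Finset.sum_comm, Finset.mul_sum]
        refine Finset.sum_congr rfl fun i _ => ?_
        rw [Finset.sum_comm, Finset.mul_sum]
        refine Finset.sum_congr rfl fun j _ => ?_
        rw [← Finset.mul_sum, ← Finset.mul_sum]
        simp_rw [Finset.sum_filter]
    _ ≤ _ := by
        refine mul_le_mul_of_nonneg_left (Finset.sum_le_sum fun i hi =>
          Finset.sum_le_sum fun j hj => mul_le_mul_of_nonneg_left ?_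
            (mul_nonneg (ha i) (hb j))) (sq_nonneg _)
        have sA := sum_volume_atom_le (𝓑 := J.biUnion 𝓑) (𝓑' := 𝓑 i) (C := C i)
          (fun B hB => (hmeas J B hB).measurableSet) (hCb i) fun B hB => (h𝓑 i B hB).2
        have sB := sum_volume_atom_le (𝓑 := J'.biUnion 𝓑) (𝓑' := 𝓑 j) (C := C j)
          (fun B hB => (hmeas J' B hB).measurableSet) (hCb j) fun B hB => (h𝓑 j B hB).2
        calc _ ≤ ∑ s with Meets (J.biUnion 𝓑) (𝓑 i) s, ∑ t with Meets (J'.biUnion 𝓑) (𝓑 j) t,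
                g i j * vA s * vB t := by
              refine Finset.sum_le_sum fun s hs => Finset.sum_le_sum fun t ht => ?_
              have := hγle i hi j hj s t (Finset.mem_filter.1 hs).2 (Finset.mem_filter.1 ht).2
              exact mul_le_mul_of_nonneg_right
                (mul_le_mul_of_nonneg_right this (hvA0 s)) (hvB0 t)
          _ = g i j * ((∑ s with Meets (J.biUnion 𝓑) (𝓑 i) s, vA s) *
                ∑ t with Meets (J'.biUnion 𝓑) (𝓑 j) t, vB t) := by
              rw [Finset.sum_mul_sum, Finset.mul_sum]
              refine Finset.sum_congr rfl fun s _ => ?_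
              rw [Finset.mul_sum]
              exact Finset.sum_congr rfl fun t _ => by ring
          _ ≤ g i j * ((volume (C i)).toReal * (volume (C j)).toReal) :=
              mul_le_mul_of_nonneg_left (mul_le_mul sA sB (Finset.sum_nonneg fun t _ => hvB0 t)
                ENNReal.toReal_nonneg) (hg0 i j)
          _ = _ := by ring

/-- The covariance inequality for an associated point process: Lipschitz functions of bounded
functionals of the configuration in two separated families of sets. -/
theorem abs_crossCov_restrict_le [IsProbabilityMeasure P] (hX : Measurable X)
    (hassoc : IsAssociated X P)
    {ρ₁ : (Fin 1 → EuclideanSpace ℝ (Fin d)) → ℝ} {ρ₂ : (Fin 2 → EuclideanSpace ℝ (Fin d)) → ℝ}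
    (hρ₁ : IsIntensity X P 1 ρ₁) (hρ₂ : IsIntensity X P 2 ρ₂) {ι : Type*}
    {C : ι → Set (EuclideanSpace ℝ (Fin d))} (hC : ∀ i, MeasurableSet (C i))
    (hCb : ∀ i, Bornology.IsBounded (C i)) {u : ι → Config d → ℝ} (hu : ∀ i, Measurable (u i))
    {M : ℝ} (hM0 : 0 ≤ M) (hM : ∀ i x, |u i x| ≤ M) {J J' : Finset ι}
    (hdisj : ∀ i ∈ J, ∀ j ∈ J', Disjoint (C i) (C j)) {g : ι → ι → ℝ} (hg0 : ∀ i j, 0 ≤ g i j)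
    (hg : ∀ i ∈ J, ∀ j ∈ J', ∀ x ∈ C i, ∀ y ∈ C j, |pairCov ρ₁ ρ₂ x y| ≤ g i j)
    {F G : (ι → ℝ) → ℝ} (hFm : Measurable F) (hGm : Measurable G) {a b : ι → ℝ}
    (ha : ∀ i, 0 ≤ a i) (hb : ∀ i, 0 ≤ b i)
    (hF : ∀ v w : ι → ℝ, (∀ i, |v i| ≤ M) → (∀ i, |w i| ≤ M) →
      |F v - F w| ≤ ∑ i ∈ J, a i * |v i - w i|)
    (hG : ∀ v w : ι → ℝ, (∀ i, |v i| ≤ M) → (∀ i, |w i| ≤ M) →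
      |G v - G w| ≤ ∑ i ∈ J', b i * |v i - w i|) :
    |crossCov (fun ω => F fun i => u i ((X ω).restrict (C i)))
        (fun ω => G fun i => u i ((X ω).restrict (C i))) P|
      ≤ (2 * M) ^ 2 * ∑ i ∈ J, ∑ j ∈ J',
          a i * b j * (g i j * (volume (C i)).toReal * (volume (C j)).toReal) := by
  classical
  have bdd : ∀ (Q : Finset ι) (E : (ι → ℝ) → ℝ) (e : ι → ℝ), (∀ i, 0 ≤ e i) →
      (∀ v w : ι → ℝ, (∀ i, |v i| ≤ M) → (∀ i, |w i| ≤ M) →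
        |E v - E w| ≤ ∑ i ∈ Q, e i * |v i - w i|) →
      ∀ v : ι → ℝ, (∀ i, |v i| ≤ M) → |E v| ≤ |E 0| + ∑ i ∈ Q, e i * M := by
    intro Q E e he hE v hv
    have h1 := hE v 0 hv fun _ => by simpa using hM0
    have h2 : ∑ i ∈ Q, e i * |v i - (0 : ι → ℝ) i| ≤ ∑ i ∈ Q, e i * M :=
      Finset.sum_le_sum fun i _ => mul_le_mul_of_nonneg_left (by simpa using hv i) (he i)
    have h3 := abs_sub_abs_le_abs_sub (E v) (E 0)
    linarith
  set K := max (|F 0| + ∑ i ∈ J, a i * M) (|G 0| + ∑ i ∈ J', b i * M) with hK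
  have hFK : ∀ v : ι → ℝ, (∀ i, |v i| ≤ M) → |F v| ≤ K := fun v hv =>
    (bdd J F a ha hF v hv).trans (le_max_left _ _)
  have hGK : ∀ v : ι → ℝ, (∀ i, |v i| ≤ M) → |G v| ≤ K := fun v hv =>
    (bdd J' G b hb hG v hv).trans (le_max_right _ _)
  have hK0 : 0 ≤ K := (abs_nonneg _).trans (hFK 0 fun _ => by simpa using hM0)
  set bound := (2 * M) ^ 2 * ∑ i ∈ J, ∑ j ∈ J',
    a i * b j * (g i j * (volume (C i)).toReal * (volume (C j)).toReal) with hbound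
  set L := 2 * K * (∑ i ∈ J, a i) + 2 * K * ∑ j ∈ J', b j with hL
  -- The inequality for functions of counts has the same right-hand side for every approximant, so
  -- only the `L¹` errors, at most `η` per site, have to be paid for.
  have approx : ∀ η : ℝ, 0 < η → |crossCov (fun ω => F fun i => u i ((X ω).restrict (C i)))
      (fun ω => G fun i => u i ((X ω).restrict (C i))) P| ≤ bound + L * η := by
    intro η hη
    choose 𝓑 H h1 h2 h3 h4 using fun i =>
      exists_dependsOn_approx (P := P) hX hρ₁.1 (hC i) (hCb i) (hu i) (hM i) hη
    have key := abs_crossCov_countField_le hX hassoc hρ₁ hρ₂ hCb h1 h2 hM0 h3 hdisj hg0 hg ha hb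
      hF hG hFK hGK
    have mU : ∀ i, Measurable fun ω => u i ((X ω).restrict (C i)) := fun i =>
      (hu i).comp ((Config.measurable_restrict (hC i)).comp hX)
    have mH : ∀ i, Measurable fun ω => H i (countField (X ω)) := fun i =>
      (measurable_comp_countField (fun B hB => (h1 i B hB).1.measurableSet) (h2 i)).comp hX
    have iUH : ∀ i, Integrable (fun ω => |u i ((X ω).restrict (C i)) - H i (countField (X ω))|) P :=
      fun i => by
        refine Integrable.abs (Integrable.sub ?_ ?_)
        · exact Integrable.of_bound (mU i).aestronglyMeasurable M (ae_of_all _ fun ω => hM i _)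
        · exact Integrable.of_bound (mH i).aestronglyMeasurable M (ae_of_all _ fun ω => h3 i _)
    have close : ∀ (Q : Finset ι) (E : (ι → ℝ) → ℝ) (e : ι → ℝ), (∀ i, 0 ≤ e i) →
        Measurable E → (∀ v : ι → ℝ, (∀ i, |v i| ≤ M) → |E v| ≤ K) →
        (∀ v w : ι → ℝ, (∀ i, |v i| ≤ M) → (∀ i, |w i| ≤ M) →
          |E v - E w| ≤ ∑ i ∈ Q, e i * |v i - w i|) →
        Integrable (fun ω => E fun i => u i ((X ω).restrict (C i))) P ∧
        Integrable (fun ω => E fun i => H i (countField (X ω))) P ∧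
        Measurable (fun ω => E fun i => u i ((X ω).restrict (C i))) ∧
        Measurable (fun ω => E fun i => H i (countField (X ω))) ∧
        ∫ ω, |(E fun i => u i ((X ω).restrict (C i))) - E fun i => H i (countField (X ω))| ∂P ≤
          (∑ i ∈ Q, e i) * η := by
      intro Q E e he hEm hEK hE
      have m1 : Measurable (fun ω => E fun i => u i ((X ω).restrict (C i))) :=
        hEm.comp (measurable_pi_lambda _ mU)
      have m2 : Measurable (fun ω => E fun i => H i (countField (X ω))) :=
        hEm.comp (measurable_pi_lambda _ mH)
      have i1 : Integrable (fun ω => E fun i => u i ((X ω).restrict (C i))) P :=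
        Integrable.of_bound m1.aestronglyMeasurable K (ae_of_all _ fun ω => hEK _ fun i => hM i _)
      have i2 : Integrable (fun ω => E fun i => H i (countField (X ω))) P :=
        Integrable.of_bound m2.aestronglyMeasurable K (ae_of_all _ fun ω => hEK _ fun i => h3 i _)
      refine ⟨i1, i2, m1, m2, ?_⟩
      calc _ ≤ ∫ ω, ∑ i ∈ Q, e i * |u i ((X ω).restrict (C i)) - H i (countField (X ω))| ∂P := by
            refine integral_mono (i1.sub i2).abs
              (integrable_finsetSum _ fun i _ => (iUH i).const_mul _) fun ω => ?_
            exact hE _ _ (fun i => hM i _) (fun i => h3 i _)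
        _ = ∑ i ∈ Q, e i * ∫ ω, |u i ((X ω).restrict (C i)) - H i (countField (X ω))| ∂P := by
            rw [integral_finsetSum _ fun i _ => (iUH i).const_mul _]
            simp_rw [integral_const_mul]
        _ ≤ ∑ i ∈ Q, e i * η :=
            Finset.sum_le_sum fun i _ => mul_le_mul_of_nonneg_left (h4 i) (he i)
        _ = _ := (Finset.sum_mul _ _ _).symm
    obtain ⟨iF, iF', mF, mF', cF⟩ := close J F a ha hFm hFK hF
    obtain ⟨iG, iG', mG, mG', cG⟩ := close J' G b hb hGm hGK hG
    set f := fun ω => F fun i => u i ((X ω).restrict (C i)) with hf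
    set f' := fun ω => F fun i => H i (countField (X ω)) with hf'
    set γ := fun ω => G fun i => u i ((X ω).restrict (C i)) with hγ
    set γ' := fun ω => G fun i => H i (countField (X ω)) with hγ'
    have bf : ∀ ω, |f ω| ≤ K := fun ω => hFK _ fun i => hM i _
    have bf' : ∀ ω, |f' ω| ≤ K := fun ω => hFK _ fun i => h3 i _
    have bγ : ∀ ω, |γ ω| ≤ K := fun ω => hGK _ fun i => hM i _
    have bγ' : ∀ ω, |γ' ω| ≤ K := fun ω => hGK _ fun i => h3 i _
    have iprod : Integrable (fun ω => f ω * γ ω) P :=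
      iG.bdd_mul mF.aestronglyMeasurable (c := K) (ae_of_all _ bf)
    have iprod' : Integrable (fun ω => f' ω * γ' ω) P :=
      iG'.bdd_mul mF'.aestronglyMeasurable (c := K) (ae_of_all _ bf')
    have d1 : |∫ ω, f ω ∂P - ∫ ω, f' ω ∂P| ≤ (∑ i ∈ J, a i) * η := by
      rw [← integral_sub iF iF']
      exact (abs_integral_le_integral_abs).trans cF
    have d2 : |∫ ω, γ ω ∂P - ∫ ω, γ' ω ∂P| ≤ (∑ i ∈ J', b i) * η := by
      rw [← integral_sub iG iG']
      exact (abs_integral_le_integral_abs).trans cG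
    have d3 : |∫ ω, f ω * γ ω ∂P - ∫ ω, f' ω * γ' ω ∂P| ≤
        K * ((∑ i ∈ J, a i) * η) + K * ((∑ i ∈ J', b i) * η) := by
      rw [← integral_sub iprod iprod']
      refine (abs_integral_le_integral_abs).trans ?_
      calc ∫ ω, |f ω * γ ω - f' ω * γ' ω| ∂P ≤ ∫ ω, (K * |f ω - f' ω| + K * |γ ω - γ' ω|) ∂P := by
            refine integral_mono (iprod.sub iprod').abs
              (((iF.sub iF').abs.const_mul K).add ((iG.sub iG').abs.const_mul K)) fun ω => ?_
            have e : f ω * γ ω - f' ω * γ' ω = γ ω * (f ω - f' ω) + f' ω * (γ ω - γ' ω) := by ring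
            show |f ω * γ ω - f' ω * γ' ω| ≤ K * |f ω - f' ω| + K * |γ ω - γ' ω|
            rw [e]
            refine (abs_add_le _ _).trans ?_
            rw [abs_mul, abs_mul]
            gcongr
            exacts [bγ ω, bf' ω]
        _ = K * ∫ ω, |f ω - f' ω| ∂P + K * ∫ ω, |γ ω - γ' ω| ∂P := by
            have j1 : Integrable (fun ω => K * |f ω - f' ω|) P := (iF.sub iF').abs.const_mul K
            have j2 : Integrable (fun ω => K * |γ ω - γ' ω|) P := (iG.sub iG').abs.const_mul K
            rw [integral_add j1 j2, integral_const_mul, integral_const_mul]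
        _ ≤ _ := by gcongr
    have bint : ∀ h : 𝓢 → ℝ, (∀ ω, |h ω| ≤ K) → |∫ ω, h ω ∂P| ≤ K := by
      intro h hh
      have := norm_integral_le_of_norm_le_const (μ := P) (f := h) (C := K) (ae_of_all _ hh)
      simpa using this
    have d4 : |(∫ ω, f ω ∂P) * (∫ ω, γ ω ∂P) - (∫ ω, f' ω ∂P) * (∫ ω, γ' ω ∂P)| ≤
        K * ((∑ i ∈ J, a i) * η) + K * ((∑ i ∈ J', b i) * η) := by
      have e : (∫ ω, f ω ∂P) * (∫ ω, γ ω ∂P) - (∫ ω, f' ω ∂P) * (∫ ω, γ' ω ∂P) =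
          (∫ ω, γ ω ∂P) * (∫ ω, f ω ∂P - ∫ ω, f' ω ∂P) +
            (∫ ω, f' ω ∂P) * (∫ ω, γ ω ∂P - ∫ ω, γ' ω ∂P) := by ring
      rw [e]
      refine (abs_add_le _ _).trans ?_
      rw [abs_mul, abs_mul]
      gcongr
      exacts [bint γ bγ, bint f' bf']
    have e : crossCov f γ P = crossCov f' γ' P + ((∫ ω, f ω * γ ω ∂P - ∫ ω, f' ω * γ' ω ∂P) -
        ((∫ ω, f ω ∂P) * (∫ ω, γ ω ∂P) - (∫ ω, f' ω ∂P) * (∫ ω, γ' ω ∂P))) := by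
      unfold crossCov; ring
    rw [e]
    refine (abs_add_le _ _).trans (add_le_add key ((abs_sub _ _).trans ?_))
    rw [hL]
    linarith
  by_contra hcon
  push Not at hcon
  have hL0 : 0 ≤ L := by
    have := Finset.sum_nonneg fun i (_ : i ∈ J) => ha i
    have := Finset.sum_nonneg fun i (_ : i ∈ J') => hb i
    positivity
  set gap := |crossCov (fun ω => F fun i => u i ((X ω).restrict (C i)))
      (fun ω => G fun i => u i ((X ω).restrict (C i))) P| - bound with hgap
  have hgap0 : 0 < gap := sub_pos.2 hcon
  -- The excess over the bound is contradicted by a choice of `η` for which the error is at most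
  -- half of it.
  have h := approx (gap / (2 * (L + 1))) (by positivity)
  have h2 : L * (gap / (2 * (L + 1))) ≤ gap / 2 := by
    rw [← mul_div_assoc, div_le_div_iff₀ (by positivity) (by positivity)]
    nlinarith
  linarith

end Restricted

end AssocPP

namespace AssocPP

/-! ### Covariances and variances of sums -/

section Covariance

variable {𝓢 : Type*} [MeasurableSpace 𝓢] {P : Measure 𝓢} [IsProbabilityMeasure P]

/-- Both `U + V` and `U - V` have nonnegative variance. -/
lemma abs_covariance_le_add_variance {U V : 𝓢 → ℝ} (hU : MemLp U 2 P) (hV : MemLp V 2 P) :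
    |cov[U, V; P]| ≤ (Var[U; P] + Var[V; P]) / 2 := by
  have h1 := variance_nonneg (U + V) P
  have h2 := variance_nonneg (U - V) P
  rw [variance_add hU hV] at h1
  rw [variance_sub hU hV] at h2
  rw [abs_le]
  constructor <;> linarith

lemma abs_covariance_le_sqrt_mul_sqrt {U V : 𝓢 → ℝ} (hU : MemLp U 2 P) (hV : MemLp V 2 P) :
    |cov[U, V; P]| ≤ √(Var[U; P]) * √(Var[V; P]) := by
  have key : ∀ x : ℝ, 0 ≤ Var[U; P] * (x * x) + (2 * cov[U, V; P]) * x + Var[V; P] := by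
    intro x
    have h := variance_nonneg (x • U + V) P
    rw [variance_add (hU.const_smul x) hV, variance_smul, covariance_smul_left] at h
    linarith
  have h := discrim_le_zero key
  rw [discrim] at h
  rw [← Real.sqrt_mul (variance_nonneg _ _)]
  refine Real.le_sqrt_of_sq_le ?_
  rw [sq_abs]
  linarith

lemma abs_covariance_le_of_abs_le {U V : 𝓢 → ℝ} (hU : MemLp U 2 P) (hV : MemLp V 2 P) {M : ℝ}
    (hM : ∀ ω, |V ω| ≤ M) : |cov[U, V; P]| ≤ 2 * M * ∫ ω, |U ω| ∂P := by
  have iU : Integrable U P := hU.integrable one_le_two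
  have iV : Integrable V P := hV.integrable one_le_two
  have h1 : |∫ ω, U ω * V ω ∂P| ≤ M * ∫ ω, |U ω| ∂P := by
    refine abs_integral_le_integral_abs.trans ?_
    rw [← integral_const_mul]
    refine integral_mono_of_nonneg (ae_of_all _ fun ω => abs_nonneg _) (iU.abs.const_mul M)
      (ae_of_all _ fun ω => ?_)
    show |U ω * V ω| ≤ M * |U ω|
    rw [abs_mul, mul_comm]
    exact mul_le_mul_of_nonneg_right (hM ω) (abs_nonneg _)
  have h2 : |∫ ω, U ω ∂P| ≤ ∫ ω, |U ω| ∂P := abs_integral_le_integral_abs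
  have h3 : |∫ ω, V ω ∂P| ≤ M := by
    have := norm_integral_le_of_norm_le_const (μ := P) (f := V) (C := M) (ae_of_all _ hM)
    simpa using this
  have hI : 0 ≤ ∫ ω, |U ω| ∂P := integral_nonneg fun ω => abs_nonneg _
  rw [covariance_eq_sub hU hV]
  simp only [Pi.mul_apply]
  refine (abs_sub _ _).trans ?_
  rw [abs_mul]
  have := mul_le_mul h2 h3 (abs_nonneg _) hI
  linarith

/-- Nonnegativity of the variance of `|U - E U|`. -/
lemma integral_abs_sub_le_sqrt_variance {U : 𝓢 → ℝ} (hU : MemLp U 2 P) :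
    ∫ ω, |U ω - ∫ ω', U ω' ∂P| ∂P ≤ √(Var[U; P]) := by
  set D : 𝓢 → ℝ := fun ω => |U ω - ∫ ω', U ω' ∂P| with hD
  have hDm : MemLp D 2 P := (hU.sub (memLp_const _)).abs
  have h0 := variance_nonneg D P
  rw [variance_eq_sub hDm] at h0
  refine Real.le_sqrt_of_sq_le ?_
  have e : ∫ ω, (D ^ 2) ω ∂P = Var[U; P] := by
    rw [variance_eq_integral hU.aestronglyMeasurable.aemeasurable]
    refine integral_congr_ae (ae_of_all _ fun ω => ?_)
    simp [hD]
  rw [e] at h0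
  linarith

variable {ι : Type*} [AddCommGroup ι]

lemma sum_sub_le {c : ι → ℝ} {K : ℝ} (hc : ∀ J : Finset ι, ∑ k ∈ J, c k ≤ K) (I : Finset ι)
    (i : ι) : ∑ j ∈ I, c (i - j) ≤ K := by
  classical
  have := hc (I.image fun j => i - j)
  rwa [Finset.sum_image fun x _ y _ h => sub_right_injective h] at this

/-- Each row of the covariance matrix sums to at most `K`, since `j ↦ i - j` is injective. -/
lemma variance_sum_le {A : ι → 𝓢 → ℝ} {I : Finset ι} (hA : ∀ i ∈ I, MemLp (A i) 2 P) {c : ι → ℝ}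
    {K : ℝ} (hc : ∀ J : Finset ι, ∑ k ∈ J, c k ≤ K)
    (hcov : ∀ i ∈ I, ∀ j ∈ I, |cov[A i, A j; P]| ≤ c (i - j)) :
    Var[fun ω => ∑ i ∈ I, A i ω; P] ≤ I.card * K := by
  rw [variance_fun_sum' hA]
  calc ∑ i ∈ I, ∑ j ∈ I, cov[A i, A j; P] ≤ ∑ i ∈ I, ∑ j ∈ I, c (i - j) :=
        Finset.sum_le_sum fun i hi => Finset.sum_le_sum fun j hj =>
          (le_abs_self _).trans (hcov i hi j hj)
    _ ≤ ∑ _ ∈ I, K := Finset.sum_le_sum fun i _ => sum_sub_le hc I i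
    _ = _ := by simp

end Covariance

/-! ### Weakly dependent random fields -/

section WeakDependence

variable {𝓢 : Type*} [MeasurableSpace 𝓢] {P : Measure 𝓢}
  {ι : Type*} [AddCommGroup ι] {E : Type*} [MeasurableSpace E]

/-- A random field `ξ` indexed by a group is weakly dependent with rate `t` off the finite set `B₀`
if covariances of Lipschitz functions of bounded functionals of the field over two families of sites
are controlled by the sum of the rates over pairs of sites. -/
def WeaklyDependent (P : Measure 𝓢) (ξ : ι → 𝓢 → E) (t : ι → ℝ) (B₀ : Finset ι) : Prop :=
  ∀ u : ι → E → ℝ, (∀ i, Measurable (u i)) → ∀ M : ℝ, 0 ≤ M → (∀ i x, |u i x| ≤ M) →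
    ∀ J J' : Finset ι, (∀ i ∈ J, ∀ j ∈ J', i - j ∉ B₀) →
    ∀ F G : (ι → ℝ) → ℝ, Measurable F → Measurable G →
    ∀ a b : ι → ℝ, (∀ i, 0 ≤ a i) → (∀ i, 0 ≤ b i) →
    (∀ v w : ι → ℝ, (∀ i, |v i| ≤ M) → (∀ i, |w i| ≤ M) →
      |F v - F w| ≤ ∑ i ∈ J, a i * |v i - w i|) →
    (∀ v w : ι → ℝ, (∀ i, |v i| ≤ M) → (∀ i, |w i| ≤ M) →
      |G v - G w| ≤ ∑ i ∈ J', b i * |v i - w i|) →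
    |cov[fun ω => F fun i => u i (ξ i ω), fun ω => G fun i => u i (ξ i ω); P]|
      ≤ (2 * M) ^ 2 * ∑ i ∈ J, ∑ j ∈ J', a i * b j * t (i - j)

/-- The left side vanishes up to the threshold; beyond it `|x| ^ (1 - p) ≤ M ^ (1 - p)`. -/
lemma abs_sub_clamp_le_rpow {M p : ℝ} (hM : 0 < M) (hp : 1 ≤ p) (x : ℝ) :
    |x - clamp M x| ≤ M ^ (1 - p) * |x| ^ p := by
  rcases le_or_gt |x| M with h | h
  · rw [clamp_of_abs_le h, sub_self, abs_zero]
    positivity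
  · have hx : 0 < |x| := hM.trans h
    have h1 : |x - clamp M x| ≤ |x| := by
      rcases abs_cases x with ⟨e, _⟩ | ⟨e, _⟩
      · rw [e] at h ⊢
        rw [clamp, min_eq_left h.le, max_eq_right (by linarith), abs_of_nonneg (by linarith)]
        linarith
      · rw [e] at h ⊢
        rw [clamp, min_eq_right (by linarith), max_eq_left (by linarith),
          abs_of_nonpos (by linarith)]
        linarith
    calc |x - clamp M x| ≤ |x| := h1
      _ = |x| ^ (1 - p) * |x| ^ p := by
          rw [← Real.rpow_add hx]; simp
      _ ≤ M ^ (1 - p) * |x| ^ p := by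
          refine mul_le_mul_of_nonneg_right ?_ (by positivity)
          exact Real.rpow_le_rpow_of_nonpos hM h.le (by linarith)

lemma abs_sub_clamp_le {M : ℝ} (hM : 0 ≤ M) (x : ℝ) : |x - clamp M x| ≤ |x| := by
  have h0 : clamp M 0 = 0 := clamp_of_abs_le (by simpa using hM)
  rcases le_or_gt |x| M with h | h
  · rw [clamp_of_abs_le h, sub_self, abs_zero]
    positivity
  · rcases abs_cases x with ⟨e, _⟩ | ⟨e, _⟩
    · rw [e] at h ⊢
      rw [clamp, min_eq_left h.le, max_eq_right (by linarith), abs_of_nonneg (by linarith)]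
      linarith
    · rw [e] at h ⊢
      rw [clamp, min_eq_right (by linarith), max_eq_left (by linarith),
        abs_of_nonpos (by linarith)]
      linarith

lemma sq_sub_clamp_le_rpow {M p : ℝ} (hM : 0 < M) (hp : 2 ≤ p) (x : ℝ) :
    (x - clamp M x) ^ 2 ≤ M ^ (2 - p) * |x| ^ p := by
  rcases le_or_gt |x| M with h | h
  · rw [clamp_of_abs_le h, sub_self, zero_pow two_ne_zero]
    positivity
  · have hx : 0 < |x| := hM.trans h
    calc (x - clamp M x) ^ 2 = |x - clamp M x| ^ 2 := (sq_abs _).symm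
      _ ≤ |x| ^ 2 := pow_le_pow_left₀ (abs_nonneg _) (abs_sub_clamp_le hM.le x) 2
      _ = |x| ^ (2 - p) * |x| ^ p := by
          rw [← Real.rpow_add hx]; simp
      _ ≤ M ^ (2 - p) * |x| ^ p := by
          refine mul_le_mul_of_nonneg_right ?_ (by positivity)
          exact Real.rpow_le_rpow_of_nonpos hM h.le (by linarith)

lemma memLp_two_of_integrable_rpow [IsFiniteMeasure P] {U : 𝓢 → ℝ} (hU : Measurable U) {p : ℝ}
    (hp : 2 ≤ p) (h : Integrable (fun ω => |U ω| ^ p) P) : MemLp U 2 P := by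
  rw [memLp_two_iff_integrable_sq hU.aestronglyMeasurable]
  refine ((integrable_const (1 : ℝ)).add h).mono' (hU.pow_const 2).aestronglyMeasurable
    (ae_of_all _ fun ω => ?_)
  rw [Real.norm_of_nonneg (sq_nonneg _)]
  show U ω ^ 2 ≤ 1 + |U ω| ^ p
  have h0 : 0 ≤ |U ω| ^ p := by positivity
  rcases le_or_gt |U ω| 1 with h1 | h1
  · have : U ω ^ 2 ≤ 1 := by rwa [sq_le_one_iff_abs_le_one]
    linarith
  · have : |U ω| ^ (2 : ℝ) ≤ |U ω| ^ p := Real.rpow_le_rpow_of_exponent_le h1.le hp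
    rw [Real.rpow_two, sq_abs] at this
    linarith

lemma variance_le_of_sq_le [IsProbabilityMeasure P] {U : 𝓢 → ℝ} (hU : Measurable U) {V : 𝓢 → ℝ}
    (hV : Integrable V P) (h : ∀ ω, U ω ^ 2 ≤ V ω) : Var[U; P] ≤ ∫ ω, V ω ∂P := by
  refine (variance_le_expectation_sq hU.aestronglyMeasurable).trans ?_
  exact integral_mono_of_nonneg (ae_of_all _ fun ω => sq_nonneg _) hV (ae_of_all _ h)

/-- Davydov's covariance inequality for weakly dependent fields with bounded moments. -/
theorem WeaklyDependent.abs_covariance_le [IsProbabilityMeasure P] {ξ : ι → 𝓢 → E} {t : ι → ℝ}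
    {B₀ : Finset ι} (h : WeaklyDependent P ξ t B₀) (hξ : ∀ i, Measurable (ξ i)) (h0 : 0 ∈ B₀)
    {δ : ℝ} (hδ : 0 < δ) {L : ℝ} {i j : ι} (hij : i - j ∉ B₀) (ht0 : 0 < t (i - j))
    (ht1 : t (i - j) ≤ 1) {u v : E → ℝ} (hu : Measurable u) (hv : Measurable v)
    (iu : Integrable (fun ω => |u (ξ i ω)| ^ (2 + δ)) P)
    (iv : Integrable (fun ω => |v (ξ j ω)| ^ (2 + δ)) P)
    (hLu : ∫ ω, |u (ξ i ω)| ^ (2 + δ) ∂P ≤ L) (hLv : ∫ ω, |v (ξ j ω)| ^ (2 + δ) ∂P ≤ L) :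
    |cov[fun ω => u (ξ i ω), fun ω => v (ξ j ω); P]| ≤ (4 + 5 * L) * t (i - j) ^ (δ / (2 + δ)) := by
  classical
  have hp : 0 < 2 + δ := by linarith
  set s := t (i - j) with hs
  -- This level balances the weak dependence term `M ^ 2 * s` against the truncation terms, of order
  -- `M ^ (-δ)`: both equal `s ^ (δ / (2 + δ))`.
  set M := s ^ (-(1 / (2 + δ))) with hMdef
  have hM1 : 1 ≤ M := Real.one_le_rpow_of_pos_of_le_one_of_nonpos ht0 ht1
    (by simp only [Left.neg_nonpos_iff]; positivity)
  have hM : 0 < M := by linarith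
  have hMδ : M ^ (2 - (2 + δ)) = s ^ (δ / (2 + δ)) := by
    rw [hMdef, ← Real.rpow_mul ht0.le]
    congr 1
    field_simp
    ring
  have hMs : M ^ 2 * s = s ^ (δ / (2 + δ)) := by
    rw [hMdef, ← Real.rpow_natCast, ← Real.rpow_mul ht0.le]
    nth_rewrite 2 [← Real.rpow_one s]
    rw [← Real.rpow_add ht0]
    congr 1
    push_cast
    field_simp
    ring
  have hM2 : M * M ^ (1 - (2 + δ)) = s ^ (δ / (2 + δ)) := by
    rw [← hMδ]
    nth_rewrite 1 [← Real.rpow_one M]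
    rw [← Real.rpow_add hM]
    congr 1
    ring
  set U : 𝓢 → ℝ := fun ω => u (ξ i ω) with hU
  set V : 𝓢 → ℝ := fun ω => v (ξ j ω) with hV
  have mU : Measurable U := hu.comp (hξ i)
  have mV : Measurable V := hv.comp (hξ j)
  set U₁ : 𝓢 → ℝ := fun ω => clamp M (U ω) with hU₁
  set V₁ : 𝓢 → ℝ := fun ω => clamp M (V ω) with hV₁
  have mU₁ : Measurable U₁ := (measurable_clamp M).comp mU
  have mV₁ : Measurable V₁ := (measurable_clamp M).comp mV
  have pU₁ : MemLp U₁ 2 P := MemLp.of_bound mU₁.aestronglyMeasurable M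
    (ae_of_all _ fun ω => abs_clamp_le hM.le _)
  have pV₁ : MemLp V₁ 2 P := MemLp.of_bound mV₁.aestronglyMeasurable M
    (ae_of_all _ fun ω => abs_clamp_le hM.le _)
  have pU : MemLp U 2 P := memLp_two_of_integrable_rpow mU (by linarith) iu
  have pV : MemLp V 2 P := memLp_two_of_integrable_rpow mV (by linarith) iv
  have pU₂ : MemLp (U - U₁) 2 P := pU.sub pU₁
  have pV₂ : MemLp (V - V₁) 2 P := pV.sub pV₁
  have eU : U = U₁ + (U - U₁) := by abel
  have eV : V = V₁ + (V - V₁) := by abel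
  -- Only the covariance of the two clamped parts uses weak dependence. The three others are
  -- controlled by moments, and the constants add up as `4 + 2 * L + 2 * L + L`.
  have split : cov[U, V; P] = cov[U₁, V₁; P] + cov[U₁, V - V₁; P] +
      (cov[U - U₁, V₁; P] + cov[U - U₁, V - V₁; P]) := by
    conv_lhs => rw [eU, eV]
    rw [covariance_add_left pU₁ pU₂ (pV₁.add pV₂), covariance_add_right pU₁ pV₁ pV₂,
      covariance_add_right pU₂ pV₁ pV₂]
  have hne : i ≠ j := by
    rintro rfl
    exact hij (by simpa using h0)
  have c11 : |cov[U₁, V₁; P]| ≤ 4 * s ^ (δ / (2 + δ)) := by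
    -- The functions of the two sites are encoded in one family by testing `k = i`, which is
    -- legitimate because `0 ∈ B₀` forces `i ≠ j`.
    have := h (fun k x => if k = i then clamp M (u x) else clamp M (v x))
      (fun k => by
        by_cases hk : k = i
        · simp only [hk, if_true]; exact (measurable_clamp M).comp hu
        · simp only [hk, if_false]; exact (measurable_clamp M).comp hv) M hM.le
      (fun k x => by split_ifs <;> exact abs_clamp_le hM.le _) {i} {j} (by simpa using hij)
      (fun w => w i) (fun w => w j) (measurable_pi_apply i) (measurable_pi_apply j)
      (fun _ => 1) (fun _ => 1) (fun _ => zero_le_one) (fun _ => zero_le_one)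
      (fun v w _ _ => by simp) (fun v w _ _ => by simp)
    simp only [if_true, hne.symm, if_false, Finset.sum_singleton, one_mul] at this
    refine this.trans_eq ?_
    rw [← hMs]
    ring
  have l1 : ∀ (W : 𝓢 → ℝ), Integrable (fun ω => |W ω| ^ (2 + δ)) P →
      ∫ ω, |W ω| ^ (2 + δ) ∂P ≤ L → 2 * M * ∫ ω, |W ω - clamp M (W ω)| ∂P ≤
        2 * L * s ^ (δ / (2 + δ)) := by
    intro W iW hW
    have : ∫ ω, |W ω - clamp M (W ω)| ∂P ≤ M ^ (1 - (2 + δ)) * L := by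
      refine le_trans ?_ (mul_le_mul_of_nonneg_left hW (by positivity))
      rw [← integral_const_mul]
      exact integral_mono_of_nonneg (ae_of_all _ fun ω => abs_nonneg _) (iW.const_mul _)
        (ae_of_all _ fun ω => abs_sub_clamp_le_rpow hM (by linarith) _)
    calc _ ≤ 2 * M * (M ^ (1 - (2 + δ)) * L) := mul_le_mul_of_nonneg_left this (by positivity)
      _ = 2 * L * (M * M ^ (1 - (2 + δ))) := by ring
      _ = _ := by rw [hM2]
  have l2 : ∀ (W : 𝓢 → ℝ), Measurable W → Integrable (fun ω => |W ω| ^ (2 + δ)) P →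
      ∫ ω, |W ω| ^ (2 + δ) ∂P ≤ L → Var[fun ω => W ω - clamp M (W ω); P] ≤
        L * s ^ (δ / (2 + δ)) := by
    intro W mW iW hW
    refine (variance_le_of_sq_le (mW.sub ((measurable_clamp M).comp mW)) (iW.const_mul _)
      fun ω => sq_sub_clamp_le_rpow hM (p := 2 + δ) (by linarith) (W ω)).trans ?_
    rw [integral_const_mul, hMδ, mul_comm]
    exact mul_le_mul_of_nonneg_right hW (by positivity)
  have c12 : |cov[U₁, V - V₁; P]| ≤ 2 * L * s ^ (δ / (2 + δ)) := by
    rw [covariance_comm]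
    exact (abs_covariance_le_of_abs_le pV₂ pU₁ fun ω => abs_clamp_le hM.le _).trans (l1 V iv hLv)
  have c21 : |cov[U - U₁, V₁; P]| ≤ 2 * L * s ^ (δ / (2 + δ)) :=
    (abs_covariance_le_of_abs_le pU₂ pV₁ fun ω => abs_clamp_le hM.le _).trans (l1 U iu hLu)
  have c22 : |cov[U - U₁, V - V₁; P]| ≤ L * s ^ (δ / (2 + δ)) := by
    refine (abs_covariance_le_add_variance pU₂ pV₂).trans ?_
    have h1 : Var[U - U₁; P] ≤ L * s ^ (δ / (2 + δ)) := l2 U mU iu hLu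
    have h2 : Var[V - V₁; P] ≤ L * s ^ (δ / (2 + δ)) := l2 V mV iv hLv
    linarith
  rw [split]
  calc _ ≤ |cov[U₁, V₁; P]| + |cov[U₁, V - V₁; P]| +
        (|cov[U - U₁, V₁; P]| + |cov[U - U₁, V - V₁; P]|) :=
        (abs_add_le _ _).trans (add_le_add (abs_add_le _ _) (abs_add_le _ _))
    _ ≤ _ := by linarith

/-- The truncation errors of a field with bounded moments contribute little to the variance of
its sums. -/
theorem WeaklyDependent.exists_variance_truncation_le [IsProbabilityMeasure P] {ξ : ι → 𝓢 → E}
    {t : ι → ℝ} {B₀ : Finset ι} (h : WeaklyDependent P ξ t B₀) (hξ : ∀ i, Measurable (ξ i))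
    (h0 : 0 ∈ B₀) {δ : ℝ} (hδ : 0 < δ) {L : ℝ} (ht0 : ∀ k, 0 < t k) (ht1 : ∀ k, t k ≤ 1)
    (htB : ∀ k ∈ B₀, t k = 1) (hsum : Summable fun k => t k ^ (δ / (2 + δ)))
    {y : ι → E → ℝ} (hy : ∀ i, Measurable (y i))
    (iy : ∀ i, Integrable (fun ω => |y i (ξ i ω)| ^ (2 + δ)) P)
    (hL : ∀ i, ∫ ω, |y i (ξ i ω)| ^ (2 + δ) ∂P ≤ L) {η : ℝ} (hη : 0 < η) :
    ∃ M : ℝ, 0 < M ∧ ∀ I : Finset ι,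
      Var[fun ω => ∑ i ∈ I, (y i (ξ i ω) - clamp M (y i (ξ i ω))); P] ≤ I.card * η := by
  have hL0 : 0 ≤ L := (integral_nonneg fun ω => by positivity).trans (hL 0)
  -- The first entry is Davydov's bound, summable over `k`. The second comes from the variances and
  -- tends to 0 as the level grows. Dominated convergence makes the sum of the minima tend to 0.
  set c : ℝ → ι → ℝ := fun M k => min ((4 + 5 * L) * t k ^ (δ / (2 + δ))) (L * M ^ (-δ)) with hc
  have hτ0 : ∀ k, 0 ≤ t k ^ (δ / (2 + δ)) := fun k => Real.rpow_nonneg (ht0 k).le _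
  have hc0 : ∀ M, 0 < M → ∀ k, 0 ≤ c M k := fun M hM k =>
    le_min (mul_nonneg (by positivity) (hτ0 k)) (by positivity)
  have hlim : Tendsto (fun M => ∑' k, c M k) atTop (𝓝 (∑' _ : ι, (0 : ℝ))) := by
    refine tendsto_tsum_of_dominated_convergence (hsum.mul_left (4 + 5 * L)) (fun k => ?_) ?_
    · have h1 : Tendsto (fun M : ℝ => L * M ^ (-δ)) atTop (𝓝 0) := by
        simpa using (tendsto_rpow_neg_atTop hδ).const_mul L
      refine tendsto_of_tendsto_of_tendsto_of_le_of_le' tendsto_const_nhds h1 ?_ ?_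
      · filter_upwards [eventually_gt_atTop 0] with M hM using hc0 M hM k
      · exact Eventually.of_forall fun M => min_le_right _ _
    · filter_upwards [eventually_gt_atTop 0] with M hM k
      rw [Real.norm_of_nonneg (hc0 M hM k)]
      exact min_le_left _ _
  rw [tsum_zero] at hlim
  obtain ⟨M, hMη, hM1⟩ := ((hlim.eventually_lt_const hη).and (eventually_ge_atTop 1)).exists
  have hM : 0 < M := by linarith
  refine ⟨M, hM, fun I => ?_⟩
  set z : ι → E → ℝ := fun i x => y i x - clamp M (y i x) with hz
  have mz : ∀ i, Measurable (z i) := fun i => (hy i).sub ((measurable_clamp M).comp (hy i))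
  have zle : ∀ i ω, |z i (ξ i ω)| ^ (2 + δ) ≤ |y i (ξ i ω)| ^ (2 + δ) := fun i ω =>
    Real.rpow_le_rpow (abs_nonneg _) (abs_sub_clamp_le hM.le _) (by linarith)
  have iz : ∀ i, Integrable (fun ω => |z i (ξ i ω)| ^ (2 + δ)) P := fun i => by
    refine (iy i).mono' ?_ (ae_of_all _ fun ω => ?_)
    · exact (((mz i).comp (hξ i)).abs.pow_const _).aestronglyMeasurable
    · rw [Real.norm_of_nonneg (by positivity)]
      exact zle i ω
  have hLz : ∀ i, ∫ ω, |z i (ξ i ω)| ^ (2 + δ) ∂P ≤ L := fun i =>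
    (integral_mono (iz i) (iy i) (zle i)).trans (hL i)
  have pz : ∀ i, MemLp (fun ω => z i (ξ i ω)) 2 P := fun i =>
    memLp_two_of_integrable_rpow ((mz i).comp (hξ i)) (by linarith) (iz i)
  have vz : ∀ i, Var[fun ω => z i (ξ i ω); P] ≤ L * M ^ (-δ) := fun i => by
    refine (variance_le_of_sq_le ((mz i).comp (hξ i)) ((iy i).const_mul _)
      fun ω => sq_sub_clamp_le_rpow hM (p := 2 + δ) (by linarith) (y i (ξ i ω))).trans ?_
    rw [integral_const_mul, mul_comm, show 2 - (2 + δ) = -δ by ring]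
    exact mul_le_mul_of_nonneg_right (hL i) (by positivity)
  have hcs : Summable (c M) := Summable.of_nonneg_of_le (hc0 M hM) (fun k => min_le_left _ _)
    (hsum.mul_left (4 + 5 * L))
  refine variance_sum_le (A := fun i ω => z i (ξ i ω)) (fun i _ => pz i) (c := c M)
    (fun J => (hcs.sum_le_tsum J fun k _ => hc0 M hM k).trans hMη.le) fun i _ j _ => ?_
  have hv : |cov[fun ω => z i (ξ i ω), fun ω => z j (ξ j ω); P]| ≤ L * M ^ (-δ) := by
    refine (abs_covariance_le_add_variance (pz i) (pz j)).trans ?_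
    linarith [vz i, vz j]
  refine le_min ?_ hv
  -- On `B₀`, where `t = 1`, the first entry of the minimum is implied by the second, because `M ≥
  -- 1`.
  by_cases hij : i - j ∈ B₀
  · rw [htB _ hij, Real.one_rpow]
    have : M ^ (-δ) ≤ 1 := Real.rpow_le_one_of_one_le_of_nonpos hM1 (by linarith)
    nlinarith
  · exact h.abs_covariance_le hξ h0 hδ hij (ht0 _) (ht1 _) (mz i) (mz j) (iz i) (iz j) (hLz i)
      (hLz j)

end WeakDependence

end AssocPP

namespace AssocPP

/-! ### Stein's method for bounded weakly dependent fields -/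

section Stein

variable {𝓢 : Type*} [MeasurableSpace 𝓢] {P : Measure 𝓢} [IsProbabilityMeasure P]
  {ι : Type*} [AddCommGroup ι] {E : Type*} [MeasurableSpace E] {ξ : ι → 𝓢 → E} {t : ι → ℝ}
  {B₀ : Finset ι} {v : ι → E → ℝ} {b : ℝ}

lemma abs_mul_sub_mul_le {M x y x' y' : ℝ} (hx' : |x'| ≤ M) (hy : |y| ≤ M) :
    |x * y - x' * y'| ≤ M * |x - x'| + M * |y - y'| := by
  have e : x * y - x' * y' = y * (x - x') + x' * (y - y') := by ring
  rw [e]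
  refine (abs_add_le _ _).trans ?_
  rw [abs_mul, abs_mul]
  gcongr

/-- Products at displacement `k` are Lipschitz functions of two sites, so the covariance of two of
them is governed by the rate at the four differences between their sites. Each of the four shifted
sums is at most `T`, which makes the bound uniform in `k`. -/
lemma WeaklyDependent.variance_sum_mul_le (h : WeaklyDependent P ξ t B₀)
    (hξ : ∀ i, Measurable (ξ i)) (ht0 : ∀ k, 0 ≤ t k) (htB : ∀ k ∈ B₀, t k = 1) {T : ℝ}
    (hT : ∀ J : Finset ι, ∑ k ∈ J, t k ≤ T) (hv : ∀ i, Measurable (v i)) (hb0 : 0 ≤ b)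
    (hb : ∀ i x, |v i x| ≤ b) (I : Finset ι) (k : ι) :
    Var[fun ω => ∑ i ∈ I, v i (ξ i ω) * v (i - k) (ξ (i - k) ω); P] ≤
      I.card * (64 * b ^ 4 * T) := by
  classical
  have mV : ∀ i, Measurable fun ω => v i (ξ i ω) := fun i => (hv i).comp (hξ i)
  have mprod : ∀ i, Measurable fun ω => v i (ξ i ω) * v (i - k) (ξ (i - k) ω) := fun i =>
    (mV i).mul (mV (i - k))
  have bprod : ∀ i ω, |v i (ξ i ω) * v (i - k) (ξ (i - k) ω)| ≤ b ^ 2 := fun i ω => by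
    rw [abs_mul, sq]
    exact mul_le_mul (hb _ _) (hb _ _) (abs_nonneg _) hb0
  have pprod : ∀ i, MemLp (fun ω => v i (ξ i ω) * v (i - k) (ξ (i - k) ω)) 2 P := fun i =>
    MemLp.of_bound (mprod i).aestronglyMeasurable (b ^ 2) (ae_of_all _ (bprod i))
  have vprod : ∀ i, Var[fun ω => v i (ξ i ω) * v (i - k) (ξ (i - k) ω); P] ≤ b ^ 4 := fun i => by
    have := variance_le_of_sq_le (P := P) (mprod i) (integrable_const (b ^ 4)) fun ω => by
      have := pow_le_pow_left₀ (abs_nonneg _) (bprod i ω) 2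
      rw [sq_abs] at this
      calc _ ≤ (b ^ 2) ^ 2 := this
        _ = b ^ 4 := by ring
    simpa using this
  refine variance_sum_le (A := fun i ω => v i (ξ i ω) * v (i - k) (ξ (i - k) ω))
    (fun i _ => pprod i)
    (c := fun h => 16 * b ^ 4 * (t h + t (h + k) + (t (h - k) + t h))) (fun J => ?_)
    fun i _ j _ => ?_
  · have h1 : ∑ h ∈ J, t (h + k) ≤ T := by
      have := hT (J.image fun h => h + k)
      rwa [Finset.sum_image fun x _ y _ h => add_left_injective k h] at this
    have h2 : ∑ h ∈ J, t (h - k) ≤ T := by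
      have := hT (J.image fun h => h - k)
      rwa [Finset.sum_image fun x _ y _ h => sub_left_injective h] at this
    rw [← Finset.mul_sum, Finset.sum_add_distrib, Finset.sum_add_distrib, Finset.sum_add_distrib]
    have := hT J
    have hb4 : 0 ≤ 16 * b ^ 4 := by positivity
    calc _ ≤ 16 * b ^ 4 * (T + T + (T + T)) := by gcongr
      _ = _ := by ring
  · have e1 : i - (j - k) = i - j + k := by abel
    have e2 : i - k - j = i - j - k := by abel
    have e3 : i - k - (j - k) = i - j := by abel
    have n1 := ht0 (i - j)
    have n2 := ht0 (i - j + k)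
    have n3 := ht0 (i - j - k)
    have hb4 : 0 ≤ b ^ 4 := by positivity
    by_cases hfar : ∀ x ∈ ({i, i - k} : Finset ι), ∀ y ∈ ({j, j - k} : Finset ι), x - y ∉ B₀
    -- The constant `2 * b` instead of `b` covers the case `x = y`, where the product is a square.
    · have lip : ∀ (x y : ι) (z w : ι → ℝ), (∀ i, |z i| ≤ b) → (∀ i, |w i| ≤ b) →
          |z x * z y - w x * w y| ≤ ∑ i ∈ ({x, y} : Finset ι), (2 * b) * |z i - w i| := by
        intro x y z w hz hw
        refine (abs_mul_sub_mul_le (hw x) (hz y)).trans ?_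
        by_cases hxy : x = y
        · subst hxy
          simp only [Finset.pair_eq_singleton, Finset.sum_singleton]
          linarith
        · rw [Finset.sum_pair hxy]
          have := mul_nonneg hb0 (abs_nonneg (z x - w x))
          have := mul_nonneg hb0 (abs_nonneg (z y - w y))
          linarith
      have key := h v hv b hb0 hb {i, i - k} {j, j - k} hfar (fun w => w i * w (i - k))
        (fun w => w j * w (j - k)) ((measurable_pi_apply i).mul (measurable_pi_apply (i - k)))
        ((measurable_pi_apply j).mul (measurable_pi_apply (j - k))) (fun _ => 2 * b)
        (fun _ => 2 * b) (fun _ => by positivity) (fun _ => by positivity)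
        (lip i (i - k)) (lip j (j - k))
      have pair_le : ∀ (f : ι → ℝ) (x y : ι), (∀ z, 0 ≤ f z) →
          ∑ z ∈ ({x, y} : Finset ι), f z ≤ f x + f y := by
        intro f x y hf
        by_cases hxy : x = y
        · subst hxy
          simp [hf x]
        · rw [Finset.sum_pair hxy]
      refine key.trans ?_
      have hsum : ∑ x ∈ ({i, i - k} : Finset ι), ∑ y ∈ ({j, j - k} : Finset ι),
          2 * b * (2 * b) * t (x - y) ≤
          2 * b * (2 * b) * (t (i - j) + t (i - j + k) + (t (i - j - k) + t (i - j))) := by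
        simp_rw [← Finset.mul_sum]
        refine mul_le_mul_of_nonneg_left ?_ (by positivity)
        refine (pair_le _ i (i - k) fun z => Finset.sum_nonneg fun y _ => ht0 _).trans ?_
        have q1 := pair_le (fun y => t (i - y)) j (j - k) fun z => ht0 _
        have q2 := pair_le (fun y => t (i - k - y)) j (j - k) fun z => ht0 _
        rw [e1] at q1
        rw [e2, e3] at q2
        linarith
      calc _ ≤ (2 * b) ^ 2 *
            (2 * b * (2 * b) * (t (i - j) + t (i - j + k) + (t (i - j - k) + t (i - j)))) :=
            mul_le_mul_of_nonneg_left hsum (sq_nonneg _)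
        _ = _ := by ring
    -- If two of the sites are close, one of the four rates is 1, and the trivial bound `b ^ 4` is
    -- enough.
    · push Not at hfar
      obtain ⟨x, hx, y, hy, hxy⟩ := hfar
      have h1 := htB _ hxy
      have hone : 1 ≤ t (i - j) + t (i - j + k) + (t (i - j - k) + t (i - j)) := by
        simp only [Finset.mem_insert, Finset.mem_singleton] at hx hy
        rcases hx with rfl | rfl <;> rcases hy with rfl | rfl
        · linarith
        · rw [e1] at h1; linarith
        · rw [e2] at h1; linarith
        · rw [e3] at h1; linarith
      refine (abs_covariance_le_add_variance (pprod i) (pprod j)).trans ?_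
      have := vprod i
      have := vprod j
      nlinarith

/-- The expected product of one site with a Lipschitz function of the sum over remote sites. -/
lemma WeaklyDependent.abs_integral_mul_far_le [DecidableEq ι] (h : WeaklyDependent P ξ t B₀)
    (hξ : ∀ i, Measurable (ξ i)) {B : Finset ι} (hB : B₀ ⊆ B) {ε : ℝ}
    (hε : ∀ J : Finset ι, Disjoint J B → ∑ k ∈ J, t k ≤ ε) (hv : ∀ i, Measurable (v i))
    (hb0 : 0 ≤ b) (hb : ∀ i x, |v i x| ≤ b) {i : ι} (hc : ∫ ω, v i (ξ i ω) ∂P = 0) (I : Finset ι)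
    {f : ℝ → ℝ} (hf : ∀ x y, |f x - f y| ≤ |x - y|) (hf1 : ∀ x, |f x| ≤ 1) (s : ℝ) :
    |∫ ω, v i (ξ i ω) * f (s * ∑ j ∈ I with i - j ∉ B, v j (ξ j ω)) ∂P| ≤
      (2 * b) ^ 2 * (|s| * ε) := by
  have mV : ∀ i, Measurable fun ω => v i (ξ i ω) := fun i => (hv i).comp (hξ i)
  have mf : Measurable f :=
    (LipschitzWith.of_dist_le_mul (K := 1) fun x y => by
      simpa [Real.dist_eq] using hf x y).continuous.measurable
  have mG : Measurable fun ω => f (s * ∑ j ∈ I with i - j ∉ B, v j (ξ j ω)) :=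
    mf.comp ((Finset.measurable_sum _ fun j _ => mV j).const_mul s)
  have key := h v hv b hb0 hb {i} (I.filter fun j => i - j ∉ B)
    (fun x hx y hy => by
      rw [Finset.mem_singleton] at hx
      subst hx
      exact fun hmem => (Finset.mem_filter.1 hy).2 (hB hmem))
    (fun w => w i) (fun w => f (s * ∑ j ∈ I with i - j ∉ B, w j)) (measurable_pi_apply i)
    (mf.comp ((Finset.measurable_sum _ fun j _ => measurable_pi_apply j).const_mul s))
    (fun _ => 1) (fun _ => |s|) (fun _ => zero_le_one) (fun _ => abs_nonneg _)
    (fun v w _ _ => by simp)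
    (fun z w _ _ => by
      refine (hf _ _).trans ?_
      rw [← mul_sub, abs_mul, ← Finset.sum_sub_distrib, ← Finset.mul_sum]
      exact mul_le_mul_of_nonneg_left (Finset.abs_sum_le_sum_abs _ _) (abs_nonneg _))
  rw [covariance_eq_sub
    (MemLp.of_bound (mV i).aestronglyMeasurable b (ae_of_all _ fun ω => hb _ _))
    (MemLp.of_bound mG.aestronglyMeasurable 1 (ae_of_all _ fun ω => hf1 _)), hc, zero_mul,
    sub_zero] at key
  refine key.trans (mul_le_mul_of_nonneg_left ?_ (sq_nonneg _))
  simp only [Finset.sum_singleton, one_mul, ← Finset.mul_sum]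
  refine mul_le_mul_of_nonneg_left ?_ (abs_nonneg _)
  have := hε ((I.filter fun j => i - j ∉ B).image fun j => i - j) (by
    rw [Finset.disjoint_left]
    rintro _ hk
    obtain ⟨j, hj, rfl⟩ := Finset.mem_image.1 hk
    exact (Finset.mem_filter.1 hj).2)
  rwa [Finset.sum_image fun x _ y _ h => sub_right_injective h] at this

/-- The variance is the sum of all covariances, and the pairs with `i - j ∉ B` contribute at most
`(2 * b) ^ 2 * ε` per row. -/
lemma WeaklyDependent.abs_sum_near_sub_variance_le [DecidableEq ι] (h : WeaklyDependent P ξ t B₀)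
    (hξ : ∀ i, Measurable (ξ i)) {B : Finset ι} (hB : B₀ ⊆ B) {ε : ℝ}
    (hε : ∀ J : Finset ι, Disjoint J B → ∑ k ∈ J, t k ≤ ε) (hv : ∀ i, Measurable (v i))
    (hb0 : 0 ≤ b) (hb : ∀ i x, |v i x| ≤ b) (hc : ∀ i, ∫ ω, v i (ξ i ω) ∂P = 0) (I : Finset ι) :
    |(∑ i ∈ I, ∑ j ∈ I with i - j ∈ B, ∫ ω, v i (ξ i ω) * v j (ξ j ω) ∂P) -
      Var[fun ω => ∑ i ∈ I, v i (ξ i ω); P]| ≤ I.card * ((2 * b) ^ 2 * ε) := by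
  have mV : ∀ i, Measurable fun ω => v i (ξ i ω) := fun i => (hv i).comp (hξ i)
  have pV : ∀ i, MemLp (fun ω => v i (ξ i ω)) 2 P := fun i =>
    MemLp.of_bound (mV i).aestronglyMeasurable b (ae_of_all _ fun ω => hb _ _)
  have ecov : ∀ i j, cov[fun ω => v i (ξ i ω), fun ω => v j (ξ j ω); P] =
      ∫ ω, v i (ξ i ω) * v j (ξ j ω) ∂P := fun i j => by
    rw [covariance_eq_sub (pV i) (pV j), hc, zero_mul, sub_zero]
    rfl
  rw [variance_fun_sum' fun i _ => pV i, ← Finset.sum_sub_distrib, ← nsmul_eq_mul]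
  refine (Finset.abs_sum_le_sum_abs _ _).trans (Finset.sum_le_card_nsmul _ _ _ fun i _ => ?_)
  rw [← Finset.sum_filter_add_sum_filter_not I (fun j => i - j ∈ B)
    fun j => cov[fun ω => v i (ξ i ω), fun ω => v j (ξ j ω); P]]
  simp_rw [ecov]
  rw [sub_add_cancel_left, abs_neg]
  refine (Finset.abs_sum_le_sum_abs _ _).trans ?_
  calc ∑ j ∈ I with i - j ∉ B, |∫ ω, v i (ξ i ω) * v j (ξ j ω) ∂P|
      ≤ ∑ j ∈ I with i - j ∉ B, (2 * b) ^ 2 * t (i - j) := by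
        refine Finset.sum_le_sum fun j hj => ?_
        have hij : i - j ∉ B₀ := fun hmem => (Finset.mem_filter.1 hj).2 (hB hmem)
        have := h v hv b hb0 hb {i} {j} (by simpa using hij) (fun w => w i) (fun w => w j)
          (measurable_pi_apply i) (measurable_pi_apply j) (fun _ => 1) (fun _ => 1)
          (fun _ => zero_le_one) (fun _ => zero_le_one) (fun v w _ _ => by simp)
          (fun v w _ _ => by simp)
        simpa [ecov] using this
    _ = (2 * b) ^ 2 * ∑ j ∈ I with i - j ∉ B, t (i - j) := (Finset.mul_sum _ _ _).symm
    _ ≤ _ := by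
        refine mul_le_mul_of_nonneg_left ?_ (sq_nonneg _)
        have := hε ((I.filter fun j => i - j ∉ B).image fun j => i - j) (by
          rw [Finset.disjoint_left]
          rintro _ hk
          obtain ⟨j, hj, rfl⟩ := Finset.mem_image.1 hk
          exact (Finset.mem_filter.1 hj).2)
        rwa [Finset.sum_image fun x _ y _ h => sub_right_injective h] at this

/-- Grouping by the displacement `k = i - j` turns the near quadratic form into `B.card` sums, each
over products at one displacement. -/
lemma sum_near_eq_sum_shift [DecidableEq ι] (I B : Finset ι) (f : ι → ι → ℝ) :
    ∑ i ∈ I, ∑ j ∈ I with i - j ∈ B, f i j =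
      ∑ k ∈ B, ∑ i ∈ I with i - k ∈ I, f i (i - k) := by
  have e : ∀ k, ∑ i ∈ I with i - k ∈ I, f i (i - k) =
      ∑ i ∈ I, if i - k ∈ I then f i (i - k) else 0 := fun k => Finset.sum_filter _ _
  simp_rw [e]
  rw [Finset.sum_comm]
  refine Finset.sum_congr rfl fun i _ => ?_
  rw [← Finset.sum_filter]
  refine Finset.sum_nbij' (fun j => i - j) (fun k => i - k) ?_ ?_ ?_ ?_ ?_
  · intro j hj
    rw [Finset.mem_filter] at hj ⊢
    exact ⟨hj.2, by simpa using hj.1⟩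
  · intro k hk
    rw [Finset.mem_filter] at hk ⊢
    exact ⟨hk.2, by simpa using hk.1⟩
  · intro j _
    simp
  · intro k _
    simp
  · intro j _
    simp

/-- For `|x| ≤ 1` the Taylor remainder is at most `x ^ 2`; for larger `|x|` the crude bound `2 +
|x|` suffices. -/
lemma norm_one_sub_cexp_sub_le (x : ℝ) :
    ‖1 - Complex.exp (-((x : ℂ) * Complex.I)) - (x : ℂ) * Complex.I‖ ≤ 3 * x ^ 2 := by
  have e : 1 - Complex.exp (-((x : ℂ) * Complex.I)) - (x : ℂ) * Complex.I =
      -(Complex.exp (-((x : ℂ) * Complex.I)) - 1 - (-((x : ℂ) * Complex.I))) := by ring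
  have hn : ‖-((x : ℂ) * Complex.I)‖ = |x| := by simp
  rw [e, norm_neg]
  rcases le_or_gt |x| 1 with hx | hx
  · refine (Complex.norm_exp_sub_one_sub_id_le (by rwa [hn])).trans ?_
    rw [hn, sq_abs]
    nlinarith [sq_nonneg x]
  · have h1 : ‖Complex.exp (-((x : ℂ) * Complex.I))‖ = 1 := by
      rw [← neg_mul, ← Complex.ofReal_neg, Complex.norm_exp_ofReal_mul_I]
    refine (norm_sub_le _ _).trans ?_
    have h2 := norm_sub_le (Complex.exp (-((x : ℂ) * Complex.I))) 1
    rw [h1, norm_one] at h2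
    rw [hn]
    have : |x| ^ 2 = x ^ 2 := sq_abs x
    nlinarith

/-- If `W` nearly satisfies Stein's characterization of the standard Gaussian law then its
characteristic function is nearly Gaussian. -/
lemma norm_charFun_sub_le_of_stein {W : 𝓢 → ℝ} (hW : Measurable W) {K : ℝ} (hK : ∀ ω, |W ω| ≤ K)
    {z r : ℝ} (h : ∀ s : ℝ, |s| ≤ |z| →
      ‖∫ ω, (W ω : ℂ) * Complex.exp (((s * W ω : ℝ) : ℂ) * Complex.I) ∂P -
        (s : ℂ) * Complex.I * ∫ ω, Complex.exp (((s * W ω : ℝ) : ℂ) * Complex.I) ∂P‖ ≤ r) :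
    ‖∫ ω, Complex.exp (((z * W ω : ℝ) : ℂ) * Complex.I) ∂P - Complex.exp (-((z : ℂ) ^ 2) / 2)‖ ≤
      |z| * r := by
  set φ : ℝ → ℂ := fun s => ∫ ω, Complex.exp (((s * W ω : ℝ) : ℂ) * Complex.I) ∂P with hφ
  set Ψ : ℝ → ℂ := fun s =>
    ∫ ω, (W ω : ℂ) * Complex.exp (((s * W ω : ℝ) : ℂ) * Complex.I) ∂P with hΨ
  have mexp : ∀ s : ℝ, Measurable fun ω => Complex.exp (((s * W ω : ℝ) : ℂ) * Complex.I) :=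
    fun s => by fun_prop
  have hderiv : ∀ s : ℝ, HasDerivAt φ (Complex.I * Ψ s) s := by
    intro s
    have := (hasDerivAt_integral_of_dominated_loc_of_deriv_le (μ := P) (s := Set.univ)
      (F := fun s ω => Complex.exp (((s * W ω : ℝ) : ℂ) * Complex.I))
      (F' := fun s ω => Complex.I * ((W ω : ℂ) * Complex.exp (((s * W ω : ℝ) : ℂ) * Complex.I)))
      (x₀ := s) (bound := fun _ => K) Filter.univ_mem
      (Eventually.of_forall fun s => (mexp s).aestronglyMeasurable)
      (Integrable.of_bound (mexp s).aestronglyMeasurable 1 (ae_of_all _ fun ω => by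
        rw [Complex.norm_exp_ofReal_mul_I]))
      (by
        refine Measurable.aestronglyMeasurable ?_
        fun_prop)
      (ae_of_all _ fun ω s _ => by
        rw [norm_mul, norm_mul, Complex.norm_exp_ofReal_mul_I, Complex.norm_I, one_mul, mul_one,
          Complex.norm_real]
        exact hK ω)
      (integrable_const K)
      (ae_of_all _ fun ω s _ => by
        have h1 : HasDerivAt (fun s : ℝ => ((s * W ω : ℝ) : ℂ) * Complex.I)
            ((W ω : ℂ) * Complex.I) s := by
          have h2 : HasDerivAt (fun s : ℝ => s * W ω) (W ω) s := by
            simpa using (hasDerivAt_id s).mul_const (W ω)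
          exact (h2.ofReal_comp).mul_const Complex.I
        convert! h1.cexp using 1
        ring)).2
    rwa [integral_const_mul] at this
  -- Since `φ' = i Ψ`, the integrating factor `exp (s ^ 2 / 2)` gives a function whose derivative is
  -- proportional to the Stein error `Ψ - i s φ`. The mean value inequality from 0 to `z` then
  -- yields `|z| * r`, the exponentials cancelling.
  set g : ℝ → ℂ := fun s => Complex.exp ((s : ℂ) ^ 2 / 2) * φ s with hg
  have hgderiv : ∀ s : ℝ, HasDerivAt g (Complex.I * Complex.exp ((s : ℂ) ^ 2 / 2) *
      (Ψ s - (s : ℂ) * Complex.I * φ s)) s := by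
    intro s
    have h1 : HasDerivAt (fun s : ℝ => (s : ℂ) ^ 2 / 2) (s : ℂ) s := by
      have h2 : HasDerivAt (fun s : ℝ => s ^ 2 / 2) s s := by
        have := ((hasDerivAt_id s).pow 2).div_const 2
        simpa using this
      convert! h2.ofReal_comp using 1
      funext x
      push_cast
      rfl
    convert! h1.cexp.mul (hderiv s) using 1
    linear_combination (-Complex.exp ((s : ℂ) ^ 2 / 2) * (s : ℂ) * φ s) * Complex.I_sq
  have hr : 0 ≤ r := (norm_nonneg _).trans (h z le_rfl)
  have hbound : ∀ s ∈ Set.uIcc 0 z, ‖Complex.I * Complex.exp ((s : ℂ) ^ 2 / 2) *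
      (Ψ s - (s : ℂ) * Complex.I * φ s)‖ ≤ Real.exp (z ^ 2 / 2) * r := by
    intro s hs
    have hsz : |s| ≤ |z| := by
      rcases Set.mem_uIcc.1 hs with ⟨h1, h2⟩ | ⟨h1, h2⟩
      · rw [abs_of_nonneg h1, abs_of_nonneg (h1.trans h2)]
        exact h2
      · rw [abs_of_nonpos h2, abs_of_nonpos (h1.trans h2)]
        linarith
    have hn : ‖Complex.exp ((s : ℂ) ^ 2 / 2)‖ = Real.exp (s ^ 2 / 2) := by
      rw [← Complex.ofReal_pow, show ((s ^ 2 : ℝ) : ℂ) / 2 = ((s ^ 2 / 2 : ℝ) : ℂ) by push_cast; rfl,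
        ← Complex.ofReal_exp, Complex.norm_real, Real.norm_of_nonneg (Real.exp_pos _).le]
    rw [norm_mul, norm_mul, Complex.norm_I, one_mul, hn]
    refine mul_le_mul (Real.exp_le_exp.2 ?_) (h s hsz) (norm_nonneg _) (Real.exp_pos _).le
    have := sq_le_sq.2 hsz
    linarith
  have hmv := (convex_uIcc 0 z).norm_image_sub_le_of_norm_hasDerivWithin_le
    (fun s _ => (hgderiv s).hasDerivWithinAt) hbound Set.left_mem_uIcc Set.right_mem_uIcc
  have hg0 : g 0 = 1 := by simp [hg, hφ]
  rw [hg0, sub_zero, Real.norm_eq_abs] at hmv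
  have hfac : φ z - Complex.exp (-((z : ℂ) ^ 2) / 2) =
      Complex.exp (-((z : ℂ) ^ 2) / 2) * (g z - 1) := by
    rw [hg, mul_sub, mul_one, ← mul_assoc, ← Complex.exp_add]
    rw [show -((z : ℂ) ^ 2) / 2 + (z : ℂ) ^ 2 / 2 = 0 by ring, Complex.exp_zero, one_mul]
  have hn : ‖Complex.exp (-((z : ℂ) ^ 2) / 2)‖ = Real.exp (-(z ^ 2 / 2)) := by
    rw [show -((z : ℂ) ^ 2) / 2 = ((-(z ^ 2 / 2) : ℝ) : ℂ) by push_cast; ring,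
      ← Complex.ofReal_exp, Complex.norm_real, Real.norm_of_nonneg (Real.exp_pos _).le]
  show ‖φ z - _‖ ≤ _
  rw [hfac, norm_mul, hn]
  calc _ ≤ Real.exp (-(z ^ 2 / 2)) * (Real.exp (z ^ 2 / 2) * r * |z|) :=
        mul_le_mul_of_nonneg_left hmv (Real.exp_pos _).le
    _ = (Real.exp (-(z ^ 2 / 2)) * Real.exp (z ^ 2 / 2)) * (|z| * r) := by ring
    _ = _ := by rw [← Real.exp_add]; simp

end Stein

end AssocPP

namespace AssocPP

/-! ### The central limit theorem for weakly dependent fields -/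

section CLT

variable {𝓢 : Type*} [MeasurableSpace 𝓢] {P : Measure 𝓢} [IsProbabilityMeasure P]
  {ι : Type*} [AddCommGroup ι] {E : Type*} [MeasurableSpace E] {ξ : ι → 𝓢 → E} {t : ι → ℝ}
  {B₀ : Finset ι} {v : ι → E → ℝ} {b : ℝ}

/-- Weak dependence is stated for real functions, so the exponential is handled through cosine and
sine. -/
lemma norm_integral_mul_cexp_le {V θ : 𝓢 → ℝ} (hV : Measurable V) (hθ : Measurable θ) {K : ℝ}
    (hK : ∀ ω, |V ω| ≤ K) {C : ℝ} (hcos : |∫ ω, V ω * Real.cos (θ ω) ∂P| ≤ C)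
    (hsin : |∫ ω, V ω * Real.sin (θ ω) ∂P| ≤ C) :
    ‖∫ ω, (V ω : ℂ) * Complex.exp ((θ ω : ℂ) * Complex.I) ∂P‖ ≤ 2 * C := by
  have hi : Integrable (fun ω => (V ω : ℂ) * Complex.exp ((θ ω : ℂ) * Complex.I)) P := by
    refine Integrable.of_bound (Measurable.aestronglyMeasurable (by fun_prop)) K
      (ae_of_all _ fun ω => ?_)
    rw [norm_mul, Complex.norm_exp_ofReal_mul_I, mul_one, Complex.norm_real]
    exact hK ω
  have hre : (∫ ω, (V ω : ℂ) * Complex.exp ((θ ω : ℂ) * Complex.I) ∂P).re =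
      ∫ ω, V ω * Real.cos (θ ω) ∂P := by
    have := Complex.reCLM.integral_comp_comm hi
    simpa [Complex.re_ofReal_mul, Complex.exp_ofReal_mul_I_re] using this.symm
  have him : (∫ ω, (V ω : ℂ) * Complex.exp ((θ ω : ℂ) * Complex.I) ∂P).im =
      ∫ ω, V ω * Real.sin (θ ω) ∂P := by
    have := Complex.imCLM.integral_comp_comm hi
    simpa [Complex.im_ofReal_mul, Complex.exp_ofReal_mul_I_im] using this.symm
  refine (Complex.norm_le_abs_re_add_abs_im _).trans ?_
  rw [hre, him]
  linarith

lemma abs_sin_sub_sin_le (x y : ℝ) : |Real.sin x - Real.sin y| ≤ |x - y| := by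
  simpa [Real.dist_eq] using Real.lipschitzWith_sin.dist_le_mul x y

lemma abs_cos_sub_cos_le (x y : ℝ) : |Real.cos x - Real.cos y| ≤ |x - y| := by
  simpa [Real.dist_eq] using Real.lipschitzWith_cos.dist_le_mul x y

/-- The quadratic form of nearby products is close to its mean. -/
lemma WeaklyDependent.integral_abs_near_sub_le [DecidableEq ι] (h : WeaklyDependent P ξ t B₀)
    (hξ : ∀ i, Measurable (ξ i)) (ht0 : ∀ k, 0 ≤ t k) (htB : ∀ k ∈ B₀, t k = 1) {T : ℝ}
    (hT : ∀ J : Finset ι, ∑ k ∈ J, t k ≤ T) (hv : ∀ i, Measurable (v i)) (hb0 : 0 ≤ b)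
    (hb : ∀ i x, |v i x| ≤ b) (I B : Finset ι) :
    ∫ ω, |(∑ i ∈ I, ∑ j ∈ I with i - j ∈ B, v i (ξ i ω) * v j (ξ j ω)) -
      ∑ i ∈ I, ∑ j ∈ I with i - j ∈ B, ∫ ω, v i (ξ i ω) * v j (ξ j ω) ∂P| ∂P ≤
      B.card * √(I.card * (64 * b ^ 4 * T)) := by
  have mV : ∀ i, Measurable fun ω => v i (ξ i ω) := fun i => (hv i).comp (hξ i)
  have bprod : ∀ i j ω, |v i (ξ i ω) * v j (ξ j ω)| ≤ b ^ 2 := fun i j ω => by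
    rw [abs_mul, sq]
    exact mul_le_mul (hb _ _) (hb _ _) (abs_nonneg _) hb0
  have pprod : ∀ i j, MemLp (fun ω => v i (ξ i ω) * v j (ξ j ω)) 2 P := fun i j =>
    MemLp.of_bound ((mV i).mul (mV j)).aestronglyMeasurable (b ^ 2) (ae_of_all _ (bprod i j))
  have iprod : ∀ i j, Integrable (fun ω => v i (ξ i ω) * v j (ξ j ω)) P := fun i j =>
    (pprod i j).integrable one_le_two
  set S : ι → 𝓢 → ℝ := fun k ω =>
    ∑ i ∈ I with i - k ∈ I, v i (ξ i ω) * v (i - k) (ξ (i - k) ω) with hS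
  have pS : ∀ k, MemLp (S k) 2 P := fun k => memLp_finsetSum _ fun i _ => pprod i (i - k)
  have iS : ∀ k, Integrable (S k) P := fun k => (pS k).integrable one_le_two
  have e1 : ∀ ω, (∑ i ∈ I, ∑ j ∈ I with i - j ∈ B, v i (ξ i ω) * v j (ξ j ω)) = ∑ k ∈ B, S k ω :=
    fun ω => sum_near_eq_sum_shift I B fun i j => v i (ξ i ω) * v j (ξ j ω)
  have e2 : (∑ i ∈ I, ∑ j ∈ I with i - j ∈ B, ∫ ω, v i (ξ i ω) * v j (ξ j ω) ∂P) =
      ∑ k ∈ B, ∫ ω, S k ω ∂P := by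
    rw [sum_near_eq_sum_shift I B fun i j => ∫ ω, v i (ξ i ω) * v j (ξ j ω) ∂P]
    refine Finset.sum_congr rfl fun k _ => ?_
    rw [hS, integral_finsetSum _ fun i _ => iprod i (i - k)]
  simp_rw [e1]
  rw [e2]
  have hT0 : 0 ≤ T := by simpa using hT ∅
  have iD : ∀ k, Integrable (fun ω => |S k ω - ∫ ω', S k ω' ∂P|) P := fun k =>
    ((iS k).sub (integrable_const _)).abs
  calc ∫ ω, |∑ k ∈ B, S k ω - ∑ k ∈ B, ∫ ω', S k ω' ∂P| ∂P
      ≤ ∫ ω, ∑ k ∈ B, |S k ω - ∫ ω', S k ω' ∂P| ∂P := by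
        refine integral_mono_of_nonneg (ae_of_all _ fun ω => abs_nonneg _)
          (integrable_finsetSum _ fun k _ => iD k) (ae_of_all _ fun ω => ?_)
        show |∑ k ∈ B, S k ω - ∑ k ∈ B, ∫ ω', S k ω' ∂P| ≤ _
        rw [← Finset.sum_sub_distrib]
        exact Finset.abs_sum_le_sum_abs _ _
    _ = ∑ k ∈ B, ∫ ω, |S k ω - ∫ ω', S k ω' ∂P| ∂P := integral_finsetSum _ fun k _ => iD k
    -- For each displacement the sum runs over a subset of `I`, to which the variance bound applies.
    _ ≤ ∑ k ∈ B, √(I.card * (64 * b ^ 4 * T)) := by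
        refine Finset.sum_le_sum fun k _ => (integral_abs_sub_le_sqrt_variance (pS k)).trans ?_
        refine Real.sqrt_le_sqrt ((h.variance_sum_mul_le hξ ht0 htB hT hv hb0 hb _ k).trans ?_)
        refine mul_le_mul_of_nonneg_right ?_ (by positivity)
        exact_mod_cast Finset.card_filter_le _ _
    _ = _ := by simp

/-- A normalized sum over a bounded weakly dependent field nearly satisfies Stein's equation. -/
theorem WeaklyDependent.norm_stein_le [DecidableEq ι] (h : WeaklyDependent P ξ t B₀)
    (hξ : ∀ i, Measurable (ξ i)) (ht0 : ∀ k, 0 ≤ t k) (htB : ∀ k ∈ B₀, t k = 1) {T : ℝ}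
    (hT : ∀ J : Finset ι, ∑ k ∈ J, t k ≤ T) {B : Finset ι} (hB : B₀ ⊆ B) {ε : ℝ}
    (hε : ∀ J : Finset ι, Disjoint J B → ∑ k ∈ J, t k ≤ ε) (hv : ∀ i, Measurable (v i))
    (hb0 : 0 ≤ b) (hb : ∀ i x, |v i x| ≤ b) (hc : ∀ i, ∫ ω, v i (ξ i ω) ∂P = 0) (I : Finset ι)
    {r : ℝ} (hr : 0 ≤ r) (s : ℝ) {W : 𝓢 → ℝ} (hW : ∀ ω, W ω = r * ∑ i ∈ I, v i (ξ i ω)) :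
    ‖∫ ω, (W ω : ℂ) * Complex.exp (((s * W ω : ℝ) : ℂ) * Complex.I) ∂P -
        (s : ℂ) * Complex.I * ∫ ω, Complex.exp (((s * W ω : ℝ) : ℂ) * Complex.I) ∂P‖ ≤
      8 * b ^ 2 * |s| * ε * (r ^ 2 * I.card) + 3 * s ^ 2 * B.card ^ 2 * b ^ 3 * (r ^ 3 * I.card) +
        |s| * (B.card * (r ^ 2 * √(I.card * (64 * b ^ 4 * T))) +
          |r ^ 2 * Var[fun ω => ∑ i ∈ I, v i (ξ i ω); P] - 1| +
          4 * b ^ 2 * ε * (r ^ 2 * I.card)) := by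
  have hε0 : 0 ≤ ε := by simpa using hε ∅ (Finset.disjoint_empty_left _)
  set V : ι → 𝓢 → ℝ := fun i ω => v i (ξ i ω) with hV
  have mV : ∀ i, Measurable (V i) := fun i => (hv i).comp (hξ i)
  have bV : ∀ i ω, |V i ω| ≤ b := fun i ω => hb i _
  have mW : Measurable W := by
    rw [funext hW]
    exact (Finset.measurable_sum _ fun i _ => mV i).const_mul r
  -- For each site `i`, the phase `s * W` splits into `s * near i` and `far i`; the latter already
  -- contains the factor `s`.
  set near : ι → 𝓢 → ℝ := fun i ω => r * ∑ j ∈ I with i - j ∈ B, V j ω with hnear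
  set far : ι → 𝓢 → ℝ := fun i ω => (s * r) * ∑ j ∈ I with i - j ∉ B, V j ω with hfar
  have mnear : ∀ i, Measurable (near i) := fun i =>
    (Finset.measurable_sum _ fun j _ => mV j).const_mul r
  have mfar : ∀ i, Measurable (far i) := fun i =>
    (Finset.measurable_sum _ fun j _ => mV j).const_mul (s * r)
  have hsplit : ∀ i ω, s * W ω - s * near i ω = far i ω := by
    intro i ω
    rw [hW, hnear, hfar]
    simp only
    rw [← Finset.sum_filter_add_sum_filter_not I (fun j => i - j ∈ B) fun j => v j (ξ j ω)]
    ring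
  have bnear : ∀ i ω, |near i ω| ≤ r * (B.card * b) := by
    intro i ω
    rw [hnear]
    simp only
    rw [abs_mul, abs_of_nonneg hr]
    refine mul_le_mul_of_nonneg_left ((Finset.abs_sum_le_sum_abs _ _).trans ?_) hr
    refine (Finset.sum_le_card_nsmul _ _ b fun j _ => bV j ω).trans ?_
    rw [nsmul_eq_mul]
    refine mul_le_mul_of_nonneg_right ?_ hb0
    have : (I.filter fun j => i - j ∈ B).card ≤ B.card :=
      Finset.card_le_card_of_injOn (fun j => i - j) (fun j hj => (Finset.mem_filter.1 hj).2)
        fun x _ y _ hxy => sub_right_injective hxy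
    exact_mod_cast this
  set Q : 𝓢 → ℝ := fun ω => r ^ 2 * ∑ i ∈ I, ∑ j ∈ I with i - j ∈ B, V i ω * V j ω with hQ
  have mQ : Measurable Q := (Finset.measurable_sum _ fun i _ => Finset.measurable_sum _ fun j _ =>
    (mV i).mul (mV j)).const_mul _
  have eQ : ∀ ω, Q ω = ∑ i ∈ I, r * V i ω * near i ω := by
    intro ω
    rw [hQ, hnear]
    simp only [Finset.mul_sum]
    exact Finset.sum_congr rfl fun i _ => Finset.sum_congr rfl fun j _ => by ring
  set e : 𝓢 → ℂ := fun ω => Complex.exp (((s * W ω : ℝ) : ℂ) * Complex.I) with he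
  have ne : ∀ ω, ‖e ω‖ = 1 := fun ω => Complex.norm_exp_ofReal_mul_I _
  have me : Measurable e := by fun_prop
  -- `A` is `W * exp (i s W)` with the near sites removed from the phase accompanying each summand.
  -- Its mean is small, because each centred `V i` is almost uncorrelated with the far phase.
  set A : 𝓢 → ℂ := fun ω =>
    ∑ i ∈ I, ((r : ℂ) * ((V i ω : ℂ) * Complex.exp ((far i ω : ℂ) * Complex.I))) with hA
  have iA' : ∀ i, Integrable
      (fun ω => (V i ω : ℂ) * Complex.exp ((far i ω : ℂ) * Complex.I)) P := fun i => by
    have := mV i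
    have := mfar i
    refine Integrable.of_bound (Measurable.aestronglyMeasurable (by fun_prop)) b
      (ae_of_all _ fun ω => ?_)
    rw [norm_mul, Complex.norm_exp_ofReal_mul_I, mul_one, Complex.norm_real]
    exact bV i ω
  have iA : Integrable A P := integrable_finsetSum _ fun i _ => (iA' i).const_mul _
  have bA : ‖∫ ω, A ω ∂P‖ ≤ 8 * b ^ 2 * |s| * ε * (r ^ 2 * I.card) := by
    rw [hA, integral_finsetSum _ fun i _ => (iA' i).const_mul _]
    refine (norm_sum_le _ _).trans ?_
    have : ∀ i ∈ I, ‖∫ ω, (r : ℂ) * ((V i ω : ℂ) * Complex.exp ((far i ω : ℂ) * Complex.I)) ∂P‖ ≤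
        r * (2 * ((2 * b) ^ 2 * (|s * r| * ε))) := by
      intro i _
      rw [integral_const_mul, norm_mul, Complex.norm_real, Real.norm_of_nonneg hr]
      refine mul_le_mul_of_nonneg_left ?_ hr
      exact norm_integral_mul_cexp_le (mV i) (mfar i) (bV i)
        (h.abs_integral_mul_far_le hξ hB hε hv hb0 hb (hc i) I abs_cos_sub_cos_le
          Real.abs_cos_le_one (s * r))
        (h.abs_integral_mul_far_le hξ hB hε hv hb0 hb (hc i) I abs_sin_sub_sin_le
          Real.abs_sin_le_one (s * r))
    refine (Finset.sum_le_card_nsmul _ _ _ this).trans_eq ?_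
    rw [nsmul_eq_mul, abs_mul, abs_of_nonneg hr]
    ring
  have bW : ∀ ω, |W ω| ≤ r * (I.card * b) := by
    intro ω
    rw [hW, abs_mul, abs_of_nonneg hr]
    refine mul_le_mul_of_nonneg_left ((Finset.abs_sum_le_sum_abs _ _).trans ?_) hr
    refine (Finset.sum_le_card_nsmul _ _ b fun j _ => bV j ω).trans_eq (nsmul_eq_mul _ _)
  have iWe : Integrable (fun ω => (W ω : ℂ) * e ω) P := by
    refine Integrable.of_bound (Measurable.aestronglyMeasurable (by fun_prop)) (r * (I.card * b))
      (ae_of_all _ fun ω => ?_)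
    rw [norm_mul, ne, mul_one, Complex.norm_real]
    exact bW ω
  have ie : Integrable e P :=
    Integrable.of_bound me.aestronglyMeasurable 1 (ae_of_all _ fun ω => (ne ω).le)
  have ise : Integrable (fun ω => (s : ℂ) * Complex.I * e ω) P := ie.const_mul _
  have ptw : ∀ ω, ‖(W ω : ℂ) * e ω - (s : ℂ) * Complex.I * e ω - A ω‖ ≤
      |s| * |Q ω - 1| + 3 * s ^ 2 * B.card ^ 2 * b ^ 3 * (r ^ 3 * I.card) := by
    intro ω
    have hθ : ∀ i, Complex.exp ((far i ω : ℂ) * Complex.I) =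
        e ω * Complex.exp (-(((s * near i ω : ℝ) : ℂ) * Complex.I)) := by
      intro i
      rw [he, ← Complex.exp_add, ← hsplit i ω]
      congr 1
      push_cast
      ring
    -- Expanding `1 - exp (-i s near)` to first order, the linear terms sum to `i s Q`. The rest is
    -- a Taylor remainder of order `r ^ 3 * I.card`.
    have key : (W ω : ℂ) * e ω - (s : ℂ) * Complex.I * e ω - A ω =
        (s : ℂ) * Complex.I * ((Q ω - 1 : ℝ) : ℂ) * e ω + ∑ i ∈ I, ((r * V i ω : ℝ) : ℂ) * e ω *
          (1 - Complex.exp (-(((s * near i ω : ℝ) : ℂ) * Complex.I)) -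
            ((s * near i ω : ℝ) : ℂ) * Complex.I) := by
      rw [eQ ω, hW ω, hA]
      simp only [hθ]
      push_cast
      simp only [Finset.mul_sum, Finset.sum_mul, mul_sub, sub_mul, Finset.sum_sub_distrib]
      have e3 : ∑ i ∈ I, (s : ℂ) * Complex.I * ((r : ℂ) * (V i ω : ℂ) * (near i ω : ℂ)) * e ω =
          ∑ i ∈ I, (r : ℂ) * (V i ω : ℂ) * e ω * ((s : ℂ) * (near i ω : ℂ) * Complex.I) :=
        Finset.sum_congr rfl fun i _ => by ring
      have e4 : ∑ i ∈ I, (r : ℂ) * ((V i ω : ℂ) * (e ω *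
            Complex.exp (-((s : ℂ) * (near i ω : ℂ) * Complex.I)))) =
          ∑ i ∈ I, (r : ℂ) * (V i ω : ℂ) * e ω *
            Complex.exp (-((s : ℂ) * (near i ω : ℂ) * Complex.I)) :=
        Finset.sum_congr rfl fun i _ => by ring
      rw [e3, e4]
      simp only [mul_one, hV]
      ring
    rw [key]
    refine (norm_add_le _ _).trans (add_le_add ?_ ?_)
    · rw [norm_mul, norm_mul, norm_mul, ne, Complex.norm_I, mul_one, mul_one, Complex.norm_real,
        Complex.norm_real]
      rfl
    · refine (norm_sum_le _ _).trans ?_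
      have : ∀ i ∈ I, ‖((r * V i ω : ℝ) : ℂ) * e ω *
          (1 - Complex.exp (-(((s * near i ω : ℝ) : ℂ) * Complex.I)) -
            ((s * near i ω : ℝ) : ℂ) * Complex.I)‖ ≤
          r * b * (3 * (s ^ 2 * (r * (B.card * b)) ^ 2)) := by
        intro i _
        rw [norm_mul, norm_mul, ne, mul_one, Complex.norm_real, Real.norm_eq_abs, abs_mul,
          abs_of_nonneg hr]
        refine mul_le_mul (mul_le_mul_of_nonneg_left (bV i ω) hr)
          ((norm_one_sub_cexp_sub_le _).trans ?_) (norm_nonneg _) (mul_nonneg hr hb0)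
        rw [mul_pow]
        refine mul_le_mul_of_nonneg_left (mul_le_mul_of_nonneg_left ?_ (sq_nonneg _)) (by norm_num)
        rw [← sq_abs]
        exact pow_le_pow_left₀ (abs_nonneg _) (bnear i ω) 2
      refine (Finset.sum_le_card_nsmul _ _ _ this).trans_eq ?_
      rw [nsmul_eq_mul]
      ring
  have iprod : ∀ i j, Integrable (fun ω => V i ω * V j ω) P := fun i j =>
    Integrable.of_bound ((mV i).mul (mV j)).aestronglyMeasurable (b * b) (ae_of_all _ fun ω => by
      rw [norm_mul]
      exact mul_le_mul (bV i ω) (bV j ω) (norm_nonneg _) hb0)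
  have iQ : Integrable Q P := (integrable_finsetSum _ fun i _ => integrable_finsetSum _ fun j _ =>
    iprod i j).const_mul _
  -- `Q` is compared first with its mean `r ^ 2 * m`, by concentration, then with the normalized
  -- variance up to the far covariances, and finally with 1.
  have bQ : ∫ ω, |Q ω - 1| ∂P ≤ B.card * (r ^ 2 * √(I.card * (64 * b ^ 4 * T))) +
      |r ^ 2 * Var[fun ω => ∑ i ∈ I, v i (ξ i ω); P] - 1| + 4 * b ^ 2 * ε * (r ^ 2 * I.card) := by
    set m := ∑ i ∈ I, ∑ j ∈ I with i - j ∈ B, ∫ ω, v i (ξ i ω) * v j (ξ j ω) ∂P with hm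
    have h1 : ∫ ω, |Q ω - r ^ 2 * m| ∂P ≤ r ^ 2 * (B.card * √(I.card * (64 * b ^ 4 * T))) := by
      refine le_trans (le_of_eq ?_) (mul_le_mul_of_nonneg_left
        (h.integral_abs_near_sub_le hξ ht0 htB hT hv hb0 hb I B) (sq_nonneg r))
      rw [← integral_const_mul]
      refine integral_congr_ae (ae_of_all _ fun ω => ?_)
      simp only [hQ]
      rw [← mul_sub, abs_mul, abs_of_nonneg (sq_nonneg r)]
    have h2 : |r ^ 2 * m - 1| ≤ |r ^ 2 * Var[fun ω => ∑ i ∈ I, v i (ξ i ω); P] - 1| +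
        4 * b ^ 2 * ε * (r ^ 2 * I.card) := by
      have h3 := h.abs_sum_near_sub_variance_le hξ hB hε hv hb0 hb hc I
      have e5 : r ^ 2 * m - 1 = (r ^ 2 * Var[fun ω => ∑ i ∈ I, v i (ξ i ω); P] - 1) +
          r ^ 2 * (m - Var[fun ω => ∑ i ∈ I, v i (ξ i ω); P]) := by ring
      rw [e5]
      refine (abs_add_le _ _).trans (add_le_add_right ?_ _)
      rw [abs_mul, abs_of_nonneg (sq_nonneg r)]
      refine (mul_le_mul_of_nonneg_left h3 (sq_nonneg r)).trans_eq ?_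
      ring
    have i1 : Integrable (fun ω => |Q ω - r ^ 2 * m|) P := (iQ.sub (integrable_const _)).abs
    calc ∫ ω, |Q ω - 1| ∂P ≤ ∫ ω, (|Q ω - r ^ 2 * m| + |r ^ 2 * m - 1|) ∂P := by
          refine integral_mono_of_nonneg (ae_of_all _ fun ω => abs_nonneg _)
            (i1.add (integrable_const _)) (ae_of_all _ fun ω => abs_sub_le _ _ _)
      _ = ∫ ω, |Q ω - r ^ 2 * m| ∂P + |r ^ 2 * m - 1| := by
          rw [integral_add i1 (integrable_const _)]
          simp
      _ ≤ _ := by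
          have : r ^ 2 * (B.card * √(I.card * (64 * b ^ 4 * T))) =
            B.card * (r ^ 2 * √(I.card * (64 * b ^ 4 * T))) := by ring
          linarith
  have split : ∫ ω, (W ω : ℂ) * e ω ∂P - (s : ℂ) * Complex.I * ∫ ω, e ω ∂P =
      ∫ ω, A ω ∂P + ∫ ω, ((W ω : ℂ) * e ω - (s : ℂ) * Complex.I * e ω - A ω) ∂P := by
    have i2 : Integrable (fun ω => (W ω : ℂ) * e ω - (s : ℂ) * Complex.I * e ω) P := iWe.sub ise
    rw [integral_sub i2 iA, integral_sub iWe ise, integral_const_mul]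
    ring
  have i3 : Integrable (fun ω => |s| * |Q ω - 1|) P :=
    (iQ.sub (integrable_const _)).abs.const_mul _
  have bR : ‖∫ ω, ((W ω : ℂ) * e ω - (s : ℂ) * Complex.I * e ω - A ω) ∂P‖ ≤
      |s| * ∫ ω, |Q ω - 1| ∂P + 3 * s ^ 2 * B.card ^ 2 * b ^ 3 * (r ^ 3 * I.card) := by
    refine (norm_integral_le_integral_norm _).trans ?_
    refine (integral_mono_of_nonneg (ae_of_all _ fun ω => norm_nonneg _)
      (i3.add (integrable_const _)) (ae_of_all _ ptw)).trans_eq ?_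
    rw [integral_add' i3 (integrable_const _), integral_const_mul]
    simp
  rw [split]
  refine (norm_add_le _ _).trans ?_
  have := mul_le_mul_of_nonneg_left bQ (abs_nonneg s)
  linarith

lemma norm_integral_cexp_sub_le {S W : 𝓢 → ℝ} (hS : Measurable S) (hW : Measurable W)
    (hSW : Integrable (fun ω => |S ω - W ω|) P) (z : ℝ) :
    ‖∫ ω, Complex.exp (((z * S ω : ℝ) : ℂ) * Complex.I) ∂P -
      ∫ ω, Complex.exp (((z * W ω : ℝ) : ℂ) * Complex.I) ∂P‖ ≤ |z| * ∫ ω, |S ω - W ω| ∂P := by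
  have i1 : ∀ U : 𝓢 → ℝ, Measurable U →
      Integrable (fun ω => Complex.exp (((z * U ω : ℝ) : ℂ) * Complex.I)) P := fun U hU =>
    Integrable.of_bound (Measurable.aestronglyMeasurable (by fun_prop)) 1
      (ae_of_all _ fun ω => (Complex.norm_exp_ofReal_mul_I _).le)
  rw [← integral_sub (i1 S hS) (i1 W hW), ← integral_const_mul]
  refine (norm_integral_le_integral_norm _).trans (integral_mono_of_nonneg
    (ae_of_all _ fun ω => norm_nonneg _) (hSW.const_mul _) (ae_of_all _ fun ω => ?_))
  show ‖_ - _‖ ≤ |z| * |S ω - W ω|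
  have e : Complex.exp (((z * S ω : ℝ) : ℂ) * Complex.I) -
      Complex.exp (((z * W ω : ℝ) : ℂ) * Complex.I) =
      Complex.exp (((z * W ω : ℝ) : ℂ) * Complex.I) *
        (Complex.exp (Complex.I * ((z * (S ω - W ω) : ℝ) : ℂ)) - 1) := by
    rw [mul_sub, mul_one, ← Complex.exp_add]
    congr 2
    push_cast
    ring
  rw [e, norm_mul, Complex.norm_exp_ofReal_mul_I, one_mul, ← abs_mul]
  exact Real.norm_exp_I_mul_ofReal_sub_one_le

end CLT

end AssocPP

namespace AssocPP

section CLT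

variable {𝓢 : Type*} [MeasurableSpace 𝓢] {P : Measure 𝓢} [IsProbabilityMeasure P]
  {ι : Type*} [AddCommGroup ι] {E : Type*} [MeasurableSpace E] {ξ : ι → 𝓢 → E} {t : ι → ℝ}
  {B₀ : Finset ι}

/-- The characteristic function of a normalized sum is close to the Gaussian one when the field is
well approximated in variance by a truncated field. -/
theorem WeaklyDependent.norm_charFun_sub_le [DecidableEq ι] (h : WeaklyDependent P ξ t B₀)
    (hξ : ∀ i, Measurable (ξ i)) (ht0 : ∀ k, 0 ≤ t k) (htB : ∀ k ∈ B₀, t k = 1) {T : ℝ}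
    (hT : ∀ J : Finset ι, ∑ k ∈ J, t k ≤ T) {B : Finset ι} (hB : B₀ ⊆ B) {ε : ℝ}
    (hε : ∀ J : Finset ι, Disjoint J B → ∑ k ∈ J, t k ≤ ε) {y : ι → E → ℝ}
    (hy : ∀ i, Measurable (y i)) (py : ∀ i, MemLp (fun ω => y i (ξ i ω)) 2 P)
    (hc : ∀ i, ∫ ω, y i (ξ i ω) ∂P = 0) {M : ℝ} (hM : 0 < M) (I : Finset ι) {c₀ q : ℝ}
    (hc₀ : 0 < c₀) (hq : 0 ≤ q)
    (htrunc : Var[fun ω => ∑ i ∈ I, (y i (ξ i ω) - clamp M (y i (ξ i ω))); P] ≤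
      I.card * (c₀ * q ^ 2))
    (hI : 0 < I.card) (hvar : c₀ * I.card ≤ Var[fun ω => ∑ i ∈ I, y i (ξ i ω); P]) (z : ℝ) :
    ‖∫ ω, Complex.exp (((z * ((∑ i ∈ I, y i (ξ i ω)) /
          √(Var[fun ω => ∑ i ∈ I, y i (ξ i ω); P])) : ℝ) : ℂ) * Complex.I) ∂P -
        Complex.exp (-((z : ℂ) ^ 2) / 2)‖ ≤
      (|z| * q + z ^ 2 * (q ^ 2 + 2 * q)) + 12 * (2 * M) ^ 2 * z ^ 2 * ε / c₀ +
        |z| * (3 * z ^ 2 * B.card ^ 2 * (2 * M) ^ 3 / c₀ +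
          |z| * (B.card * √(64 * (2 * M) ^ 4 * T / c₀))) / √(c₀ * I.card) := by
  set S : 𝓢 → ℝ := fun ω => ∑ i ∈ I, y i (ξ i ω) with hS
  set D : 𝓢 → ℝ := fun ω => ∑ i ∈ I, (y i (ξ i ω) - clamp M (y i (ξ i ω))) with hD
  have hN : (0 : ℝ) < I.card := by exact_mod_cast hI
  have hcN : 0 < c₀ * I.card := by positivity
  have hvS : 0 < Var[S; P] := hcN.trans_le hvar
  have hε0 : 0 ≤ ε := by simpa using hε ∅ (Finset.disjoint_empty_left _)
  have hT0 : 0 ≤ T := by simpa using hT ∅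
  set r := (√(Var[S; P]))⁻¹ with hr
  have hr0 : 0 < r := inv_pos.2 (Real.sqrt_pos.2 hvS)
  have hrS : r ^ 2 * Var[S; P] = 1 := by
    rw [hr, inv_pow, Real.sq_sqrt hvS.le, inv_mul_cancel₀ hvS.ne']
  have hrN : r ^ 2 * I.card ≤ 1 / c₀ := by
    rw [le_div_iff₀ hc₀]
    calc r ^ 2 * I.card * c₀ = r ^ 2 * (c₀ * I.card) := by ring
      _ ≤ r ^ 2 * Var[S; P] := mul_le_mul_of_nonneg_left hvar (sq_nonneg _)
      _ = 1 := hrS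
  have hrle : r ≤ 1 / √(c₀ * I.card) := by
    rw [hr, ← one_div]
    exact one_div_le_one_div_of_le (Real.sqrt_pos.2 hcN) (Real.sqrt_le_sqrt hvar)
  have mY : ∀ i, Measurable fun ω => y i (ξ i ω) := fun i => (hy i).comp (hξ i)
  have iY : ∀ i, Integrable (fun ω => y i (ξ i ω)) P := fun i => (py i).integrable one_le_two
  have mC : ∀ i, Measurable fun ω => clamp M (y i (ξ i ω)) := fun i =>
    (measurable_clamp M).comp (mY i)
  have pC : ∀ i, MemLp (fun ω => clamp M (y i (ξ i ω))) 2 P := fun i =>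
    MemLp.of_bound (mC i).aestronglyMeasurable M (ae_of_all _ fun ω => abs_clamp_le hM.le _)
  have iC : ∀ i, Integrable (fun ω => clamp M (y i (ξ i ω))) P := fun i =>
    (pC i).integrable one_le_two
  have pS : MemLp S 2 P := memLp_finsetSum _ fun i _ => py i
  have pD : MemLp D 2 P := memLp_finsetSum _ fun i _ => (py i).sub (pC i)
  have iD : Integrable D P := pD.integrable one_le_two
  -- Clamping destroys the centring. Restoring it costs a factor 2, so the bounded field has bound
  -- `2 * M`.
  set v : ι → E → ℝ := fun i x => clamp M (y i x) - ∫ ω, clamp M (y i (ξ i ω)) ∂P with hv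
  have mv : ∀ i, Measurable (v i) := fun i =>
    ((measurable_clamp M).comp (hy i)).sub measurable_const
  have bv : ∀ i x, |v i x| ≤ 2 * M := fun i x => by
    have h1 : |∫ ω, clamp M (y i (ξ i ω)) ∂P| ≤ M := by
      have := norm_integral_le_of_norm_le_const (μ := P) (f := fun ω => clamp M (y i (ξ i ω)))
        (C := M) (ae_of_all _ fun ω => abs_clamp_le hM.le _)
      simpa using this
    refine (abs_sub _ _).trans ?_
    linarith [abs_clamp_le hM.le (y i x)]
  have cv : ∀ i, ∫ ω, v i (ξ i ω) ∂P = 0 := fun i => by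
    simp only [hv]
    rw [integral_sub (iC i) (integrable_const _)]
    simp
  have eV : ∀ ω, ∑ i ∈ I, v i (ξ i ω) = (S ω - D ω) - (-∫ ω', D ω' ∂P) := by
    intro ω
    have e1 : ∫ ω', D ω' ∂P = -∑ i ∈ I, ∫ ω', clamp M (y i (ξ i ω')) ∂P := by
      have h1 : ∀ i, Integrable (fun ω => y i (ξ i ω) - clamp M (y i (ξ i ω))) P := fun i =>
        (iY i).sub (iC i)
      change ∫ ω', ∑ i ∈ I, (y i (ξ i ω') - clamp M (y i (ξ i ω'))) ∂P = _
      rw [integral_finsetSum _ fun i _ => h1 i, ← Finset.sum_neg_distrib]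
      refine Finset.sum_congr rfl fun i _ => ?_
      rw [integral_sub (iY i) (iC i), hc i, zero_sub]
    rw [e1, hS, hD]
    simp only [hv, Finset.sum_sub_distrib]
    ring
  -- The truncated sum is `S - D` up to a constant. After normalization `Var D` contributes at most
  -- `q ^ 2`, and by Cauchy–Schwarz the covariance of `S` and `D` at most `2 * q`.
  have vV : |r ^ 2 * Var[fun ω => ∑ i ∈ I, v i (ξ i ω); P] - 1| ≤ q ^ 2 + 2 * q := by
    have e1 : Var[fun ω => ∑ i ∈ I, v i (ξ i ω); P] = Var[S; P] - 2 * cov[S, D; P] + Var[D; P] := by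
      rw [funext eV]
      have := variance_sub_const (μ := P) (X := S - D) (pS.sub pD).aestronglyMeasurable
        (-∫ ω', D ω' ∂P)
      rw [variance_sub pS pD] at this
      exact this
    have hrD : r ^ 2 * Var[D; P] ≤ q ^ 2 := by
      calc r ^ 2 * Var[D; P] ≤ r ^ 2 * (I.card * (c₀ * q ^ 2)) :=
            mul_le_mul_of_nonneg_left htrunc (sq_nonneg _)
        _ = (r ^ 2 * I.card) * (c₀ * q ^ 2) := by ring
        _ ≤ 1 / c₀ * (c₀ * q ^ 2) := by gcongr
        _ = q ^ 2 := by field_simp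
    have hcov : r ^ 2 * |cov[S, D; P]| ≤ q := by
      have h1 := mul_le_mul_of_nonneg_left (abs_covariance_le_sqrt_mul_sqrt pS pD) (sq_nonneg r)
      have h2 : r * √(Var[S; P]) = 1 := inv_mul_cancel₀ (Real.sqrt_pos.2 hvS).ne'
      have h3 : r * √(Var[D; P]) ≤ q := by
        refine abs_le_of_sq_le_sq' ?_ hq |>.2
        rw [mul_pow, Real.sq_sqrt (variance_nonneg _ _)]
        exact hrD
      calc _ ≤ r ^ 2 * (√(Var[S; P]) * √(Var[D; P])) := h1
        _ = (r * √(Var[S; P])) * (r * √(Var[D; P])) := by ring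
        _ = r * √(Var[D; P]) := by rw [h2, one_mul]
        _ ≤ q := h3
    rw [e1]
    have e2 : r ^ 2 * (Var[S; P] - 2 * cov[S, D; P] + Var[D; P]) - 1 =
        r ^ 2 * Var[D; P] - 2 * (r ^ 2 * cov[S, D; P]) := by
      rw [mul_add, mul_sub, hrS]; ring
    have h4 : |r ^ 2 * cov[S, D; P]| ≤ q := by rwa [abs_mul, abs_of_nonneg (sq_nonneg r)]
    have h5 : 0 ≤ r ^ 2 * Var[D; P] := mul_nonneg (sq_nonneg _) (variance_nonneg _ _)
    rw [e2]
    refine (abs_sub _ _).trans ?_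
    rw [abs_of_nonneg h5, abs_mul]
    simp only [Nat.abs_ofNat]
    linarith
  set W : 𝓢 → ℝ := fun ω => r * ∑ i ∈ I, v i (ξ i ω) with hW
  have mW : Measurable W := (Finset.measurable_sum _ fun i _ => (mv i).comp (hξ i)).const_mul r
  have bW : ∀ ω, |W ω| ≤ r * (I.card * (2 * M)) := by
    intro ω
    rw [hW]
    simp only
    rw [abs_mul, abs_of_nonneg hr0.le]
    refine mul_le_mul_of_nonneg_left ((Finset.abs_sum_le_sum_abs _ _).trans ?_) hr0.le
    exact (Finset.sum_le_card_nsmul _ _ _ fun j _ => bv j _).trans_eq (nsmul_eq_mul _ _)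
  set R := 12 * (2 * M) ^ 2 * |z| * ε / c₀ + |z| * (q ^ 2 + 2 * q) +
    (3 * z ^ 2 * B.card ^ 2 * (2 * M) ^ 3 / c₀ +
      |z| * (B.card * √(64 * (2 * M) ^ 4 * T / c₀))) / √(c₀ * I.card) with hR
  have stein : ∀ s : ℝ, |s| ≤ |z| →
      ‖∫ ω, (W ω : ℂ) * Complex.exp (((s * W ω : ℝ) : ℂ) * Complex.I) ∂P -
        (s : ℂ) * Complex.I * ∫ ω, Complex.exp (((s * W ω : ℝ) : ℂ) * Complex.I) ∂P‖ ≤ R := by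
    intro s hs
    refine (h.norm_stein_le hξ ht0 htB hT hB hε mv (by positivity) bv cv I hr0.le s
      (fun ω => rfl)).trans ?_
    have hs2 : s ^ 2 ≤ z ^ 2 := sq_le_sq.2 hs
    have h3 : r ^ 3 * I.card ≤ 1 / c₀ * (1 / √(c₀ * I.card)) := by
      calc r ^ 3 * I.card = (r ^ 2 * I.card) * r := by ring
        _ ≤ _ := by gcongr
    have h4 : r ^ 2 * √(I.card * (64 * (2 * M) ^ 4 * T)) ≤
        √(64 * (2 * M) ^ 4 * T / c₀) * (1 / √(c₀ * I.card)) := by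
      have e1 : r * √(I.card * (64 * (2 * M) ^ 4 * T)) ≤ √(64 * (2 * M) ^ 4 * T / c₀) := by
        refine Real.le_sqrt_of_sq_le ?_
        rw [mul_pow, Real.sq_sqrt (by positivity)]
        calc _ = (r ^ 2 * I.card) * (64 * (2 * M) ^ 4 * T) := by ring
          _ ≤ 1 / c₀ * (64 * (2 * M) ^ 4 * T) := by gcongr
          _ = _ := by ring
      calc _ = (r * √(I.card * (64 * (2 * M) ^ 4 * T))) * r := by ring
        _ ≤ _ := by gcongr
    calc _ ≤ 8 * (2 * M) ^ 2 * |z| * ε * (1 / c₀) +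
          3 * z ^ 2 * B.card ^ 2 * (2 * M) ^ 3 * (1 / c₀ * (1 / √(c₀ * I.card))) +
          |z| * (B.card * (√(64 * (2 * M) ^ 4 * T / c₀) * (1 / √(c₀ * I.card))) +
            (q ^ 2 + 2 * q) + 4 * (2 * M) ^ 2 * ε * (1 / c₀)) := by gcongr
      _ = R := by rw [hR]; ring
  have main := norm_charFun_sub_le_of_stein mW bW stein
  have mS : Measurable S := Finset.measurable_sum _ fun i _ => mY i
  have eSW : ∀ ω, r * S ω - W ω = r * (D ω - ∫ ω', D ω' ∂P) := by
    intro ω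
    rw [hW]
    simp only
    rw [eV ω]
    ring
  have iSW : Integrable (fun ω => |r * S ω - W ω|) P := by
    simp_rw [eSW]
    exact ((iD.sub (integrable_const _)).const_mul r).abs
  have close := norm_integral_cexp_sub_le (P := P) (mS.const_mul r) mW iSW z
  -- The difference is the centred `D` scaled by `r`, whose mean absolute value is at most its
  -- standard deviation.
  have hSW : ∫ ω, |r * S ω - W ω| ∂P ≤ q := by
    have e1 : ∀ ω, |r * S ω - W ω| = r * |D ω - ∫ ω', D ω' ∂P| := fun ω => by
      rw [eSW, abs_mul, abs_of_nonneg hr0.le]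
    simp_rw [e1]
    rw [integral_const_mul]
    refine (mul_le_mul_of_nonneg_left (integral_abs_sub_le_sqrt_variance pD) hr0.le).trans ?_
    refine abs_le_of_sq_le_sq' ?_ hq |>.2
    rw [mul_pow, Real.sq_sqrt (variance_nonneg _ _)]
    calc r ^ 2 * Var[D; P] ≤ r ^ 2 * (I.card * (c₀ * q ^ 2)) :=
          mul_le_mul_of_nonneg_left htrunc (sq_nonneg _)
      _ = (r ^ 2 * I.card) * (c₀ * q ^ 2) := by ring
      _ ≤ 1 / c₀ * (c₀ * q ^ 2) := by gcongr
      _ = q ^ 2 := by field_simp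
  have eT : ∀ ω, (∑ i ∈ I, y i (ξ i ω)) / √(Var[S; P]) = r * S ω := fun ω => by rw [hr, div_eq_inv_mul]
  simp_rw [eT]
  have hz2 : |z| * |z| = z ^ 2 := by rw [← sq, sq_abs]
  calc _ ≤ |z| * q + |z| * R := by
        refine (norm_sub_le_norm_sub_add_norm_sub _ _ _).trans (add_le_add
          (close.trans (mul_le_mul_of_nonneg_left hSW (abs_nonneg _))) main)
    _ = _ := by
        rw [hR, ← hz2]
        ring

/-- **Central limit theorem** for sums over finite sets of sites of a weakly dependent field with
bounded moments of order `2 + δ`, in terms of characteristic functions. -/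
theorem WeaklyDependent.tendsto_charFun (h : WeaklyDependent P ξ t B₀)
    (hξ : ∀ i, Measurable (ξ i)) (h0 : 0 ∈ B₀) {δ : ℝ} (hδ : 0 < δ) {L : ℝ} (ht0 : ∀ k, 0 < t k)
    (ht1 : ∀ k, t k ≤ 1) (htB : ∀ k ∈ B₀, t k = 1)
    (hsum : Summable fun k => t k ^ (δ / (2 + δ))) {y : ι → E → ℝ} (hy : ∀ i, Measurable (y i))
    (iy : ∀ i, Integrable (fun ω => |y i (ξ i ω)| ^ (2 + δ)) P)
    (hL : ∀ i, ∫ ω, |y i (ξ i ω)| ^ (2 + δ) ∂P ≤ L) (hc : ∀ i, ∫ ω, y i (ξ i ω) ∂P = 0)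
    {I : ℕ → Finset ι} (hI : Tendsto (fun n => (I n).card) atTop atTop) {c₀ : ℝ} (hc₀ : 0 < c₀)
    (hvar : ∀ᶠ n in atTop, c₀ * (I n).card ≤ Var[fun ω => ∑ i ∈ I n, y i (ξ i ω); P]) (z : ℝ) :
    Tendsto (fun n => ∫ ω, Complex.exp (((z * ((∑ i ∈ I n, y i (ξ i ω)) /
        √(Var[fun ω => ∑ i ∈ I n, y i (ξ i ω); P])) : ℝ) : ℂ) * Complex.I) ∂P) atTop
      (𝓝 (Complex.exp (-((z : ℂ) ^ 2) / 2))) := by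
  classical
  -- For rates at most 1, the power with exponent `δ / (2 + δ) ≤ 1` dominates the rate itself.
  have hst : Summable t := by
    refine Summable.of_nonneg_of_le (fun k => (ht0 k).le) (fun k => ?_) hsum
    have := Real.rpow_le_rpow_of_exponent_ge (ht0 k) (ht1 k)
      (show δ / (2 + δ) ≤ 1 by rw [div_le_one (by linarith)]; linarith)
    rwa [Real.rpow_one] at this
  rw [Metric.tendsto_atTop']
  intro e he
  -- Choices are made in the order `q`, the level `M`, then `ε` and the neighbourhood `B₀ ∪ B₁`, and
  -- last `n`, since each error constant involves the earlier choices. Each of the three errors is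
  -- at most `e / 3`; as `q ≤ 1`, here `q ^ 2 + 2 * q ≤ 3 * q`.
  set q := min 1 (e / (3 * (|z| + 3 * z ^ 2 + 1))) with hq
  have hq0 : 0 < q := lt_min one_pos (by positivity)
  have hq1 : q ≤ 1 := min_le_left _ _
  have hqe : |z| * q + z ^ 2 * (q ^ 2 + 2 * q) ≤ e / 3 := by
    have h1 : q * (3 * (|z| + 3 * z ^ 2 + 1)) ≤ e := by
      rw [← le_div_iff₀ (by positivity)]
      exact min_le_right _ _
    have h2 : q ^ 2 ≤ q := by nlinarith
    nlinarith [sq_nonneg z, mul_le_mul_of_nonneg_left h2 (sq_nonneg z)]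
  obtain ⟨M, hM, htrunc⟩ := h.exists_variance_truncation_le hξ h0 hδ ht0 ht1 htB hsum hy iy hL
    (η := c₀ * q ^ 2) (by positivity)
  set ε := e * c₀ / (36 * (2 * M) ^ 2 * z ^ 2 + 1) with hε
  have hε0 : 0 < ε := by positivity
  have hεe : 12 * (2 * M) ^ 2 * z ^ 2 * ε / c₀ ≤ e / 3 := by
    rw [hε, div_le_div_iff₀ hc₀ (by norm_num), ← mul_div_assoc, div_mul_eq_mul_div,
      div_le_iff₀ (by positivity)]
    have : 0 ≤ e * c₀ := by positivity
    nlinarith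
  obtain ⟨B₁, hB₁⟩ := summable_iff_vanishing_norm.1 hst ε hε0
  have hB : ∀ J : Finset ι, Disjoint J (B₀ ∪ B₁) → ∑ k ∈ J, t k ≤ ε := fun J hJ =>
    (le_abs_self _).trans (hB₁ J (hJ.mono_right Finset.subset_union_right)).le
  set K := |z| * (3 * z ^ 2 * (B₀ ∪ B₁).card ^ 2 * (2 * M) ^ 3 / c₀ +
    |z| * ((B₀ ∪ B₁).card * √(64 * (2 * M) ^ 4 * (∑' k, t k) / c₀))) with hK
  have hlim : Tendsto (fun n => K / √(c₀ * (I n).card)) atTop (𝓝 0) := by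
    refine Tendsto.div_atTop tendsto_const_nhds (Real.tendsto_sqrt_atTop.comp ?_)
    exact (tendsto_natCast_atTop_atTop.comp hI).const_mul_atTop hc₀
  have hev := ((hlim.eventually_lt_const (show (0 : ℝ) < e / 3 by positivity)).and hvar).and
    (hI.eventually_gt_atTop 0)
  obtain ⟨n₀, hn₀⟩ := eventually_atTop.1 hev
  refine ⟨n₀, fun n hn => ?_⟩
  obtain ⟨⟨h1, h2⟩, h3⟩ := hn₀ n hn.le
  have mY : ∀ i, Measurable fun ω => y i (ξ i ω) := fun i => (hy i).comp (hξ i)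
  rw [dist_eq_norm]
  refine (h.norm_charFun_sub_le hξ (fun k => (ht0 k).le) htB
    (fun J => hst.sum_le_tsum J fun k _ => (ht0 k).le) Finset.subset_union_left hB hy
    (fun i => memLp_two_of_integrable_rpow (mY i) (by linarith) (iy i)) hc hM (I n) hc₀ hq0.le
    (htrunc (I n)) h3 h2 z).trans_lt ?_
  rw [← hK]
  linarith

end CLT

end AssocPP

namespace AssocPP

/-! ### Summable power rates on the lattice `ℤ^d` -/

section Lattice

variable {d : ℕ}

/-- The integer points span a lattice of rank `d` in `ℝ^d`, for which the corresponding sum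
converges. -/
lemma summable_norm_rpow_int_pi {p : ℝ} (hp : (d : ℝ) < p) :
    Summable fun k : Fin d → ℤ => ‖k‖ ^ (-p) := by
  set L : Submodule ℤ (Fin d → ℝ) := Submodule.span ℤ (Set.range (Pi.basisFun ℝ (Fin d))) with hL
  have hr : Module.finrank ℤ L = d := by
    rw [ZLattice.rank ℝ L]
    simp
  have hmem : ∀ k : Fin d → ℤ, (fun i => (k i : ℝ)) ∈ L := by
    intro k
    rw [hL, (Pi.basisFun ℝ (Fin d)).mem_span_iff_repr_mem ℤ]
    intro i
    exact ⟨k i, by simp⟩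
  have h := ZLattice.summable_norm_rpow L (-p) (by rw [hr]; linarith)
  have hinj : Function.Injective fun k : Fin d → ℤ => (⟨fun i => (k i : ℝ), hmem k⟩ : L) := by
    intro k l hkl
    funext i
    have := congrFun (congrArg Subtype.val hkl) i
    simpa using this
  refine (h.comp_injective hinj).congr fun k => ?_
  rfl

/-- A power decay rate on `ℤ^d`, flattened to `1` on a finite set of sites. -/
lemma exists_summable_rate {β q C K : ℝ} (hβ : 0 < β) (hq : (d : ℝ) < β * q) (hC : 0 ≤ C) :
    ∃ (t : (Fin d → ℤ) → ℝ) (B₀ : Finset (Fin d → ℤ)), 0 ∈ B₀ ∧ (∀ k, 0 < t k) ∧ (∀ k, t k ≤ 1) ∧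
      (∀ k ∈ B₀, t k = 1) ∧ (Summable fun k => t k ^ q) ∧
      ∀ k ∉ B₀, K ≤ ‖k‖ ∧ C * ‖k‖ ^ (-β) ≤ t k := by
  classical
  -- The added 1 keeps the rate positive even if `C = 0`. The radius `N` below is large enough for
  -- `D * ‖k‖ ^ (-β) ≤ 1` outside the ball.
  set D := C + 1 with hD
  have hD0 : 0 < D := by positivity
  set N := max 1 (max K (D ^ β⁻¹)) with hN
  have hN1 : 1 ≤ N := le_max_left _ _
  set B₀ := (isCompact_closedBall (0 : Fin d → ℤ) N).finite_of_discrete.toFinset with hB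
  have hmem : ∀ k, k ∈ B₀ ↔ ‖k‖ ≤ N := fun k => by simp [hB]
  have hpos : ∀ k ∉ B₀, 0 < ‖k‖ := fun k hk => by
    rw [hmem, not_le] at hk
    linarith
  refine ⟨fun k => if k ∈ B₀ then 1 else D * ‖k‖ ^ (-β), B₀, ?_, ?_, ?_, ?_, ?_, ?_⟩
  · rw [hmem, norm_zero]
    linarith
  · intro k
    dsimp only
    split_ifs with hk
    · exact one_pos
    · have := hpos k hk
      positivity
  · intro k
    dsimp only
    split_ifs with hk
    · exact le_rfl
    · have h0 := hpos k hk
      rw [hmem, not_le] at hk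
      have h1 : D ^ β⁻¹ ≤ ‖k‖ := ((le_max_right _ _).trans (le_max_right _ _)).trans hk.le
      have h2 : D ≤ ‖k‖ ^ β := by
        have := Real.rpow_le_rpow (by positivity) h1 hβ.le
        rwa [← Real.rpow_mul hD0.le, inv_mul_cancel₀ hβ.ne', Real.rpow_one] at this
      rw [Real.rpow_neg h0.le, ← div_eq_mul_inv]
      exact div_le_one_of_le₀ h2 (by positivity)
  · intro k hk
    exact if_pos hk
  · have h1 := (summable_norm_rpow_int_pi (d := d) hq).mul_left (D ^ q)
    refine h1.congr_cofinite ?_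
    filter_upwards [B₀.finite_toSet.compl_mem_cofinite] with k hk
    have hk' : k ∉ B₀ := hk
    rw [if_neg hk', Real.mul_rpow hD0.le (by positivity), ← Real.rpow_mul (norm_nonneg _),
      neg_mul]
  · intro k hk
    have h0 := hpos k hk
    refine ⟨?_, ?_⟩
    · rw [hmem, not_le] at hk
      exact ((le_max_left _ _).trans (le_max_right _ _)).trans hk.le
    · dsimp only
      rw [if_neg hk]
      gcongr
      linarith

end Lattice

/-! ### Geometry of the cubes -/

section Cube

variable {d : ℕ}

lemma measurableSet_cube (R s : ℝ) (i : Fin d → ℤ) : MeasurableSet (cube R s i) := by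
  refine IsClosed.measurableSet ?_
  simp only [cube, Set.ofPred_forall]
  exact isClosed_iInter fun k => isClosed_le (by fun_prop) continuous_const

lemma isBounded_cube {R s : ℝ} (hs : 0 ≤ s) (i : Fin d → ℤ) :
    Bornology.IsBounded (cube R s i) := by
  refine ((PiLp.antilipschitzWith_ofLp 2 (fun _ : Fin d => ℝ)).isBounded_preimage
    (Metric.isBounded_closedBall (x := fun k => R * (i k : ℝ)) (r := s / 2))).subset ?_
  intro x hx
  rw [Set.mem_preimage, mem_closedBall_iff_norm, pi_norm_le_iff_of_nonneg (by positivity)]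
  exact hx

lemma volume_cube (R s : ℝ) (i : Fin d → ℤ) :
    volume (cube R s i) = volume (cube R s (0 : Fin d → ℤ)) := by
  rw [← measure_preimage_add_right volume
    (-(WithLp.toLp 2 fun k => R * (i k : ℝ)) : EuclideanSpace ℝ (Fin d)) (cube R s 0)]
  congr 1
  ext x
  simp [cube, sub_eq_add_neg]

/-- In each coordinate the points are within `s / 2` of the centres, and the Euclidean norm
dominates the sup norm, which is the norm on `ℤ^d`. -/
lemma mul_norm_sub_le_of_mem_cube {R s : ℝ} (hR : 0 < R) (hs : 0 ≤ s) {i j : Fin d → ℤ}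
    {x y : EuclideanSpace ℝ (Fin d)} (hx : x ∈ cube R s i) (hy : y ∈ cube R s j) :
    R * ‖i - j‖ - s ≤ ‖x - y‖ := by
  have h : ‖i - j‖ ≤ (‖x - y‖ + s) / R := by
    refine (pi_norm_le_iff_of_nonneg (by positivity)).2 fun k => ?_
    rw [le_div_iff₀ hR, Pi.sub_apply, Int.norm_eq_abs]
    have h1 := hx k
    have h2 := hy k
    have h3 : |x k - y k| ≤ ‖x - y‖ := by
      have := PiLp.norm_apply_le (x - y) k
      simpa using this
    have h4 : |R * ((i k : ℝ) - (j k : ℝ))| = |((i k - j k : ℤ) : ℝ)| * R := by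
      rw [abs_mul, abs_of_pos hR, mul_comm]
      push_cast
      rfl
    rw [← h4]
    rw [abs_le] at h1 h2 h3 ⊢
    constructor <;> nlinarith
  rw [le_div_iff₀ hR] at h
  linarith

end Cube

/-! ### From the point process to the weakly dependent field, and Lévy's theorem -/

section Assembly

variable {d : ℕ} {𝓢 : Type*} [MeasurableSpace 𝓢] {P : Measure 𝓢} {X : 𝓢 → Config d}

lemma exists_abs_le_rpow_of_tendsto_supBeyond
    {D : EuclideanSpace ℝ (Fin d) → EuclideanSpace ℝ (Fin d) → ℝ} {β : ℝ}
    (h : Tendsto (fun r : ℝ => ENNReal.ofReal (r ^ β) * supBeyond D r) atTop (𝓝 0)) :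
    ∃ r₀ : ℝ, 0 < r₀ ∧ ∀ r, r₀ ≤ r → ∀ x y, r ≤ ‖x - y‖ → |D x y| ≤ r ^ (-β) := by
  obtain ⟨r₁, hr₁⟩ := eventually_atTop.1 (h.eventually_lt_const one_pos)
  refine ⟨max 1 r₁, lt_max_of_lt_left one_pos, fun r hr x y hxy => ?_⟩
  have hr0 : 0 < r := one_pos.trans_le ((le_max_left _ _).trans hr)
  have h1 : ENNReal.ofReal (r ^ β) * ENNReal.ofReal |D x y| ≤ 1 := by
    refine le_trans ?_ (hr₁ r ((le_max_right _ _).trans hr)).le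
    gcongr
    exact le_iSup₂_of_le x y (le_iSup_of_le hxy le_rfl)
  rw [← ENNReal.ofReal_mul (by positivity), ENNReal.ofReal_le_one] at h1
  rw [Real.rpow_neg hr0.le, ← one_div, le_div_iff₀ (by positivity), mul_comm]
  exact h1

/-- The restrictions of an associated point process to far apart sets are weakly dependent. -/
theorem weaklyDependent_restrict [IsProbabilityMeasure P] (hX : Measurable X)
    (hassoc : IsAssociated X P) {ρ₁ : (Fin 1 → EuclideanSpace ℝ (Fin d)) → ℝ}
    {ρ₂ : (Fin 2 → EuclideanSpace ℝ (Fin d)) → ℝ} (hρ₁ : IsIntensity X P 1 ρ₁)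
    (hρ₂ : IsIntensity X P 2 ρ₂) {ι : Type*} [AddCommGroup ι]
    {C : ι → Set (EuclideanSpace ℝ (Fin d))} (hC : ∀ i, MeasurableSet (C i))
    (hCb : ∀ i, Bornology.IsBounded (C i)) {t : ι → ℝ} {B₀ : Finset ι}
    (hdisj : ∀ i j, i - j ∉ B₀ → Disjoint (C i) (C j)) {g : ι → ι → ℝ} (hg0 : ∀ i j, 0 ≤ g i j)
    (hg : ∀ i j, i - j ∉ B₀ → ∀ x ∈ C i, ∀ y ∈ C j, |pairCov ρ₁ ρ₂ x y| ≤ g i j)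
    (hgt : ∀ i j, i - j ∉ B₀ →
      g i j * (volume (C i)).toReal * (volume (C j)).toReal ≤ t (i - j)) :
    WeaklyDependent P (fun i ω => (X ω).restrict (C i)) t B₀ := by
  intro u hu M hM0 hM J J' hJ F G hFm hGm a b ha hb hF hG
  have hξ : ∀ i, Measurable fun ω => (X ω).restrict (C i) := fun i =>
    (Config.measurable_restrict (hC i)).comp hX
  have mem : ∀ (Q : Finset ι) (H : (ι → ℝ) → ℝ) (e : ι → ℝ), Measurable H → (∀ i, 0 ≤ e i) →
      (∀ v w : ι → ℝ, (∀ i, |v i| ≤ M) → (∀ i, |w i| ≤ M) →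
        |H v - H w| ≤ ∑ i ∈ Q, e i * |v i - w i|) →
      MemLp (fun ω => H fun i => u i ((X ω).restrict (C i))) 2 P := by
    intro Q H e hH he hLip
    refine MemLp.of_bound (C := |H 0| + ∑ i ∈ Q, e i * M)
      (hH.comp (measurable_pi_lambda _ fun i => (hu i).comp (hξ i))).aestronglyMeasurable
      (ae_of_all _ fun ω => ?_)
    have h1 := hLip (fun i => u i ((X ω).restrict (C i))) 0 (fun i => hM i _)
      (fun i => by simpa using hM0)
    have h2 : ∑ i ∈ Q, e i * |u i ((X ω).restrict (C i)) - (0 : ι → ℝ) i| ≤ ∑ i ∈ Q, e i * M :=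
      Finset.sum_le_sum fun i _ => mul_le_mul_of_nonneg_left (by simpa using hM i _) (he i)
    have h3 := abs_sub_abs_le_abs_sub (H fun i => u i ((X ω).restrict (C i))) (H 0)
    rw [Real.norm_eq_abs]
    linarith
  have hcov := covariance_eq_sub (mem J F a hFm ha hF) (mem J' G b hGm hb hG)
  rw [hcov]
  refine (abs_crossCov_restrict_le hX hassoc hρ₁ hρ₂ hC hCb hu hM0 hM
    (fun i hi j hj => hdisj i j (hJ i hi j hj)) hg0 (fun i hi j hj => hg i j (hJ i hi j hj))
    hFm hGm ha hb hF hG).trans ?_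
  refine mul_le_mul_of_nonneg_left (Finset.sum_le_sum fun i hi => Finset.sum_le_sum fun j hj => ?_)
    (sq_nonneg _)
  exact mul_le_mul_of_nonneg_left (hgt i j (hJ i hi j hj)) (mul_nonneg (ha i) (hb j))

/-- The restrictions of an associated point process with decaying pair covariance to the cubes of a
lattice form a weakly dependent field with summable rate. -/
theorem exists_weaklyDependent_cube [IsProbabilityMeasure P] (hX : Measurable X)
    (hassoc : IsAssociated X P) {ρ₁ : (Fin 1 → EuclideanSpace ℝ (Fin d)) → ℝ}
    {ρ₂ : (Fin 2 → EuclideanSpace ℝ (Fin d)) → ℝ} (hρ₁ : IsIntensity X P 1 ρ₁)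
    (hρ₂ : IsIntensity X P 2 ρ₂) {R s : ℝ} (hR : 0 < R) (hs : 0 < s) {β q : ℝ} (hβ : 0 < β)
    (hq : (d : ℝ) < β * q)
    (hdecay : Tendsto (fun r : ℝ => ENNReal.ofReal (r ^ β) * supBeyond (pairCov ρ₁ ρ₂) r) atTop
      (𝓝 0)) :
    ∃ (t : (Fin d → ℤ) → ℝ) (B₀ : Finset (Fin d → ℤ)), 0 ∈ B₀ ∧ (∀ k, 0 < t k) ∧ (∀ k, t k ≤ 1) ∧
      (∀ k ∈ B₀, t k = 1) ∧ (Summable fun k => t k ^ q) ∧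
      WeaklyDependent P (fun i ω => (X ω).restrict (cube R s i)) t B₀ := by
  obtain ⟨r₀, hr₀, hD⟩ := exists_abs_le_rpow_of_tendsto_supBeyond hdecay
  set V := (volume (cube R s (0 : Fin d → ℤ))).toReal with hV
  have hV0 : 0 ≤ V := ENNReal.toReal_nonneg
  obtain ⟨t, B₀, h0, ht0, ht1, htB, hsum, hfar⟩ := exists_summable_rate (d := d)
    -- Off `B₀` this `K` gives `R / 2 * ‖i - j‖ ≥ max s r₀`. Then points of the two cubes are at
    -- least `R / 2 * ‖i - j‖` apart, which is positive, so the cubes are disjoint, and is in the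
    -- range where the decay bound holds.
    (C := (R / 2) ^ (-β) * V * V) (K := 2 * max s r₀ / R) hβ hq (by positivity)
  have dist : ∀ i j : Fin d → ℤ, i - j ∉ B₀ → ∀ x ∈ cube R s i, ∀ y ∈ cube R s j,
      max s r₀ ≤ R / 2 * ‖i - j‖ ∧ R / 2 * ‖i - j‖ ≤ ‖x - y‖ := by
    intro i j hij x hx y hy
    have h1 := mul_norm_sub_le_of_mem_cube hR hs.le hx hy
    have h2 := (hfar _ hij).1
    rw [div_le_iff₀ hR] at h2
    have h3 := le_max_left s r₀
    constructor <;> linarith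
  refine ⟨t, B₀, h0, ht0, ht1, htB, hsum, weaklyDependent_restrict hX hassoc hρ₁ hρ₂
    (fun i => measurableSet_cube R s i) (fun i => isBounded_cube hs.le i) ?_
    (g := fun i j => (R / 2 * ‖i - j‖) ^ (-β)) (fun i j => by positivity) ?_ ?_⟩
  · intro i j hij
    refine Set.disjoint_left.2 fun x hx hx' => ?_
    obtain ⟨h1, h2⟩ := dist i j hij x hx x hx'
    rw [sub_self, norm_zero] at h2
    have := le_max_left s r₀
    linarith
  · intro i j hij x hx y hy
    obtain ⟨h1, h2⟩ := dist i j hij x hx y hy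
    exact hD _ ((le_max_right _ _).trans h1) x y h2
  · intro i j hij
    rw [volume_cube R s i, volume_cube R s j, ← hV]
    refine le_of_eq_of_le ?_ (hfar _ hij).2
    rw [Real.mul_rpow (by positivity) (norm_nonneg _)]
    ring

lemma integral_abs_rpow_le_of_eLpNorm_le {Y : 𝓢 → ℝ} (hY : Measurable Y) {p : ℝ} (hp : 0 < p)
    {K : ℝ≥0∞} (hK : K < ∞) (h : eLpNorm Y (ENNReal.ofReal p) P ≤ K) :
    Integrable (fun ω => |Y ω| ^ p) P ∧ ∫ ω, |Y ω| ^ p ∂P ≤ K.toReal ^ p := by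
  have hL : MemLp Y (ENNReal.ofReal p) P := ⟨hY.aestronglyMeasurable, h.trans_lt hK⟩
  have hp0 : ENNReal.ofReal p ≠ 0 := by simpa using hp
  have h1 := hL.integrable_norm_rpow hp0 ENNReal.ofReal_ne_top
  have h2 := hL.eLpNorm_eq_integral_rpow_norm hp0 ENNReal.ofReal_ne_top
  simp only [ENNReal.toReal_ofReal hp.le, Real.norm_eq_abs] at h1 h2
  refine ⟨h1, ?_⟩
  have h0 : 0 ≤ ∫ ω, |Y ω| ^ p ∂P := integral_nonneg fun ω => by positivity
  rw [h2, ENNReal.ofReal_le_iff_le_toReal hK.ne] at h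
  have h3 := Real.rpow_le_rpow (by positivity) h hp.le
  rwa [← Real.rpow_mul h0, inv_mul_cancel₀ hp.ne', Real.rpow_one] at h3

/-- Integrability of the centred variable implies that of `Z`, as they differ by a constant, so the
subtracted integral is a genuine mean. -/
lemma integral_sub_integral_eq_zero [IsProbabilityMeasure P] {Z : 𝓢 → ℝ}
    (h : Integrable (fun ω => Z ω - ∫ ω', Z ω' ∂P) P) :
    ∫ ω, (Z ω - ∫ ω', Z ω' ∂P) ∂P = 0 := by
  have hZ : Integrable Z P := by
    refine (h.add (integrable_const (∫ ω', Z ω' ∂P))).congr (ae_of_all _ fun ω => ?_)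
    simp
  rw [integral_sub hZ (integrable_const _)]
  simp

lemma exists_eventually_mul_card_le {α : Type*} {I : ℕ → Finset α} {v : ℕ → ℝ} (hv : ∀ n, 0 ≤ v n)
    (h : 0 < liminf (fun n => ((v n / ((I n).card : ℝ) : ℝ) : EReal)) atTop) :
    ∃ c : ℝ, 0 < c ∧ ∀ᶠ n in atTop, c * (I n).card ≤ v n := by
  obtain ⟨c, hc0, hc⟩ := EReal.lt_iff_exists_real_btwn.1 h
  refine ⟨c, by exact_mod_cast hc0, ?_⟩
  filter_upwards [eventually_lt_of_lt_liminf hc] with n hn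
  have hn' : c < v n / ((I n).card : ℝ) := by exact_mod_cast hn
  rcases (Nat.cast_nonneg (α := ℝ) (I n).card).eq_or_lt with h0 | h0
  · rw [← h0, mul_zero]
    exact hv n
  · exact ((lt_div_iff₀ h0).1 hn').le

/-- Lévy's continuity theorem. -/
lemma tendstoInDistribution_gaussianReal_of_tendsto_integral_cexp [IsProbabilityMeasure P]
    {Z : ℕ → 𝓢 → ℝ} (hZ : ∀ n, Measurable (Z n))
    (h : ∀ z : ℝ, Tendsto (fun n => ∫ ω, Complex.exp (((z * Z n ω : ℝ) : ℂ) * Complex.I) ∂P) atTop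
      (𝓝 (Complex.exp (-((z : ℂ) ^ 2) / 2)))) :
    TendstoInDistribution Z atTop (id : ℝ → ℝ) (fun _ => P) (gaussianReal 0 1) where
  forall_aemeasurable := fun n => (hZ n).aemeasurable
  aemeasurable_limit := aemeasurable_id
  tendsto := by
    refine ProbabilityMeasure.tendsto_iff_tendsto_charFun.2 fun z => ?_
    simp only [ProbabilityMeasure.coe_mk, Measure.map_id, charFun_gaussianReal]
    convert h z using 2 with n
    · rw [charFun_apply_real, integral_map (hZ n).aemeasurable (by fun_prop)]
      push_cast
      rfl
    · simp
      ring_nf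

end Assembly

end AssocPP

theorem theorem3p1 {d : ℕ} {𝓢 : Type*} [MeasurableSpace 𝓢]
    (P : Measure 𝓢) [IsProbabilityMeasure P]
    (X : 𝓢 → AssocPP.Config d) (hX : Measurable X)
    (R s : ℝ) (hR : 0 < R) (hs : R ≤ s)
    (f : (Fin d → ℤ) → AssocPP.Config d → ℝ) (hf : ∀ i, Measurable (f i))
    (I : ℕ → Finset (Fin d → ℤ)) (hI : StrictMono I)
    (ε δ : ℝ) (hε : 0 < ε) (hδ : 0 < δ)
    (hassoc : AssocPP.IsAssociated X P)
    (ρ₁ : (Fin 1 → EuclideanSpace ℝ (Fin d)) → ℝ) (hρ₁ : AssocPP.IsIntensity X P 1 ρ₁)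
    (ρ₂ : (Fin 2 → EuclideanSpace ℝ (Fin d)) → ℝ) (hρ₂ : AssocPP.IsIntensity X P 2 ρ₂)
    (hmoment : ⨆ i, eLpNorm (AssocPP.field X P R s f i) (ENNReal.ofReal (2 + δ)) P < ∞)
    (hdecay : Tendsto
      (fun r : ℝ => ENNReal.ofReal (r ^ (((d : ℝ) + ε) * ((2 + δ) / δ)))
        * AssocPP.supBeyond (AssocPP.pairCov ρ₁ ρ₂) r) atTop (𝓝 0))
    (hvar : 0 < liminf
      (fun n => ((Var[AssocPP.fieldSum X P R s f (I n); P] / ((I n).card : ℝ) : ℝ) : EReal))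
      atTop) :
    TendstoInDistribution
      (fun n ω => AssocPP.fieldSum X P R s f (I n) ω
        / √(Var[AssocPP.fieldSum X P R s f (I n); P]))
      atTop (id : ℝ → ℝ) (fun _ => P) (gaussianReal 0 1) := by
  have hs0 : 0 < s := hR.trans_le hs
  obtain ⟨t, B₀, h0, ht0, ht1, htB, hsum, hweak⟩ :=
    AssocPP.exists_weaklyDependent_cube (β := ((d : ℝ) + ε) * ((2 + δ) / δ)) (q := δ / (2 + δ))
      hX hassoc hρ₁ hρ₂ hR hs0 (by positivity)
      (by
        -- Davydov's exponent `δ / (2 + δ)` turns the decay exponent of `D` into `d + ε`, just above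
        -- the threshold of summability on `ℤ^d`.
        have h1 : ((d : ℝ) + ε) * ((2 + δ) / δ) * (δ / (2 + δ)) = d + ε := by field_simp
        rw [h1]
        linarith)
      hdecay
  have hξ : ∀ i, Measurable fun ω => (X ω).restrict (AssocPP.cube R s i) := fun i =>
    (AssocPP.Config.measurable_restrict (AssocPP.measurableSet_cube R s i)).comp hX
  have hY : ∀ i, Measurable (AssocPP.field X P R s f i) := fun i =>
    ((hf i).comp (hξ i)).sub measurable_const
  have hmom := fun i => AssocPP.integral_abs_rpow_le_of_eLpNorm_le (hY i)
    (show 0 < 2 + δ by positivity) hmoment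
    (le_iSup (fun i => eLpNorm (AssocPP.field X P R s f i) (ENNReal.ofReal (2 + δ)) P) i)
  have hcentred : ∀ i, ∫ ω, AssocPP.field X P R s f i ω ∂P = 0 := fun i =>
    AssocPP.integral_sub_integral_eq_zero
      ((AssocPP.memLp_two_of_integrable_rpow (hY i) (by linarith) (hmom i).1).integrable
        one_le_two)
  obtain ⟨c, hc0, hc⟩ := AssocPP.exists_eventually_mul_card_le
    (fun n => variance_nonneg (AssocPP.fieldSum X P R s f (I n)) P) hvar
  -- Cardinalities of strictly increasing finite sets form a strictly increasing sequence of
  -- integers.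
  have hcard : Tendsto (fun n => (I n).card) atTop atTop :=
    (Finset.card_strictMono.comp hI).tendsto_atTop
  refine AssocPP.tendstoInDistribution_gaussianReal_of_tendsto_integral_cexp
    (fun n => (Finset.measurable_sum _ fun i _ => hY i).div_const _) fun z => ?_
  exact hweak.tendsto_charFun hξ h0 hδ ht0 ht1 htB hsum
    (y := fun i x => f i x - ∫ ω', f i ((X ω').restrict (AssocPP.cube R s i)) ∂P)
    (fun i => (hf i).sub measurable_const) (fun i => (hmom i).1) (fun i => (hmom i).2) hcentred
    hcard hc0 hc z
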